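/- Let $\mathbf k$ be a field and let $K$ be a simplicial complex on the vertex set $[m]=\{1,\dots,m\}$ (the empty set is counted as a simplex). *Algebraic side.* Let $\mathbf k(K)=\mathbf k[v_1,\dots,v_m]/(v_{i_1}\cdots v_{i_s}: \{i_1,\dots,i_s\}\notin K)$ be the face ring. The Koszul complex $\mathbf k(K)\otimes\Lambda[u_1,\dots,u_m]$, with $\deg v_i=2$, $\deg u_i=1$, has the differential $d$ given by $dv_i=0$, $du_i=v_i$ and the Leibniz rule. For $I,J\subset[m]$ put $v_I=\prod_{i\in I}v_i$ and $u_J=u_{j_1}\cdots u_{j_q}$ where $J=\{j_1<\dots<j_q\}$. Let $\mathcal C^*(K)$ be the subcomplex spanned by all $v_Iu_J$ with $I\in K$, $I\cap J=\varnothing$. The Koszul algebra is the direct sum of $\mathcal C^*(K)$ and the ideal generated by all $v_i^2$ and $v_iu_i$; let $j$ be the projection onto $\mathcal C^*(K)$ along this ideal. The product in $\mathcal C^*(K)$ is $x\cdot y=j(xy)$, and its grading is the total degree of the Koszul complex. *Topological side.* Let $D^2\subset\mathbb C$ be the closed unit disk and let $$\mathcal Z_K=\bigcup_{J\in K}\{z\in(D^2)^m:\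 |z_j|=1\text{ for }j\notin J\}.$$ Decompose $D^2$ into the point $1$, the open $1$-cell $T=\{|z|=1,\ z\ne1\}$ and the open $2$-cell $D=\{|z|<1\}$, with $T$ oriented counterclockwise and $D$ oriented as a domain in $\mathbb C$. This gives the decomposition of $(D^2)^m$ into the $3^m$ product cells $D_IT_J$ ($I,J\subset[m]$, $I\cap J=\varnothing$), with the factor $D$ in the coordinates of $I$, $T$ in those of $J$ and $1$ elsewhere, oriented as products in the order of the coordinates; $\dim D_IT_J=2\,\#I+\#J$. Let $\mathcal C_*(\mathcal Z_K)$ be the cellular chain complex over $\mathbf k$ of the subcomplex $\mathcal Z_K$: its basis consists of the cells contained in $\mathcal Z_K$, and the coefficient of a cell $e'$ in $\partial e$ is the degree over $e'$ of the attaching map of $e$. Let $\mathcal C^*(\mathcal Z_K)$ be the dual cochain complex, graded by dimension, with differential $d_c\varphi=\varphi\circ\partial$, and let $(D_IT_J)^*$ be the elements of the dual basis. Its product is $(ab)(e)=(a\times b)(\widetilde\Delta_*e)$, where $(a\times b)(e'\times e'')=a(e')\,b(e'')$ and $\widetilde\Delta_*:\mathcal C_*(\mathcal Z_K)\to\mathcal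 C_*(\mathcal Z_K\times\mathcal Z_K)$ is the chain map induced by the following cellular approximation $\widetilde\Delta$ of the diagonal $\mathcal Z_K\to\mathcal Z_K\times\mathcal Z_K$: in each coordinate, $$\rho e^{i\varphi}\longmapsto\begin{cases}\bigl(1+\rho(e^{2i\varphi}-1),\,1\bigr),&0\le\varphi\le\pi,\\ \bigl(1,\,1+\rho(e^{2i\varphi}-1)\bigr),&\pi\le\varphi\le2\pi.\end{cases}$$ Its unit is the cochain with value $1$ on every $0$-cell. **Theorem.** The cell $D_IT_J$ is contained in $\mathcal Z_K$ if and only if $I\in K$. Both $\mathcal C^*(K)$ and $\mathcal C^*(\mathcal Z_K)$ are associative unital differential graded algebras over $\mathbf k$, and there is exactly one isomorphism of differential graded algebras $$\mathcal C^*(K)\ \xrightarrow{\ \cong\ }\ \mathcal C^*(\mathcal Z_K)$$ with $v_Iu_J\mapsto(D_IT_J)^*$ for all $I\in K$ and $J\subset[m]$ with $I\cap J=\varnothing$. -/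

import Mathlib

open scoped TensorProduct

namespace MomentAngle

section DGA

/-- The data of a differential graded algebra on a `k`-module: unit, product, differential and
homogeneous parts. The axioms are in `PreDGA.IsDGA`. -/
structure PreDGA (k A : Type*) [Field k] [AddCommGroup A] [Module k A] where
  one : A
  mul : A →ₗ[k] A →ₗ[k] A
  d : A →ₗ[k] A
  deg : ℕ → Submodule k A

/-- The axioms of an associative unital differential graded algebra, with differential of degree
`+1`. -/
structure PreDGA.IsDGA {k A : Type*} [Field k] [AddCommGroup A] [Module k A]
    (X : PreDGA k A) : Prop where
  isInternal : DirectSum.IsInternal X.deg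
  one_mem : X.one ∈ X.deg 0
  mul_mem : ∀ p q, ∀ a ∈ X.deg p, ∀ b ∈ X.deg q, X.mul a b ∈ X.deg (p + q)
  one_mul : ∀ a, X.mul X.one a = a
  mul_one : ∀ a, X.mul a X.one = a
  mul_assoc : ∀ a b c, X.mul (X.mul a b) c = X.mul a (X.mul b c)
  d_mem : ∀ p, ∀ a ∈ X.deg p, X.d a ∈ X.deg (p + 1)
  d_d : ∀ a, X.d (X.d a) = 0
  leibniz : ∀ p, ∀ a ∈ X.deg p, ∀ b,
    X.d (X.mul a b) = X.mul (X.d a) b + (-1 : k) ^ p • X.mul a (X.d b)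

/-- A linear isomorphism is an isomorphism of differential graded algebras. -/
structure PreDGA.IsIso {k A B : Type*} [Field k] [AddCommGroup A] [Module k A] [AddCommGroup B]
    [Module k B] (X : PreDGA k A) (Y : PreDGA k B) (φ : A ≃ₗ[k] B) : Prop where
  map_one : φ X.one = Y.one
  map_mul : ∀ a b, φ (X.mul a b) = Y.mul (φ a) (φ b)
  map_d : ∀ a, φ (X.d a) = Y.d (φ a)
  map_deg : ∀ n, (X.deg n).map φ.toLinearMap = Y.deg n

end DGA

/-- `I` is a simplex of `K`; the empty set counts as a simplex. -/
def IsSimplex {m : ℕ} (K : AbstractSimplicialComplex (Fin m)) (I : Finset (Fin m)) : Prop :=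
  I = ∅ ∨ I ∈ K

section Koszul

variable (k : Type*) [Field k] {m : ℕ} (K : AbstractSimplicialComplex (Fin m))

/-- The Stanley–Reisner ideal: generated by the square-free monomials `∏_{i ∈ I} v_i`, `I ∉ K`. -/
noncomputable def faceIdeal : Ideal (MvPolynomial (Fin m) k) :=
  Ideal.span {p | ∃ I : Finset (Fin m), ¬ IsSimplex K I ∧ p = ∏ i ∈ I, MvPolynomial.X i}

/-- The face ring (Stanley–Reisner ring) `k(K) = k[v_1, …, v_m] / faceIdeal`. -/
def FaceRing : Type _ := MvPolynomial (Fin m) k ⧸ faceIdeal k K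

noncomputable instance : CommRing (FaceRing k K) :=
  inferInstanceAs (CommRing (MvPolynomial (Fin m) k ⧸ faceIdeal k K))

noncomputable instance : Algebra k (FaceRing k K) :=
  inferInstanceAs (Algebra k (MvPolynomial (Fin m) k ⧸ faceIdeal k K))

/-- The quotient map `k[v_1, …, v_m] → k(K)`. -/
noncomputable def faceMk : MvPolynomial (Fin m) k →ₐ[k] FaceRing k K :=
  Ideal.Quotient.mkₐ k (faceIdeal k K)

lemma faceMk_surjective : Function.Surjective (faceMk k K) :=
  Ideal.Quotient.mkₐ_surjective k (faceIdeal k K)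

lemma faceMk_eq_zero_iff (p : MvPolynomial (Fin m) k) : faceMk k K p = 0 ↔ p ∈ faceIdeal k K :=
  Ideal.Quotient.eq_zero_iff_mem

/-- The Koszul algebra `k(K) ⊗ Λ[u_1, …, u_m]`. As the `v_i` have even degree, no signs occur in the
product of the tensor product of algebras. -/
abbrev Koszul : Type _ := FaceRing k K ⊗[k] ExteriorAlgebra k (Fin m → k)

/-- The generator `v_i` of the face ring. -/
noncomputable def v (i : Fin m) : FaceRing k K := faceMk k K (MvPolynomial.X i)

/-- The generator `u_i` of the exterior algebra. -/
noncomputable def u (i : Fin m) : ExteriorAlgebra k (Fin m → k) :=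
  ExteriorAlgebra.ι k (Pi.single i 1)

/-- `v_I = v_{i_1} ⋯ v_{i_p}`. -/
noncomputable def vMon (I : Finset (Fin m)) : FaceRing k K := ∏ i ∈ I, v k K i

/-- `u_J = u_{j_1} ⋯ u_{j_q}` for `J = {j_1 < ⋯ < j_q}`. -/
noncomputable def uMon (J : Finset (Fin m)) : ExteriorAlgebra k (Fin m → k) :=
  ((J.sort (· ≤ ·)).map (u k)).prod

/-- The monomial `v_I u_J`. -/
noncomputable def monomialVU (I J : Finset (Fin m)) : Koszul k K := vMon k K I ⊗ₜ[k] uMon k J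

/-- Contraction with the `i`-th coordinate form: the antiderivation of `Λ[u_1, …, u_m]` that sends
`u_i` to `1` and the other generators to `0`. -/
noncomputable def contract (i : Fin m) :
    ExteriorAlgebra k (Fin m → k) →ₗ[k] ExteriorAlgebra k (Fin m → k) :=
  CliffordAlgebra.contractLeft (Q := (0 : QuadraticForm k (Fin m → k))) (LinearMap.proj i)

/-- The Koszul differential `d = ∑ i, v_i ⊗ ∂/∂u_i`: the antiderivation with `d v_i = 0` and
`d u_i = v_i` (see `koszulD_v`, `koszulD_u`, `koszulD_v_mul`, `koszulD_u_mul`). -/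
noncomputable def koszulD : Koszul k K →ₗ[k] Koszul k K :=
  ∑ i, TensorProduct.map (LinearMap.mulLeft k (v k K i)) (contract k i)

/-- The subcomplex `C^*(K)` of the Koszul complex: the span of the monomials `v_I u_J` with `I` a
simplex of `K` and `I ∩ J = ∅`. -/
noncomputable def reducedKoszul : Submodule k (Koszul k K) :=
  Submodule.span k {x | ∃ I J, IsSimplex K I ∧ Disjoint I J ∧ x = monomialVU k K I J}

/-- The ideal of the Koszul algebra generated by all `v_i²` and `v_i u_i`. (As `v_i` is central and
`u_i` commutes with homogeneous elements up to sign, the left ideal written here is two-sided.) -/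
noncomputable def squareIdeal : Submodule k (Koszul k K) :=
  (Ideal.span ({x : Koszul k K | ∃ i, x = (v k K i ^ 2) ⊗ₜ[k] 1} ∪
    {x | ∃ i, x = v k K i ⊗ₜ[k] u k i})).restrictScalars k

lemma contract_u_mul (i j : Fin m) (x : ExteriorAlgebra k (Fin m → k)) :
    contract k i (u k j * x) = (if i = j then x else 0) - u k j * contract k i x := by
  have := CliffordAlgebra.contractLeft_ι_mul (Q := (0 : QuadraticForm k (Fin m → k)))
    (d := LinearMap.proj i) (Pi.single j 1) x
  rw [contract, u, ExteriorAlgebra.ι, this]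
  by_cases h : i = j
  · subst h; simp
  · simp [h]

lemma koszulD_tmul (a : FaceRing k K) (b : ExteriorAlgebra k (Fin m → k)) :
    koszulD k K (a ⊗ₜ b) = ∑ i, (v k K i * a) ⊗ₜ[k] contract k i b := by
  simp [koszulD, LinearMap.sum_apply]

lemma koszulD_v (a : FaceRing k K) : koszulD k K (a ⊗ₜ 1) = 0 := by
  rw [koszulD_tmul]
  refine Finset.sum_eq_zero fun i _ => ?_
  rw [contract, CliffordAlgebra.contractLeft_one, TensorProduct.tmul_zero]

lemma koszulD_v_mul (a : FaceRing k K) (x : Koszul k K) :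
    koszulD k K ((a ⊗ₜ 1) * x) = (a ⊗ₜ 1) * koszulD k K x := by
  induction x using TensorProduct.induction_on with
  | zero => rw [mul_zero, map_zero, mul_zero]
  | add x y hx hy => rw [mul_add, map_add, hx, hy, map_add, mul_add]
  | tmul b c =>
    rw [Algebra.TensorProduct.tmul_mul_tmul, one_mul, koszulD_tmul, koszulD_tmul, Finset.mul_sum]
    refine Finset.sum_congr rfl fun i _ => ?_
    rw [Algebra.TensorProduct.tmul_mul_tmul, one_mul, mul_left_comm]

lemma koszulD_u_mul (j : Fin m) (x : Koszul k K) :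
    koszulD k K ((1 ⊗ₜ u k j) * x) =
      (v k K j ⊗ₜ 1) * x - (1 ⊗ₜ u k j) * koszulD k K x := by
  induction x using TensorProduct.induction_on with
  | zero => simp
  | add x y hx hy => rw [mul_add, map_add, hx, hy, map_add, mul_add, mul_add]; abel
  | tmul b c =>
    rw [Algebra.TensorProduct.tmul_mul_tmul, one_mul, koszulD_tmul, koszulD_tmul, Finset.mul_sum,
      Algebra.TensorProduct.tmul_mul_tmul, one_mul]
    simp_rw [Algebra.TensorProduct.tmul_mul_tmul, one_mul, contract_u_mul, TensorProduct.tmul_sub]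
    rw [Finset.sum_sub_distrib, Finset.sum_eq_single j]
    · rw [if_pos rfl]
    · intro i _ hi
      rw [if_neg hi, TensorProduct.tmul_zero]
    · simp

lemma koszulD_u (j : Fin m) : koszulD k K (1 ⊗ₜ u k j) = v k K j ⊗ₜ 1 := by
  have h := koszulD_u_mul k K j 1
  rw [mul_one, mul_one, Algebra.TensorProduct.one_def, koszulD_v, mul_zero, sub_zero] at h
  exact h

lemma contract_prod_of_notMem (i : Fin m) (l : List (Fin m)) (h : i ∉ l) :
    contract k i (l.map (u k)).prod = 0 := by
  induction l with
  | nil => simp [contract]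
  | cons j l ih =>
    simp only [List.mem_cons, not_or] at h
    rw [List.map_cons, List.prod_cons, contract_u_mul, if_neg h.1, ih h.2]; simp

lemma uMon_eq_basis (J : Finset (Fin m)) :
    uMon k J = (Pi.basisFun k (Fin m)).ExteriorAlgebra J := by
  rw [ExteriorAlgebra.basis_apply, uMon]
  change _ = ExteriorAlgebra.ιMulti k J.card _
  rw [ExteriorAlgebra.ιMulti_apply]
  congr 1
  apply List.ext_getElem
  · simp
  · intro n h1 h2
    simp [u, Set.powersetCard.prodEquiv, Set.powersetCard.ofFinEmbEquiv_symm_apply]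
    change Pi.single _ 1 = Pi.single ((J.orderEmbOfFin rfl) ⟨n, by simpa using h1⟩) 1
    rw [Finset.orderEmbOfFin_apply]
    rfl

lemma uMon_singleton (i : Fin m) : uMon k {i} = u k i := by simp [uMon]

lemma uMon_mul_of_not_disjoint {s t : Finset (Fin m)} (h : ¬ Disjoint s t) :
    uMon k s * uMon k t = 0 := by
  rw [uMon_eq_basis, uMon_eq_basis]
  exact ExteriorAlgebra.basis_mul_of_not_disjoint (Pi.basisFun k (Fin m))
    (⟨s, rfl⟩ : Set.powersetCard (Fin m) s.card) (⟨t, rfl⟩ : Set.powersetCard (Fin m) t.card) h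

lemma uMon_mul_of_disjoint {s t : Finset (Fin m)} (h : Disjoint s t) :
    ∃ e : ℤˣ, uMon k s * uMon k t = e • uMon k (s ∪ t) := by
  refine ⟨(Set.powersetCard.permOfDisjoint (s := (⟨s, rfl⟩ : Set.powersetCard (Fin m) s.card))
    (t := (⟨t, rfl⟩ : Set.powersetCard (Fin m) t.card)) h).sign, ?_⟩
  rw [uMon_eq_basis, uMon_eq_basis, uMon_eq_basis]
  have := ExteriorAlgebra.basis_mul_of_disjoint (Pi.basisFun k (Fin m))
      (⟨s, rfl⟩ : Set.powersetCard (Fin m) s.card) (⟨t, rfl⟩ : Set.powersetCard (Fin m) t.card) h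
  refine this.trans ?_
  congr 2
  simp [Set.powersetCard.disjUnion]

lemma vMon_eq_zero {I : Finset (Fin m)} (h : ¬ IsSimplex K I) : vMon k K I = 0 := by
  simp only [vMon, v]
  rw [← map_prod, faceMk_eq_zero_iff]
  exact Ideal.subset_span ⟨I, h, rfl⟩

lemma monomialVU_mem {I J : Finset (Fin m)} (h : Disjoint I J) :
    monomialVU k K I J ∈ reducedKoszul k K := by
  by_cases hI : IsSimplex K I
  · exact Submodule.subset_span ⟨I, J, hI, h, rfl⟩
  · rw [monomialVU, vMon_eq_zero k K hI, TensorProduct.zero_tmul]; exact Submodule.zero_mem _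

lemma zsmul_unit_mem {V : Type*} [AddCommGroup V] [Module k V] (S : Submodule k V) (e : ℤˣ)
    {x : V} (h : x ∈ S) : e • x ∈ S := by
  rcases Int.units_eq_one_or e with rfl | rfl
  · simpa using h
  · simpa [Units.neg_smul] using h

lemma koszulD_mem_reducedKoszul (x : Koszul k K) (hx : x ∈ reducedKoszul k K) :
    koszulD k K x ∈ reducedKoszul k K := by
  induction hx using Submodule.span_induction with
  | zero => simp
  | add x y _ _ hx hy => rw [map_add]; exact Submodule.add_mem _ hx hy
  | smul a x _ hx => rw [map_smul]; exact Submodule.smul_mem _ _ hx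
  | mem x hx =>
    obtain ⟨I, J, hI, hIJ, rfl⟩ := hx
    rw [koszulD, LinearMap.sum_apply]
    refine Submodule.sum_mem _ fun i _ => ?_
    rw [monomialVU, TensorProduct.map_tmul, LinearMap.mulLeft_apply]
    by_cases hi : i ∈ J
    · obtain ⟨e, he⟩ := uMon_mul_of_disjoint k (s := {i}) (t := J.erase i) (by simp)
      have h1 : ({i} : Finset (Fin m)) ∪ J.erase i = J := by
        rw [← Finset.insert_eq, Finset.insert_erase hi]
      rw [h1, uMon_singleton] at he
      have h2 : uMon k J = e • (u k i * uMon k (J.erase i)) := by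
        rw [he, smul_smul, Int.units_mul_self, one_smul]
      have h3 : contract k i (uMon k J) = e • uMon k (J.erase i) := by
        rw [h2, Units.smul_def, map_zsmul, contract_u_mul, if_pos rfl,
          uMon, contract_prod_of_notMem _ _ _ (by simp)]
        simp [Units.smul_def]
      have hiI : i ∉ I := fun h => Finset.disjoint_left.1 hIJ h hi
      have h4 : v k K i * vMon k K I = vMon k K (insert i I) := by
        rw [vMon, vMon, Finset.prod_insert hiI]
      rw [h3, h4]
      have h5 : monomialVU k K (insert i I) (J.erase i) ∈ reducedKoszul k K := by
        apply monomialVU_mem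
        rw [Finset.disjoint_insert_left]
        exact ⟨by simp, hIJ.mono_right (Finset.erase_subset _ _)⟩
      rcases Int.units_eq_one_or e with rfl | rfl
      · simpa [monomialVU] using h5
      · simpa [monomialVU, Units.neg_smul, TensorProduct.tmul_neg] using h5
    · rw [uMon, contract_prod_of_notMem _ _ _ (by simpa using hi), TensorProduct.tmul_zero]
      exact Submodule.zero_mem _

lemma IsSimplex.subset {K : AbstractSimplicialComplex (Fin m)} {I I' : Finset (Fin m)}
    (h : IsSimplex K I) (hI : I' ⊆ I) : IsSimplex K I' := by
  rcases I'.eq_empty_or_nonempty with h0 | h0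
  · exact Or.inl h0
  · rcases h with rfl | h
    · exact Or.inl (Finset.subset_empty.1 hI)
    · exact Or.inr ((K.isRelLowerSet_faces h).2 hI h0)

/-- The exponent vector of the square-free monomial `v_I`. -/
noncomputable def expo (I : Finset (Fin m)) : Fin m →₀ ℕ := ∑ i ∈ I, Finsupp.single i 1

lemma expo_apply (I : Finset (Fin m)) (i : Fin m) : expo I i = if i ∈ I then 1 else 0 := by
  simp [expo, Finsupp.finsetSum_apply, Finsupp.single_apply]

lemma prod_X_eq (I : Finset (Fin m)) :
    (∏ i ∈ I, MvPolynomial.X i : MvPolynomial (Fin m) k) = MvPolynomial.monomial (expo I) 1 := by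
  rw [expo, MvPolynomial.monomial_sum_one]; rfl

lemma coeff_eq_zero_of_mem {I : Finset (Fin m)} (hI : IsSimplex K I)
    {p : MvPolynomial (Fin m) k} (hp : p ∈ faceIdeal k K) : p.coeff (expo I) = 0 := by
  have h1 : faceIdeal k K = Ideal.span ((fun s => MvPolynomial.monomial s (1 : k)) ''
      {s | ∃ I : Finset (Fin m), ¬ IsSimplex K I ∧ s = expo I}) := by
    rw [faceIdeal]
    congr 1
    ext q
    constructor
    · rintro ⟨I, hI, rfl⟩
      exact ⟨expo I, ⟨I, hI, rfl⟩, (prod_X_eq k I).symm⟩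
    · rintro ⟨_, ⟨I, hI, rfl⟩, rfl⟩
      exact ⟨I, hI, (prod_X_eq k I).symm⟩
  rw [h1, MvPolynomial.mem_ideal_span_monomial_image] at hp
  by_contra hc
  obtain ⟨_, ⟨I', hI', rfl⟩, hle⟩ := hp (expo I) (MvPolynomial.mem_support_iff.2 hc)
  refine hI' (hI.subset fun i hi => ?_)
  by_contra hn
  have := hle i
  rw [expo_apply, expo_apply, if_pos hi, if_neg hn] at this
  omega

/-- The coefficient of `v_I`, for a simplex `I`, as a linear form on the face ring. -/
noncomputable def faceCoeff {I : Finset (Fin m)} (hI : IsSimplex K I) : FaceRing k K →ₗ[k] k :=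
  (Submodule.liftQ ((faceIdeal k K).restrictScalars k) (MvPolynomial.lcoeff k (expo I))
    (fun _ hp => coeff_eq_zero_of_mem k K hI hp)) ∘ₗ
    (Submodule.Quotient.restrictScalarsEquiv k (faceIdeal k K)).symm.toLinearMap

lemma faceCoeff_mk {I : Finset (Fin m)} (hI : IsSimplex K I) (p : MvPolynomial (Fin m) k) :
    faceCoeff k K hI (faceMk k K p) = p.coeff (expo I) := rfl

noncomputable def extCoeff (J : Finset (Fin m)) : ExteriorAlgebra k (Fin m → k) →ₗ[k] k :=
  (Pi.basisFun k (Fin m)).ExteriorAlgebra.coord J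

lemma extCoeff_uMon (J J' : Finset (Fin m)) :
    extCoeff k J (uMon k J') = if J' = J then 1 else 0 := by
  rw [extCoeff, uMon_eq_basis, Module.Basis.coord_apply, Module.Basis.repr_self,
    Finsupp.single_apply]

lemma extCoeff_mul_u {i : Fin m} {J : Finset (Fin m)} (h : i ∉ J)
    (b : ExteriorAlgebra k (Fin m → k)) : extCoeff k J (b * u k i) = 0 := by
  have : (extCoeff k J) ∘ₗ (LinearMap.mulRight k (u k i)) = 0 := by
    refine (Pi.basisFun k (Fin m)).ExteriorAlgebra.ext fun s => ?_
    rw [← uMon_eq_basis, LinearMap.comp_apply, LinearMap.mulRight_apply, ← uMon_singleton]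
    by_cases hs : Disjoint s {i}
    · obtain ⟨e, he⟩ := uMon_mul_of_disjoint k hs
      rw [he, Units.smul_def, map_zsmul, extCoeff_uMon, if_neg]
      · simp
      · rintro rfl; simp at h
    · rw [uMon_mul_of_not_disjoint k hs, map_zero]; rfl
  exact LinearMap.congr_fun this b

/-- The coefficient of `v_I u_J`. -/
noncomputable def monoCoeff {I : Finset (Fin m)} (hI : IsSimplex K I) (J : Finset (Fin m)) :
    Koszul k K →ₗ[k] k :=
  LinearMap.mul' k k ∘ₗ TensorProduct.map (faceCoeff k K hI) (extCoeff k J)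

lemma monoCoeff_tmul {I : Finset (Fin m)} (hI : IsSimplex K I) (J : Finset (Fin m))
    (a : FaceRing k K) (b : ExteriorAlgebra k (Fin m → k)) :
    monoCoeff k K hI J (a ⊗ₜ b) = faceCoeff k K hI a * extCoeff k J b := by
  simp [monoCoeff]

lemma faceCoeff_mul_v {I : Finset (Fin m)} (hI : IsSimplex K I) {i : Fin m} (h : i ∉ I)
    (a : FaceRing k K) : faceCoeff k K hI (a * v k K i) = 0 := by
  obtain ⟨p, rfl⟩ := faceMk_surjective k K a
  rw [v, ← map_mul, faceCoeff_mk, MvPolynomial.coeff_mul_X', if_neg]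
  simp [expo_apply, h]

lemma faceCoeff_mul_v_sq {I : Finset (Fin m)} (hI : IsSimplex K I) (i : Fin m)
    (a : FaceRing k K) : faceCoeff k K hI (a * v k K i ^ 2) = 0 := by
  by_cases h : i ∈ I
  · obtain ⟨p, rfl⟩ := faceMk_surjective k K a
    rw [v, ← map_pow, ← map_mul, faceCoeff_mk, pow_two, ← mul_assoc, MvPolynomial.coeff_mul_X',
      MvPolynomial.coeff_mul_X']
    simp [expo_apply, h]
  · rw [pow_two, ← mul_assoc]; exact faceCoeff_mul_v k K hI h _

lemma faceCoeff_vMon {I : Finset (Fin m)} (hI : IsSimplex K I) (I' : Finset (Fin m)) :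
    faceCoeff k K hI (vMon k K I') = if I' = I then 1 else 0 := by
  simp only [vMon, v]
  rw [← map_prod, faceCoeff_mk, prod_X_eq, MvPolynomial.coeff_monomial]
  by_cases h : I' = I
  · simp [h]
  · rw [if_neg h, if_neg]
    intro h'
    apply h
    ext i
    have := DFunLike.congr_fun h' i
    rw [expo_apply, expo_apply] at this
    by_cases h1 : i ∈ I' <;> by_cases h2 : i ∈ I <;> simp_all

lemma monoCoeff_squareIdeal {I J : Finset (Fin m)} (hI : IsSimplex K I) (hIJ : Disjoint I J)
    {x : Koszul k K} (hx : x ∈ squareIdeal k K) : monoCoeff k K hI J x = 0 := by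
  have key : ∀ x ∈ Ideal.span ({x : Koszul k K | ∃ i, x = (v k K i ^ 2) ⊗ₜ[k] 1} ∪
      {x | ∃ i, x = v k K i ⊗ₜ[k] u k i}), ∀ y : Koszul k K, monoCoeff k K hI J (y * x) = 0 := by
    intro x hx
    induction hx using Submodule.span_induction with
    | zero => simp
    | add x y hx hy h1 h2 => intro z; rw [mul_add, map_add, h1, h2, add_zero]
    | smul a x _ hx => intro z; rw [smul_eq_mul, ← mul_assoc, hx]
    | mem x hx =>
      intro y
      induction y using TensorProduct.induction_on with
      | zero => simp
      | add y z h1 h2 => rw [add_mul, map_add, h1, h2, add_zero]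
      | tmul a b =>
        rcases hx with ⟨i, rfl⟩ | ⟨i, rfl⟩
        · rw [Algebra.TensorProduct.tmul_mul_tmul, monoCoeff_tmul, faceCoeff_mul_v_sq, zero_mul]
        · rw [Algebra.TensorProduct.tmul_mul_tmul, monoCoeff_tmul]
          by_cases hi : i ∈ I
          · rw [extCoeff_mul_u k (Finset.disjoint_left.1 hIJ hi), mul_zero]
          · rw [faceCoeff_mul_v k K hI hi, zero_mul]
  simpa using key x hx 1

lemma monoCoeff_monomialVU {I J : Finset (Fin m)} (hI : IsSimplex K I) (I' J' : Finset (Fin m)) :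
    monoCoeff k K hI J (monomialVU k K I' J') = if I' = I ∧ J' = J then 1 else 0 := by
  rw [monomialVU, monoCoeff_tmul, faceCoeff_vMon, extCoeff_uMon]
  split_ifs <;> simp_all

lemma disjoint_reducedKoszul_squareIdeal : Disjoint (reducedKoszul k K) (squareIdeal k K) := by
  classical
  rw [Submodule.disjoint_def]
  intro x hx hx'
  have hr : reducedKoszul k K = Submodule.span k (Set.range
      (fun p : {p : Finset (Fin m) × Finset (Fin m) // IsSimplex K p.1 ∧ Disjoint p.1 p.2} =>
        monomialVU k K p.1.1 p.1.2)) := by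
    rw [reducedKoszul]
    congr 1
    ext y
    constructor
    · rintro ⟨I, J, hI, hIJ, rfl⟩
      exact ⟨⟨(I, J), hI, hIJ⟩, rfl⟩
    · rintro ⟨⟨⟨I, J⟩, hI, hIJ⟩, rfl⟩
      exact ⟨I, J, hI, hIJ, rfl⟩
  rw [hr, Submodule.mem_span_range_iff_exists_fun] at hx
  obtain ⟨c, rfl⟩ := hx
  refine Finset.sum_eq_zero fun p _ => ?_
  have := monoCoeff_squareIdeal k K p.2.1 p.2.2 hx'
  rw [map_sum, Finset.sum_eq_single p] at this
  · rw [map_smul, monoCoeff_monomialVU, if_pos ⟨rfl, rfl⟩, smul_eq_mul, mul_one] at this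
    rw [this, zero_smul]
  · intro q _ hq
    rw [map_smul, monoCoeff_monomialVU, if_neg, smul_zero]
    rintro ⟨h1, h2⟩
    exact hq (Subtype.ext (Prod.ext h1 h2))
  · simp

lemma tmul_uMon_mem (a : Fin m →₀ ℕ) (J : Finset (Fin m)) :
    (faceMk k K (MvPolynomial.monomial a 1)) ⊗ₜ[k] uMon k J ∈
      reducedKoszul k K ⊔ squareIdeal k K := by
  have split : ∀ (a b : Fin m →₀ ℕ), b ≤ a →
      (faceMk k K (MvPolynomial.monomial a 1)) =
      faceMk k K (MvPolynomial.monomial (a - b) 1) *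
        faceMk k K (MvPolynomial.monomial b 1) := by
    intro a b h
    rw [← map_mul, MvPolynomial.monomial_mul, tsub_add_cancel_of_le h, one_mul]
  by_cases h2 : ∃ i, 2 ≤ a i
  · obtain ⟨i, hi⟩ := h2
    apply Submodule.mem_sup_right
    have h : (faceMk k K (MvPolynomial.monomial a 1)) ⊗ₜ[k] uMon k J =
        ((faceMk k K
          (MvPolynomial.monomial (a - Finsupp.single i 2) 1)) ⊗ₜ[k] uMon k J) *
          ((v k K i ^ 2) ⊗ₜ[k] 1) := by
      rw [Algebra.TensorProduct.tmul_mul_tmul, mul_one, v, ← map_pow, MvPolynomial.X_pow_eq_monomial,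
        ← split _ _ (by simpa using hi)]
    rw [h]
    exact Ideal.mul_mem_left _ _ (Ideal.subset_span (Or.inl ⟨i, rfl⟩))
  · push Not at h2
    by_cases h1 : ∃ i ∈ J, 1 ≤ a i
    · obtain ⟨i, hiJ, hi⟩ := h1
      apply Submodule.mem_sup_right
      obtain ⟨e, he⟩ := uMon_mul_of_disjoint k (s := J.erase i) (t := {i}) (by simp)
      have h1 : J.erase i ∪ ({i} : Finset (Fin m)) = J := by
        rw [Finset.union_comm, ← Finset.insert_eq, Finset.insert_erase hiJ]
      rw [h1, uMon_singleton] at he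
      have h2 : uMon k J = e • (uMon k (J.erase i) * u k i) := by
        rw [he, smul_smul, Int.units_mul_self, one_smul]
      have h : (faceMk k K (MvPolynomial.monomial a 1)) ⊗ₜ[k]
            (uMon k (J.erase i) * u k i) =
          ((faceMk k K
            (MvPolynomial.monomial (a - Finsupp.single i 1) 1)) ⊗ₜ[k] uMon k (J.erase i)) *
            (v k K i ⊗ₜ[k] u k i) := by
        rw [Algebra.TensorProduct.tmul_mul_tmul, v, MvPolynomial.X,
          ← split _ _ (by simpa using hi)]
      have h5 : (faceMk k K (MvPolynomial.monomial a 1)) ⊗ₜ[k]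
            (uMon k (J.erase i) * u k i) ∈ squareIdeal k K := by
        rw [h]
        exact Ideal.mul_mem_left _ _ (Ideal.subset_span (Or.inr ⟨i, rfl⟩))
      rw [h2]
      rcases Int.units_eq_one_or e with rfl | rfl
      · simpa using h5
      · simpa [Units.neg_smul, TensorProduct.tmul_neg] using h5
    · push Not at h1
      apply Submodule.mem_sup_left
      have ha : a = expo a.support := by
        ext i
        rw [expo_apply]
        have := h2 i
        split_ifs with h
        · have := Finsupp.mem_support_iff.1 h; omega
        · simpa using h
      have : faceMk k K (MvPolynomial.monomial a 1) = vMon k K a.support := by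
        conv_lhs => rw [ha]
        rw [← prod_X_eq, map_prod]; rfl
      rw [this]
      refine monomialVU_mem k K (Finset.disjoint_left.2 fun i hi hiJ => ?_)
      have := h1 i hiJ
      have := Finsupp.mem_support_iff.1 hi
      omega

/-- The Koszul algebra is the direct sum of the span of the monomials `v_I u_J`
(`I ∈ K`, `I ∩ J = ∅`) and the ideal generated by the `v_i²` and `v_i u_i`. -/
lemma isCompl_reducedKoszul_squareIdeal : IsCompl (reducedKoszul k K) (squareIdeal k K) := by
  refine ⟨disjoint_reducedKoszul_squareIdeal k K, codisjoint_iff.2 (eq_top_iff.2 fun x _ => ?_)⟩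
  induction x using TensorProduct.induction_on with
  | zero => exact Submodule.zero_mem _
  | add x y hx hy => exact Submodule.add_mem _ (hx trivial) (hy trivial)
  | tmul p b =>
    rename_i ht
    clear ht
    obtain ⟨p, rfl⟩ := faceMk_surjective k K p
    have hb : b ∈ Submodule.span k (Set.range (uMon k)) := by
      have : uMon k = ⇑(Pi.basisFun k (Fin m)).ExteriorAlgebra := funext (uMon_eq_basis k)
      rw [this, Module.Basis.span_eq]; trivial
    induction hb using Submodule.span_induction with
    | zero => rw [TensorProduct.tmul_zero]; exact Submodule.zero_mem _
    | add x y _ _ hx hy => rw [TensorProduct.tmul_add]; exact Submodule.add_mem _ hx hy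
    | smul a x _ hx => rw [TensorProduct.tmul_smul]; exact Submodule.smul_mem _ _ hx
    | mem b hb =>
      obtain ⟨J, rfl⟩ := hb
      induction p using MvPolynomial.induction_on' with
      | monomial a c =>
        have : MvPolynomial.monomial a c = c • (MvPolynomial.monomial a 1 : MvPolynomial (Fin m) k) := by
          rw [MvPolynomial.smul_monomial, smul_eq_mul, mul_one]
        rw [this, map_smul, ← TensorProduct.smul_tmul']
        exact Submodule.smul_mem _ _ (tmul_uMon_mem k K a J)
      | add p q hp hq =>
        rw [map_add, TensorProduct.add_tmul]
        exact Submodule.add_mem _ hp hq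

/-- The projection `j : k(K) ⊗ Λ[u_1, …, u_m] → C^*(K)` along `squareIdeal`. It is the identity on
`C^*(K)`. -/
noncomputable def koszulProj : Koszul k K →ₗ[k] reducedKoszul k K :=
  (reducedKoszul k K).projectionOnto (squareIdeal k K) (isCompl_reducedKoszul_squareIdeal k K)

/-- The homogeneous part of degree `n` of `k(K) ⊗ Λ[u_1, …, u_m]`, for the total degree with
`deg v_i = 2` and `deg u_i = 1`. -/
noncomputable def koszulDeg (n : ℕ) : Submodule k (Koszul k K) :=
  Submodule.span k {x | ∃ p q : ℕ, 2 * p + q = n ∧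
    ∃ a ∈ MvPolynomial.homogeneousSubmodule (Fin m) k p, ∃ b ∈ ⋀[k]^q (Fin m → k),
      x = faceMk k K a ⊗ₜ[k] b}

/-- `C^*(K)` with the differential and the grading of the Koszul complex and the product
`x · y = j(x y)`; thus `v_i² = v_i u_i = 0` in `C^*(K)`. -/
noncomputable def koszulDGA : PreDGA k (reducedKoszul k K) where
  one := koszulProj k K 1
  mul := ((LinearMap.mul k (Koszul k K)).compl₁₂ (reducedKoszul k K).subtype
    (reducedKoszul k K).subtype).compr₂ (koszulProj k K)
  d := (koszulD k K).restrict (koszulD_mem_reducedKoszul k K)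
  deg n := (koszulDeg k K n).comap (reducedKoszul k K).subtype

end Koszul

section Geometry

open Set

variable {m : ℕ}

/-- The moment-angle complex `Z_K = ⋃_{J ∈ K} B_J`, where
`B_J = {z ∈ (D²)^m : |z_j| = 1 for j ∉ J}`, as a subset of `ℂ^m`. -/
def momentAngle (K : AbstractSimplicialComplex (Fin m)) : Set (Fin m → ℂ) :=
  {z | (∀ i, ‖z i‖ ≤ 1) ∧ ∃ J, IsSimplex K J ∧ ∀ j, j ∉ J → ‖z j‖ = 1}

/-- The index `(I, J)` of the cell `D_I T_J` of the `3^m`-cell decomposition of `(D²)^m`. -/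
@[ext]
structure Cell (m : ℕ) where
  I : Finset (Fin m)
  J : Finset (Fin m)
  disj : Disjoint I J

instance : Finite (Cell m) :=
  Finite.of_injective (fun c : Cell m => (c.I, c.J)) fun c c' h => by
    simp only [Prod.mk.injEq] at h
    exact Cell.ext h.1 h.2

/-- The dimension of `D_I T_J`. -/
def Cell.dim (c : Cell m) : ℕ := 2 * c.I.card + c.J.card

/-- The open cell `D_I T_J`: in each coordinate the product of the open disc `D` (`i ∈ I`), the
punctured circle `T` (`i ∈ J`), or the point `1`. -/
def Cell.openCell (c : Cell m) : Set (Fin m → ℂ) :=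
  {z | ∀ i, if i ∈ c.I then ‖z i‖ < 1 else if i ∈ c.J then ‖z i‖ = 1 ∧ z i ≠ 1 else z i = 1}

/-- The characteristic map `[-1, 1]² → D²` of the cell `D`: a homeomorphism, smooth and orientation
preserving off the four corners, that maps the open square onto the open disc. -/
noncomputable def squareToDisc (s t : ℝ) : ℂ :=
  ⟨s * √(1 - t ^ 2 / 2), t * √(1 - s ^ 2 / 2)⟩

/-- The characteristic map `[-1, 1] → S¹`, `s ↦ exp(iπ(s + 1))`, of the cell `T`, oriented
counterclockwise; both end points go to `1`. -/
noncomputable def segToCircle (s : ℝ) : ℂ := Complex.exp ((Real.pi * (s + 1) : ℝ) * Complex.I)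

/-- The coordinate of `x` with number `a` (and `0` if there is none). -/
def slot {n : ℕ} (x : Fin n → ℝ) (a : ℕ) : ℝ := if h : a < n then x ⟨a, h⟩ else 0

/-- The number of real coordinates of `D_I T_J` that belong to the factors before the `i`-th one. -/
def Cell.offset (c : Cell m) (i : Fin m) : ℕ :=
  2 * (c.I.filter (· < i)).card + (c.J.filter (· < i)).card

/-- The characteristic map `[-1, 1]^n → (D²)^m`, `n = dim D_I T_J`, of the cell `D_I T_J`: the product
of the characteristic maps of its factors, in the order of the coordinates. It orients the cell. -/
noncomputable def Cell.charMap (c : Cell m) {n : ℕ} (x : Fin n → ℝ) : Fin m → ℂ := fun i =>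
  if i ∈ c.I then squareToDisc (slot x (c.offset i)) (slot x (c.offset i + 1))
  else if i ∈ c.J then segToCircle (slot x (c.offset i))
  else 1

open Classical in
/-- The local degree at `x` of `f` over the oriented `n`-cell with characteristic map `g`, where
`f x = g y`: the sign of the determinant of the derivative `A` of `g⁻¹ ∘ f` at `x`, that is, of the
linear map with `Df(x) = Dg(y) ∘ A`. -/
noncomputable def localSign {n : ℕ} {E : Type*} [NormedAddCommGroup E] [NormedSpace ℝ E]
    (f : (Fin n → ℝ) → E) (x : Fin n → ℝ) (g : (Fin n → ℝ) → E) (y : Fin n → ℝ) : ℤ :=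
  if h : ∃ A : (Fin n → ℝ) →L[ℝ] (Fin n → ℝ), fderiv ℝ f x = (fderiv ℝ g y).comp A then
    (SignType.sign (LinearMap.det (h.choose : (Fin n → ℝ) →ₗ[ℝ] (Fin n → ℝ))) : ℤ)
  else 0

/-- The degree of `f : [-1, 1]^n → E`, a map into the `n`-skeleton with the boundary of the cube going
into the complement of the open cell (or one face of a map of `∂[-1, 1]^(n+1)`), over the `n`-cell
with characteristic map `g`: the number of preimages, counted with signs, of the regular value
`g 0`, the centre of the cell. -/
noncomputable def localDegree {n : ℕ} {E : Type*} [NormedAddCommGroup E] [NormedSpace ℝ E]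
    (f g : (Fin n → ℝ) → E) : ℤ :=
  ∑ᶠ (x : Fin n → ℝ) (_ : (∀ a, |x a| < 1) ∧ f x = g 0), localSign f x g 0

/-- The degree over the `n`-cell with characteristic map `g` of the restriction of `f` to the boundary
of `[-1, 1]^(n+1)`, a sphere with the boundary orientation (outward normal first): the face `x_a = 1`
has the sign `(-1)^a` and the face `x_a = -1` the opposite one, `a = 0, …, n`. -/
noncomputable def boundaryDegree {n : ℕ} {E : Type*} [NormedAddCommGroup E] [NormedSpace ℝ E]
    (f : (Fin (n + 1) → ℝ) → E) (g : (Fin n → ℝ) → E) : ℤ :=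
  ∑ a : Fin (n + 1), (-1) ^ (a : ℕ) *
    (localDegree (fun x => f (a.insertNth (1 : ℝ) x)) g -
      localDegree (fun x => f (a.insertNth (-1 : ℝ) x)) g)

/-- The incidence number of the cell `c` with the cell `c'`: the degree over `c'` of the attaching map
of `c` if `dim c = dim c' + 1`. -/
noncomputable def incidence (c c' : Cell m) : ℤ :=
  if c.dim = c'.dim + 1 then
    boundaryDegree (fun x : Fin (c'.dim + 1) → ℝ => c.charMap x)
      (fun x : Fin c'.dim → ℝ => c'.charMap x)
  else 0

/-- `ρ e^{iφ} ↦ 1 + ρ (e^{2iφ} - 1)`. It maps the upper half disc onto the disc, its diameter going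
to the point `1`; so does it for the lower half disc. -/
noncomputable def wrap (z : ℂ) : ℂ := 1 - ‖z‖ + z ^ 2 / ‖z‖

/-- The cellular approximation of the diagonal of `(D²)^m`. In each coordinate it sends `z ∈ D²` to
`(wrap z, 1)` if `Im z ≥ 0` and to `(1, wrap z)` if `Im z ≤ 0`. See `diagApprox_homotopic` and
`diagApprox_cellular`. -/
noncomputable def diagApprox (z : Fin m → ℂ) : (Fin m → ℂ) × (Fin m → ℂ) :=
  (fun i => if 0 ≤ (z i).im then wrap (z i) else 1,
   fun i => if 0 ≤ (z i).im then 1 else wrap (z i))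

/-- The characteristic map of the product cell `c × c'` of `(D²)^m × (D²)^m`. -/
noncomputable def prodCharMap (c c' : Cell m) (x : Fin (c.dim + c'.dim) → ℝ) :
    (Fin m → ℂ) × (Fin m → ℂ) :=
  (c.charMap fun a => x (Fin.castAdd c'.dim a), c'.charMap fun a => x (Fin.natAdd c.dim a))

/-- The coefficient of `c' × c''` in the image of the cell `c` under the chain map induced by
`diagApprox`. -/
noncomputable def diagDegree (c c' c'' : Cell m) : ℤ :=
  if c.dim = c'.dim + c''.dim then
    localDegree (fun x : Fin (c'.dim + c''.dim) → ℝ => diagApprox (c.charMap x))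
      (prodCharMap c' c'')
  else 0

/-- The homotopy from the identity to a component of the diagonal approximation of `D²`. -/
noncomputable def rot (ε t : ℝ) (z : ℂ) : ℂ :=
  (t * (1 - ‖z‖) : ℝ) + z * Complex.exp ((ε * t * |z.arg| : ℝ) * Complex.I)

lemma abs_arg_eq {z : ℂ} (hz : z ≠ 0) : |z.arg| = Real.arccos (z.re / ‖z‖) := by
  rw [← Complex.cos_arg hz, ← Real.cos_abs, Real.arccos_cos (abs_nonneg _) (Complex.abs_arg_le_pi z)]

lemma continuous_rot (ε : ℝ) : Continuous fun p : ℝ × ℂ => rot ε p.1 p.2 := by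
  refine Continuous.add (by fun_prop) ?_
  rw [continuous_iff_continuousAt]
  rintro ⟨t, z⟩
  by_cases hz : z = 0
  · subst hz
    rw [ContinuousAt]
    simp only [zero_mul]
    rw [tendsto_zero_iff_norm_tendsto_zero]
    have : (fun p : ℝ × ℂ => ‖p.2 * Complex.exp ((ε * p.1 * |p.2.arg| : ℝ) * Complex.I)‖) =
        fun p => ‖p.2‖ := by
      funext p; rw [norm_mul, Complex.norm_exp_ofReal_mul_I, mul_one]
    rw [this]
    have h : Continuous fun p : ℝ × ℂ => ‖p.2‖ := by fun_prop
    simpa using h.tendsto (t, 0)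
  · have h : (fun p : ℝ × ℂ => p.2 * Complex.exp ((ε * p.1 *
        Real.arccos (p.2.re / ‖p.2‖) : ℝ) * Complex.I)) =ᶠ[nhds (t, z)]
        fun p => p.2 * Complex.exp ((ε * p.1 * |p.2.arg| : ℝ) * Complex.I) := by
      have : ∀ᶠ p : ℝ × ℂ in nhds (t, z), p.2 ≠ 0 :=
        (continuous_snd.continuousAt (x := (t, z))).eventually_ne hz
      filter_upwards [this] with p hp
      rw [abs_arg_eq hp]
    refine ContinuousAt.congr ?_ h
    have : ContinuousAt (fun p : ℝ × ℂ => Real.arccos (p.2.re / ‖p.2‖)) (t, z) := by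
      refine Real.continuous_arccos.continuousAt.comp ?_
      exact ContinuousAt.div (by fun_prop) (by fun_prop) (by simpa using hz)
    fun_prop

lemma rot_zero (ε : ℝ) (z : ℂ) : rot ε 0 z = z := by simp [rot]

lemma mul_exp_arg (z : ℂ) : z * Complex.exp ((z.arg : ℝ) * Complex.I) = z ^ 2 / ‖z‖ := by
  by_cases hz : z = 0
  · simp [hz]
  · have := Complex.norm_mul_exp_arg_mul_I z
    have hn : (‖z‖ : ℂ) ≠ 0 := by simpa using hz
    rw [eq_div_iff hn]
    linear_combination z * this

lemma mul_exp_neg_arg (z : ℂ) : z * Complex.exp (((-z.arg : ℝ) : ℂ) * Complex.I) = ‖z‖ := by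
  have := Complex.norm_mul_exp_arg_mul_I z
  conv_lhs => rw [← this]
  rw [mul_assoc, ← Complex.exp_add]
  simp

lemma rot_one_one (z : ℂ) : rot 1 1 z = if 0 ≤ z.im then wrap z else 1 := by
  rw [rot]
  split_ifs with h
  · rw [abs_of_nonneg (Complex.arg_nonneg_iff.2 h), mul_one, one_mul, one_mul, mul_exp_arg, wrap]
    push_cast; ring
  · rw [abs_of_neg (Complex.arg_neg_iff.2 (not_le.1 h)), mul_one, one_mul, one_mul, mul_exp_neg_arg]
    push_cast; ring

lemma rot_neg_one_one (z : ℂ) : rot (-1) 1 z = if 0 ≤ z.im then 1 else wrap z := by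
  rw [rot]
  split_ifs with h
  · rw [abs_of_nonneg (Complex.arg_nonneg_iff.2 h), mul_one, one_mul, neg_one_mul, mul_exp_neg_arg]
    push_cast; ring
  · rw [abs_of_neg (Complex.arg_neg_iff.2 (not_le.1 h)), mul_one, one_mul, neg_one_mul, neg_neg,
      mul_exp_arg, wrap]
    push_cast; ring

lemma norm_rot_le {ε t : ℝ} (ht : t ∈ Icc (0 : ℝ) 1) {z : ℂ} (hz : ‖z‖ ≤ 1) :
    ‖rot ε t z‖ ≤ 1 := by
  refine (norm_add_le _ _).trans ?_
  rw [norm_mul, Complex.norm_exp_ofReal_mul_I, mul_one, Complex.norm_real, Real.norm_eq_abs,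
    abs_of_nonneg (mul_nonneg ht.1 (by linarith))]
  nlinarith [ht.2]

lemma norm_rot_eq (ε t : ℝ) {z : ℂ} (hz : ‖z‖ = 1) : ‖rot ε t z‖ = 1 := by
  rw [rot, hz, sub_self, mul_zero, Complex.ofReal_zero, zero_add, norm_mul,
    Complex.norm_exp_ofReal_mul_I, hz, mul_one]

/-- On every `Z_K` the map `diagApprox` is homotopic to the diagonal in `Z_K × Z_K`. -/
theorem diagApprox_homotopic (K : AbstractSimplicialComplex (Fin m)) :
    ∃ H : ℝ × (Fin m → ℂ) → (Fin m → ℂ) × (Fin m → ℂ),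
      Continuous H ∧
      MapsTo H (Icc 0 1 ×ˢ momentAngle K) (momentAngle K ×ˢ momentAngle K) ∧
      (∀ z, H (0, z) = (z, z)) ∧ ∀ z, H (1, z) = diagApprox z := by
  refine ⟨fun p => (fun i => rot 1 p.1 (p.2 i), fun i => rot (-1) p.1 (p.2 i)), ?_, ?_, ?_, ?_⟩
  · have h := fun ε (i : Fin m) => (continuous_rot ε).comp
      (g := fun p : ℝ × ℂ => rot ε p.1 p.2)
      (f := fun p : ℝ × (Fin m → ℂ) => (p.1, p.2 i)) (by fun_prop)
    exact (continuous_pi (h 1)).prodMk (continuous_pi (h (-1)))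
  · rintro ⟨t, z⟩ ⟨ht, hz, J, hJ, h⟩
    exact ⟨⟨fun i => norm_rot_le ht (hz i), J, hJ, fun j hj => norm_rot_eq _ _ (h j hj)⟩,
      ⟨fun i => norm_rot_le ht (hz i), J, hJ, fun j hj => norm_rot_eq _ _ (h j hj)⟩⟩
  · intro z; simp [rot_zero]
  · intro z; simp [rot_one_one, rot_neg_one_one, diagApprox]

lemma wrap_real {z : ℂ} (h : z.im = 0) : wrap z = 1 := by
  have hz : z = (z.re : ℂ) := Complex.ext rfl (by simpa using h)
  rw [wrap, hz, Complex.norm_real, Real.norm_eq_abs]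
  by_cases h0 : z.re = 0
  · simp [h0]
  · have : ((|z.re| : ℝ) : ℂ) ≠ 0 := by simpa using h0
    have h2 : (z.re : ℂ) ^ 2 = ((|z.re| : ℝ) : ℂ) ^ 2 := by
      rw [← Complex.ofReal_pow, ← sq_abs, Complex.ofReal_pow]
    rw [h2, pow_two, mul_div_assoc, div_self this]; ring

lemma normSq_wrap {z : ℂ} (h : z ≠ 0) :
    ‖wrap z‖ ^ 2 = 1 - 4 * (1 - ‖z‖) * z.im ^ 2 / ‖z‖ := by
  have hn : ‖z‖ ≠ 0 := by simpa using h
  have h1 : ‖z‖ ^ 2 = z.re ^ 2 + z.im ^ 2 := by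
    rw [← Complex.normSq_eq_norm_sq, Complex.normSq_apply]; ring
  have hre : (wrap z).re = 1 - ‖z‖ + (z.re ^ 2 - z.im ^ 2) / ‖z‖ := by
    rw [wrap, Complex.add_re, Complex.div_ofReal_re]
    simp [pow_two]
  have him : (wrap z).im = 2 * z.re * z.im / ‖z‖ := by
    rw [wrap, Complex.add_im, Complex.div_ofReal_im]
    simp [pow_two]; ring
  rw [← Complex.normSq_eq_norm_sq, Complex.normSq_apply, hre, him]
  have h2 : z.re ^ 2 = ‖z‖ ^ 2 - z.im ^ 2 := by linarith
  field_simp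
  ring_nf
  have h4 : z.re ^ 4 = (‖z‖ ^ 2 - z.im ^ 2) ^ 2 := by rw [← h2]; ring
  rw [h4, h2]
  ring

lemma norm_wrap_lt {z : ℂ} (h : ‖z‖ < 1) (hz : z.im ≠ 0) : ‖wrap z‖ < 1 := by
  have h0 : z ≠ 0 := by rintro rfl; simp at hz
  have hn : 0 < ‖z‖ := norm_pos_iff.2 h0
  have h1 : 0 < 4 * (1 - ‖z‖) * z.im ^ 2 / ‖z‖ := by
    have : 0 < 1 - ‖z‖ := by linarith
    positivity
  have := normSq_wrap h0
  nlinarith [norm_nonneg (wrap z)]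

lemma wrap_circle {z : ℂ} (h : ‖z‖ = 1) : wrap z = z ^ 2 := by simp [wrap, h]

/-- `diagApprox` is cellular: it maps the open cell `D_I T_J` into the union of the product cells
`D_{I'} T_{J'} × D_{I''} T_{J''}` with `I', I'' ⊆ I` of at most the same dimension. -/
theorem diagApprox_cellular (c : Cell m) {z : Fin m → ℂ} (hz : z ∈ c.openCell) :
    ∃ c' c'' : Cell m, c'.I ⊆ c.I ∧ c''.I ⊆ c.I ∧ c'.dim + c''.dim ≤ c.dim ∧
      diagApprox z ∈ c'.openCell ×ˢ c''.openCell := by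
  classical
  refine ⟨⟨c.I.filter fun i => 0 < (z i).im, c.J.filter fun i => 0 < (z i).im,
      Finset.disjoint_filter_filter c.disj⟩,
    ⟨c.I.filter fun i => (z i).im < 0, c.J.filter fun i => (z i).im < 0,
      Finset.disjoint_filter_filter c.disj⟩,
    Finset.filter_subset _ _, Finset.filter_subset _ _, ?_, ?_, ?_⟩
  · have key : ∀ S : Finset (Fin m), (S.filter fun i => 0 < (z i).im).card +
        (S.filter fun i => (z i).im < 0).card ≤ S.card := by
      intro S
      rw [← Finset.card_union_of_disjoint]
      · exact Finset.card_le_card (Finset.union_subset (Finset.filter_subset _ _)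
          (Finset.filter_subset _ _))
      · rw [Finset.disjoint_filter]
        intro i _ h1 h2
        exact lt_asymm h1 h2
    have h1 := key c.I
    have h2 := key c.J
    simp only [Cell.dim]
    omega
  all_goals
    intro i
    have hi := hz i
    rcases lt_trichotomy (z i).im 0 with h | h | h
    · have hw := norm_wrap_lt (z := z i)
      by_cases hI : i ∈ c.I
      · simp only [hI, if_true] at hi
        simp [diagApprox, h, not_le.2 h, not_lt.2 h.le, hI, hw hi h.ne]
      · by_cases hJ : i ∈ c.J
        · simp only [hI, hJ, if_true, if_false] at hi
          have : ¬ z i ^ 2 = 1 := by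
            rw [pow_two, mul_self_eq_one_iff, not_or]
            refine ⟨hi.2, fun h' => ?_⟩
            rw [h'] at h; simp at h
          simp [diagApprox, h, not_le.2 h, not_lt.2 h.le, hI, hJ, wrap_circle hi.1, hi.1, this]
        · simp only [hI, hJ, if_false] at hi
          rw [hi] at h; simp at h
    · simp [diagApprox, h, wrap_real h]
    · have hw := norm_wrap_lt (z := z i)
      by_cases hI : i ∈ c.I
      · simp only [hI, if_true] at hi
        simp [diagApprox, h, h.le, not_lt.2 h.le, hI, hw hi h.ne']
      · by_cases hJ : i ∈ c.J
        · simp only [hI, hJ, if_true, if_false] at hi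
          have : ¬ z i ^ 2 = 1 := by
            rw [pow_two, mul_self_eq_one_iff, not_or]
            refine ⟨hi.2, fun h' => ?_⟩
            rw [h'] at h; simp at h
          simp [diagApprox, h, h.le, not_lt.2 h.le, hI, hJ, wrap_circle hi.1, hi.1, this]
        · simp only [hI, hJ, if_false] at hi
          rw [hi] at h; simp at h

end Geometry

section Cellular

variable (k : Type*) [Field k] {m : ℕ} (K : AbstractSimplicialComplex (Fin m))

/-- The cells of `Z_K`: the cells of the `3^m`-cell decomposition of `(D²)^m` that lie in `Z_K`. -/
def ZCell : Type := {c : Cell m // c.openCell ⊆ momentAngle K}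

instance : Finite (ZCell K) := inferInstanceAs (Finite {c : Cell m // c.openCell ⊆ momentAngle K})

noncomputable instance : Fintype (ZCell K) := Fintype.ofFinite _

/-- The cellular chains of `Z_K` with coefficients in `k`. -/
abbrev CellChain : Type _ := ZCell K →₀ k

/-- The cellular cochains of `Z_K` with coefficients in `k`. -/
abbrev CellCochain : Type _ := Module.Dual k (CellChain k K)

/-- The cellular boundary `∂ c = ∑ [c : c'] c'`. -/
noncomputable def cellBoundary : CellChain k K →ₗ[k] CellChain k K :=
  Finsupp.linearCombination k fun c =>
    ∑ c' : ZCell K, (incidence c.1 c'.1 : k) • Finsupp.single c' (1 : k)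

/-- The chain map `C_*(Z_K) → C_*(Z_K × Z_K)` induced by the diagonal approximation; the cells of
`Z_K × Z_K` are the products of the cells of `Z_K`. -/
noncomputable def diagChain : CellChain k K →ₗ[k] (ZCell K × ZCell K →₀ k) :=
  Finsupp.linearCombination k fun c =>
    ∑ p : ZCell K × ZCell K, (diagDegree c.1 p.1.1 p.2.1 : k) • Finsupp.single p (1 : k)

/-- The cross product of cochains: `(a × b)(c' × c'') = a(c') b(c'')`. -/
noncomputable def crossProd :
    CellCochain k K →ₗ[k] CellCochain k K →ₗ[k] Module.Dual k (ZCell K × ZCell K →₀ k) :=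
  LinearMap.mk₂ k (fun a b => Finsupp.linearCombination k fun p =>
      a (Finsupp.single p.1 1) * b (Finsupp.single p.2 1))
    (fun a a' b => by ext p; simp [add_mul])
    (fun r a b => by ext p; simp [mul_assoc])
    (fun a b b' => by ext p; simp [mul_add])
    (fun r a b => by ext p; simp [mul_left_comm])

/-- The cochain `(D_I T_J)^*` dual to a cell of `Z_K`. -/
noncomputable def dualCell (c : ZCell K) : CellCochain k K := Finsupp.lapply c

/-- The cellular cochain algebra `C^*(Z_K)`: the dual of the cellular chain complex, with the product
`(a b)(c) = (a × b)(Δ c)` induced by the diagonal approximation, the unit cochain with value `1` on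
every `0`-cell, and the grading by the dimension of cells. -/
noncomputable def cellularDGA : PreDGA k (CellCochain k K) where
  one := Finsupp.linearCombination k fun c => if c.1.dim = 0 then (1 : k) else 0
  mul := (crossProd k K).compr₂ (diagChain k K).dualMap
  d := (cellBoundary k K).dualMap
  deg n :=
    { carrier := {a | ∀ c : ZCell K, c.1.dim ≠ n → a (Finsupp.single c 1) = 0}
      zero_mem' := fun _ _ => rfl
      add_mem' := fun ha hb c hc => by simp [ha c hc, hb c hc]
      smul_mem' := fun r a ha c hc => by simp [ha c hc] }

end Cellular

end MomentAngle

/-! Both sides have a basis indexed by the cells `D_I T_J` with `I ∈ K`, so the linear isomorphism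
`toCochain` is forced. What remains is to compare structure constants: coefficients of `d` with
incidence numbers (`cellCoeff_koszulD_eq_incidence`), and coefficients of products with degrees of
the diagonal approximation (`cellCoeff_mul_eq_diagDegree`).

The ideal generated by the `v_i²` and `v_i u_i` is two-sided and closed under `d`. Hence `C^*(K)` is
a quotient of the Koszul algebra and inherits its axioms (`koszulDGA_isDGA`). On the cellular side
`∂∂ = 0`, associativity and the Leibniz rule are never checked geometrically; they are carried over
by the isomorphism (`PreDGA.IsDGA.of_isIso`).

Differential. Count the points of the boundary of the cube of `c` that go to the centre of `c'`. The
two end faces of a factor `T` are glued and cancel. A square of a factor `D` meets the centre `-1`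
of `T` only in the midpoint of its left edge. That edge is run through clockwise, against `T`, and
this minus sign cancels the one of the lower face. There remains `(-1)^offset`, whose parity is the
number of factors `T` before the `i`-th one, as in `d u_J`.

Product. A coordinate of `diagApprox` is `wrap` in one component and `1` in the other. The zeros of
`wrap` are `±i/2`, and its derivative there is complex linear, so it preserves orientation; on the
circle it is squaring. Thus every factor of `c` serves at most one of `c'`, `c''`. Equality of
dimensions allows no loss, so `c` splits into `c'` and `c''`, and the centre of `c' × c''` has one
preimage. The sign of the determinant there is the sign of reordering the real coordinates of `c`
into those of `c'` followed by those of `c''`. Discs move as pairs, so only the factors `T` count,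
exactly as in `u_J' u_J'' = ± u_J`.

The two signs are not computed but obtained from one lemma, `list_prod_map_mul`: once in `Λ[u_1, …,
u_m]`, once in the exterior algebra of `ℝⁿ`, on whose top power a linear map acts by its determinant
(`det_eq_of_map_extTop`). -/

namespace MomentAngle

/-! ### Signs of reordering products of graded-commuting factors. -/

section Signs

variable {m : ℕ}

/-- The sign of moving `y_j` past `x_i`, where `x_i` is odd for `i ∈ s` and `y_j` for `j ∈ t`. -/
def exchangeSign (s t : Finset (Fin m)) (j i : Fin m) : ℤ := if j ∈ t ∧ i ∈ s then -1 else 1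

/-- The sign of unshuffling the product of the `x_i y_i`, `i ∈ l`, into the product of the `x_i`
times the product of the `y_i`. -/
def unshuffleSign (s t : Finset (Fin m)) : List (Fin m) → ℤ
  | [] => 1
  | j :: l => (l.map (exchangeSign s t j)).prod * unshuffleSign s t l

lemma list_prod_mul_move {R : Type*} [Ring R] (y : R) (x : Fin m → R) (ε : Fin m → ℤ)
    (h : ∀ i, y * x i = ε i • (x i * y)) (l : List (Fin m)) :
    y * (l.map x).prod = (l.map ε).prod • ((l.map x).prod * y) := by
  induction l with
  | nil => simp
  | cons i l ih =>
    simp only [List.map_cons, List.prod_cons]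
    rw [← mul_assoc, h, smul_mul_assoc, mul_assoc (x i), ih, mul_smul_comm, smul_smul, mul_assoc]

/-- Each `y_j` has to pass the `x_i` that come later in the list. This is the common source of the
product signs: it is applied to the generators `u_i` in `uMon_mul_uMon` and to blocks of coordinate
vectors in `Cell.Splits.prod_block`. -/
lemma list_prod_map_mul {R : Type*} [Ring R] (s t : Finset (Fin m)) (x y : Fin m → R)
    (h : ∀ j i, y j * x i = exchangeSign s t j i • (x i * y j)) (l : List (Fin m)) :
    (l.map fun i => x i * y i).prod =
      unshuffleSign s t l • ((l.map x).prod * (l.map y).prod) := by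
  induction l with
  | nil => simp [unshuffleSign]
  | cons j l ih =>
    simp only [List.map_cons, List.prod_cons, unshuffleSign]
    rw [ih, mul_smul_comm, mul_assoc (x j), ← mul_assoc (y j),
      list_prod_mul_move _ _ _ (h j), smul_mul_assoc, mul_smul_comm, smul_smul, mul_comm]
    simp only [mul_assoc]

lemma unshuffleSign_eq (s t : Finset (Fin m)) (l : List (Fin m)) :
    unshuffleSign s t l = 1 ∨ unshuffleSign s t l = -1 := by
  have h : ∀ j (l : List (Fin m)), (l.map (exchangeSign s t j)).prod = 1 ∨
      (l.map (exchangeSign s t j)).prod = -1 := by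
    intro j l
    induction l with
    | nil => simp
    | cons i l ih =>
      rw [List.map_cons, List.prod_cons, exchangeSign]
      split_ifs <;> rcases ih with h | h <;> simp [h]
  induction l with
  | nil => simp [unshuffleSign]
  | cons j l ih =>
    rw [unshuffleSign]
    rcases h j l with h1 | h1 <;> rcases ih with h2 | h2 <;> simp [h1, h2]

/-- Turns products over the sorted `J` into products over all coordinates, with factors `1` outside
`J`. Products for different `J` then run over one list, as `list_prod_map_mul` requires. -/
lemma sort_eq_filter (J : Finset (Fin m)) :
    J.sort (· ≤ ·) = (List.finRange m).filter (· ∈ J) := by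
  have h : ((List.finRange m).filter (· ∈ J)).toFinset = J := by ext; simp
  have h2 := (List.toFinset_sort (r := (· ≤ ·)) ((List.nodup_finRange m).filter (· ∈ J))).2
    ((List.pairwise_le_finRange m).filter _)
  rw [h] at h2
  exact h2

lemma list_prod_filter {R ι : Type*} [Monoid R] (x : ι → R) (p : ι → Prop) [DecidablePred p]
    (l : List ι) : ((l.filter (p ·)).map x).prod = (l.map fun i => if p i then x i else 1).prod := by
  induction l with
  | nil => simp
  | cons i l ih => by_cases h : p i <;> simp [h, ih]

end Signs

/-! ### Products, contractions and degrees of the monomials `u_J`. -/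

section Exterior

variable (k : Type*) [Field k] {m : ℕ}

lemma uMon_eq_prod (J : Finset (Fin m)) :
    uMon k J = ((List.finRange m).map fun i => if i ∈ J then u k i else 1).prod := by
  rw [uMon, sort_eq_filter, list_prod_filter]

lemma u_mul_u (i j : Fin m) : u k i * u k j = -(u k j * u k i) := by
  have := ExteriorAlgebra.ι_add_mul_swap (R := k) (Pi.single i 1 : Fin m → k) (Pi.single j 1)
  exact eq_neg_of_add_eq_zero_left this

lemma uMon_mul_uMon {s t : Finset (Fin m)} (h : Disjoint s t) :
    uMon k s * uMon k t = unshuffleSign s t (List.finRange m) • uMon k (s ∪ t) := by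
  have key := list_prod_map_mul s t (fun i => if i ∈ s then u k i else 1)
    (fun i => if i ∈ t then u k i else 1) (fun j i => by
      by_cases hj : j ∈ t <;> by_cases hi : i ∈ s <;> simp [exchangeSign, hi, hj, u_mul_u k j i])
    (List.finRange m)
  have h2 : (fun i : Fin m => (if i ∈ s then u k i else 1) * if i ∈ t then u k i else 1) =
      fun i => if i ∈ s ∪ t then u k i else 1 := by
    funext i
    have : i ∈ s → i ∉ t := fun h1 => Finset.disjoint_left.1 h h1
    by_cases hs : i ∈ s <;> by_cases ht : i ∈ t <;> simp_all
  rw [h2, ← uMon_eq_prod, ← uMon_eq_prod, ← uMon_eq_prod] at key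
  -- `key` expresses `u_{s ∪ t}` by the product; the sign is its own inverse.
  rw [key, smul_smul]
  rcases unshuffleSign_eq s t (List.finRange m) with h | h <;> simp [h]

lemma u_mul_uMon (i : Fin m) (J : Finset (Fin m)) :
    u k i * uMon k J = (-1 : k) ^ J.card • (uMon k J * u k i) := by
  have := list_prod_mul_move (u k i) (u k) (fun _ => -1) (fun j => by simp [u_mul_u k i j])
    (J.sort (· ≤ ·))
  rw [uMon, this, List.map_const', List.prod_replicate, Finset.length_sort, ← Int.cast_smul_eq_zsmul k]
  simp

/-- The antiderivation changes sign at every generator in front of `u_i`; in a sorted list these are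
the ones of smaller index. -/
lemma contract_prod_of_mem (i : Fin m) (l : List (Fin m)) (hl : l.Pairwise (· < ·)) (h : i ∈ l) :
    contract k i (l.map (u k)).prod =
      (-1 : k) ^ (l.filter (· < i)).length • ((l.erase i).map (u k)).prod := by
  induction l with
  | nil => simp at h
  | cons j l ih =>
    rw [List.pairwise_cons] at hl
    rw [List.map_cons, List.prod_cons, contract_u_mul]
    by_cases hij : i = j
    · subst hij
      rw [if_pos rfl, contract_prod_of_notMem]
      · have : l.filter (· < i) = [] := by
          simp only [List.filter_eq_nil_iff, decide_eq_true_eq, not_lt]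
          exact fun a ha => (hl.1 a ha).le
        simp [this]
      · exact fun hi => lt_irrefl _ (hl.1 i hi)
    · have hi : i ∈ l := by simpa [hij] using h
      rw [if_neg hij, ih hl.2 hi, List.erase_cons_tail (by simpa using Ne.symm hij),
        List.filter_cons_of_pos (by simpa using hl.1 i hi), List.length_cons, pow_succ,
        List.map_cons, List.prod_cons, mul_smul_comm, mul_neg_one, neg_smul, zero_sub]

lemma contract_uMon_of_mem {i : Fin m} {J : Finset (Fin m)} (h : i ∈ J) :
    contract k i (uMon k J) = (-1 : k) ^ (J.filter (· < i)).card • uMon k (J.erase i) := by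
  have h1 : J.sort (· ≤ ·) = (List.finRange m).filter (· ∈ J) := sort_eq_filter J
  have h2 : (J.sort (· ≤ ·)).erase i = (J.erase i).sort (· ≤ ·) := by
    rw [(J.sort_nodup _).erase_eq_filter, sort_eq_filter, sort_eq_filter, List.filter_filter]
    congr 1
    funext j
    by_cases hj : j = i <;> simp [hj]
  have h3 : (J.filter (· < i)).card = ((J.sort (· ≤ ·)).filter (· < i)).length := by
    rw [← Finset.length_sort (· ≤ ·), sort_eq_filter, sort_eq_filter, List.filter_filter]
    congr 2
    funext j
    simp [Bool.and_comm]
  rw [uMon, contract_prod_of_mem k i _ (Finset.sortedLT_sort J).pairwise (by simpa using h), h2, h3, uMon]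

lemma contract_uMon_of_notMem {i : Fin m} {J : Finset (Fin m)} (h : i ∉ J) :
    contract k i (uMon k J) = 0 := by
  rw [uMon, contract_prod_of_notMem]
  simpa using h

lemma uMon_mem_exteriorPower (J : Finset (Fin m)) : uMon k J ∈ ⋀[k]^J.card (Fin m → k) := by
  rw [uMon_eq_basis, ExteriorAlgebra.basis_apply_ofCard _ rfl]
  exact Set.mem_of_mem_of_subset (ExteriorAlgebra.ιMulti_range k _ ⟨_, rfl⟩) le_rfl

/-- The `q`-th exterior power is spanned by the `u_s` with `#s = q`, and `u_J` is not among them. -/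
lemma extCoeff_of_mem_exteriorPower {q : ℕ} {J : Finset (Fin m)} (h : J.card ≠ q)
    {b : ExteriorAlgebra k (Fin m → k)} (hb : b ∈ ⋀[k]^q (Fin m → k)) : extCoeff k J b = 0 := by
  have := ((Pi.basisFun k (Fin m)).exteriorPower q).span_eq
  have hb' : b ∈ Submodule.span k (Set.range fun s : Set.powersetCard (Fin m) q => uMon k s.1) := by
    have h1 : (⟨b, hb⟩ : ⋀[k]^q (Fin m → k)) ∈ Submodule.span k
      (Set.range ((Pi.basisFun k (Fin m)).exteriorPower q)) := by rw [this]; trivial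
    have h2 := Submodule.mem_map_of_mem (f := Submodule.subtype _) h1
    rw [Submodule.map_span, ← Set.range_comp] at h2
    have h3 : (fun s : Set.powersetCard (Fin m) q => uMon k s.1) =
        (⋀[k]^q (Fin m → k)).subtype ∘ (Pi.basisFun k (Fin m)).exteriorPower q := by
      funext s
      rw [uMon_eq_basis]
      exact ExteriorAlgebra.basis_eq_coe_basis (Pi.basisFun k (Fin m)) s
    rw [h3]
    exact h2
  clear this hb
  induction hb' using Submodule.span_induction with
  | zero => simp
  | add x y _ _ hx hy => rw [map_add, hx, hy, add_zero]
  | smul a x _ hx => rw [map_smul, hx, smul_zero]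
  | mem x hx =>
    obtain ⟨s, rfl⟩ := hx
    simp only
    rw [extCoeff_uMon, if_neg]
    rintro rfl
    exact h s.2

end Exterior

/-! ### Which cells lie in the moment-angle complex. -/

section Centre

variable {m : ℕ}

/-- The centre of a cell. -/
def Cell.centre (c : Cell m) : Fin m → ℂ := fun i =>
  if i ∈ c.I then 0 else if i ∈ c.J then -1 else 1

lemma Cell.centre_mem (c : Cell m) : c.centre ∈ c.openCell := by
  intro i
  by_cases hI : i ∈ c.I <;> by_cases hJ : i ∈ c.J <;> simp [Cell.centre, hI, hJ]
  norm_num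

/-- The centre is a test point: its coordinates in `I` are `0`, so it lies in `B_J` only if `I ⊆ J`.
Conversely all coordinates of the cell outside `I` have modulus `1`. -/
lemma openCell_subset_iff (K : AbstractSimplicialComplex (Fin m)) (c : Cell m) :
    c.openCell ⊆ momentAngle K ↔ IsSimplex K c.I := by
  constructor
  · intro h
    obtain ⟨_, J, hJ, hz⟩ := h c.centre_mem
    refine hJ.subset fun i hi => ?_
    by_contra hn
    have := hz i hn
    simp [Cell.centre, hi] at this
  · intro h z hz
    refine ⟨fun i => ?_, c.I, h, fun i hi => ?_⟩
    · have := hz i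
      split_ifs at this
      · exact this.le
      · exact this.1.le
      · simp [this]
    · have := hz i
      rw [if_neg hi] at this
      split_ifs at this
      · exact this.1
      · simp [this]

end Centre

/-! ### The basis of `C^*(K)`, the linear isomorphism with the cochains, and the axioms of the two
algebras. -/

section Algebra

variable (k : Type*) [Field k] {m : ℕ} (K : AbstractSimplicialComplex (Fin m))

variable {K} in
lemma ZCell.isSimplex (c : ZCell K) : IsSimplex K c.1.I := (openCell_subset_iff K c.1).1 c.2

/-- The coefficient of `v_I u_J` for a cell `D_I T_J` of `Z_K`. -/
noncomputable def cellCoeff (c : ZCell K) : Koszul k K →ₗ[k] k := monoCoeff k K c.isSimplex c.1.J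

/-- The monomial `v_I u_J` for a cell `D_I T_J` of `Z_K`. -/
noncomputable def cellMonomial (c : ZCell K) : reducedKoszul k K :=
  ⟨monomialVU k K c.1.I c.1.J, monomialVU_mem k K c.1.disj⟩

open Classical in
lemma cellCoeff_cellMonomial (c c' : ZCell K) :
    cellCoeff k K c (cellMonomial k K c') = if c' = c then 1 else 0 := by
  rw [cellCoeff, cellMonomial, monoCoeff_monomialVU]
  congr 1
  exact propext ⟨fun h => Subtype.ext (Cell.ext h.1 h.2), fun h => by subst h; exact ⟨rfl, rfl⟩⟩

lemma cellCoeff_squareIdeal (c : ZCell K) {x : Koszul k K} (hx : x ∈ squareIdeal k K) :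
    cellCoeff k K c x = 0 :=
  monoCoeff_squareIdeal k K c.isSimplex c.1.disj hx

lemma sub_koszulProj_mem (x : Koszul k K) : x - koszulProj k K x ∈ squareIdeal k K := by
  rw [← Submodule.projectionOnto_apply_eq_zero_iff (isCompl_reducedKoszul_squareIdeal k K), map_sub]
  change koszulProj k K x - koszulProj k K _ = 0
  rw [koszulProj, Submodule.projectionOnto_apply_left, sub_self]

lemma koszulProj_coe (x : reducedKoszul k K) : koszulProj k K x = x :=
  Submodule.projectionOnto_apply_left _ x

lemma koszulProj_eq_zero {x : Koszul k K} (hx : x ∈ squareIdeal k K) : koszulProj k K x = 0 :=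
  (Submodule.projectionOnto_apply_eq_zero_iff (isCompl_reducedKoszul_squareIdeal k K)).2 hx

/-- The coefficients vanish on the ideal along which `j` projects. Products in `C^*(K)` can
therefore be expanded in the Koszul algebra without evaluating `j`. -/
lemma cellCoeff_koszulProj (c : ZCell K) (x : Koszul k K) :
    cellCoeff k K c (koszulProj k K x) = cellCoeff k K c x := by
  have := cellCoeff_squareIdeal k K c (sub_koszulProj_mem k K x)
  rw [map_sub, sub_eq_zero] at this
  exact this.symm

/-- The spanning half of the basis property; independence is contained in `cellCoeff_cellMonomial`.
-/
lemma mem_reducedKoszul_iff (x : reducedKoszul k K) :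
    x ∈ Submodule.span k (Set.range (cellMonomial k K)) := by
  obtain ⟨x, hx⟩ := x
  have : x ∈ (Submodule.span k (Set.range (cellMonomial k K))).map (reducedKoszul k K).subtype := by
    rw [Submodule.map_span]
    refine Submodule.span_mono ?_ hx
    rintro _ ⟨I, J, hI, hIJ, rfl⟩
    exact ⟨_, ⟨⟨⟨I, J, hIJ⟩, (openCell_subset_iff K _).2 hI⟩, rfl⟩, rfl⟩
  obtain ⟨y, hy, rfl⟩ := this
  exact hy

lemma dualCell_single (c c' : ZCell K) [Decidable (c' = c)] :
    dualCell k K c (Finsupp.single c' 1) = if c' = c then 1 else 0 := by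
  classical
  rw [dualCell, Finsupp.lapply_apply, Finsupp.single_apply]

/-- The isomorphism of `C^*(K)` with the cellular cochains that maps `v_I u_J` to `(D_I T_J)^*`. -/
noncomputable def toCochain : reducedKoszul k K ≃ₗ[k] CellCochain k K :=
  LinearEquiv.ofLinearMap
    (∑ c, (cellCoeff k K c ∘ₗ (reducedKoszul k K).subtype).smulRight (dualCell k K c))
    (∑ c, (Module.Dual.eval k (CellChain k K) (Finsupp.single c 1)).smulRight (cellMonomial k K c))
    (by
      classical
      ext a c
      simp [cellCoeff_cellMonomial, dualCell_single])
    (by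
      classical
      ext x : 1
      induction mem_reducedKoszul_iff k K x using Submodule.span_induction with
      | zero => simp
      | add x y _ _ hx hy => rw [map_add, hx, hy, map_add]
      | smul a x _ hx => rw [map_smul, hx, map_smul]
      | mem x hx =>
        obtain ⟨c, rfl⟩ := hx
        simp [cellCoeff_cellMonomial, dualCell_single])

lemma toCochain_apply (x : reducedKoszul k K) (c : ZCell K) :
    toCochain k K x (Finsupp.single c 1) = cellCoeff k K c x := by
  classical
  simp [toCochain, LinearMap.sum_apply, dualCell_single]

lemma toCochain_cellMonomial (c : ZCell K) :
    toCochain k K (cellMonomial k K c) = dualCell k K c := by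
  classical
  ext c'
  simp only [LinearMap.coe_comp, Function.comp_apply, Finsupp.lsingle_apply]
  rw [toCochain_apply, cellCoeff_cellMonomial, dualCell_single]
  simp [eq_comm]

lemma eq_sum_cellMonomial (x : reducedKoszul k K) :
    x = ∑ c, cellCoeff k K c x • cellMonomial k K c := by
  classical
  apply (toCochain k K).injective
  ext c
  simp [toCochain_cellMonomial, toCochain_apply, dualCell_single]

lemma monomialVU_mem_koszulDeg {n : ℕ} (I J : Finset (Fin m)) (h : 2 * I.card + J.card = n) :
    monomialVU k K I J ∈ koszulDeg k K n := by
  refine Submodule.subset_span ⟨I.card, J.card, h, ∏ i ∈ I, MvPolynomial.X i, ?_, uMon k J,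
    uMon_mem_exteriorPower k J, ?_⟩
  · have := MvPolynomial.IsHomogeneous.prod I (fun i => (MvPolynomial.X i : MvPolynomial (Fin m) k))
      (fun _ => 1) (fun i _ => MvPolynomial.isHomogeneous_X k i)
    simpa using this
  · rw [map_prod]; rfl

/-- On a tensor of bidegree `(p, q)`, either `#J ≠ q` and the exterior factor has no term `u_J`, or
`#I ≠ p` and the polynomial factor has no term `v_I`. -/
lemma cellCoeff_of_mem_koszulDeg {n : ℕ} {c : ZCell K} (h : c.1.dim ≠ n) {x : Koszul k K}
    (hx : x ∈ koszulDeg k K n) : cellCoeff k K c x = 0 := by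
  induction hx using Submodule.span_induction with
  | zero => simp
  | add x y _ _ hx hy => rw [map_add, hx, hy, add_zero]
  | smul a x _ hx => rw [map_smul, hx, smul_zero]
  | mem x hx =>
    obtain ⟨p, q, rfl, a, ha, b, hb, rfl⟩ := hx
    rw [cellCoeff, monoCoeff_tmul, faceCoeff_mk]
    by_cases hq : c.1.J.card = q
    · have hp : c.1.I.card ≠ p := by rintro rfl; exact h (by rw [Cell.dim, hq])
      rw [MvPolynomial.IsHomogeneous.coeff_eq_zero (n := p) ha, zero_mul]
      simpa [Finsupp.degree_eq_sum, expo_apply] using hp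
    · rw [extCoeff_of_mem_exteriorPower k hq hb, mul_zero]

/-- Under `toCochain` this condition on coefficients is the one that defines the grading of the
cochains. -/
lemma mem_koszulDGA_deg_iff {n : ℕ} (x : reducedKoszul k K) :
    x ∈ (koszulDGA k K).deg n ↔ ∀ c : ZCell K, c.1.dim ≠ n → cellCoeff k K c x = 0 := by
  constructor
  · exact fun hx c hc => cellCoeff_of_mem_koszulDeg k K hc hx
  · intro h
    rw [eq_sum_cellMonomial k K x]
    refine Submodule.sum_mem _ fun c _ => ?_
    by_cases hc : c.1.dim = n
    · exact Submodule.smul_mem _ _ (monomialVU_mem_koszulDeg k K _ _ hc)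
    · rw [h c hc, zero_smul]; exact Submodule.zero_mem _

lemma koszulProj_mem_deg {n : ℕ} {x : Koszul k K} (hx : x ∈ koszulDeg k K n) :
    koszulProj k K x ∈ (koszulDGA k K).deg n := by
  rw [mem_koszulDGA_deg_iff]
  intro c hc
  rw [cellCoeff_koszulProj, cellCoeff_of_mem_koszulDeg k K hc hx]

lemma koszulDGA_deg_induction {n : ℕ} {P : reducedKoszul k K → Prop} (zero : P 0)
    (add : ∀ x y, P x → P y → P (x + y)) (smul : ∀ (r : k) x, P x → P (r • x))
    (monomial : ∀ c : ZCell K, c.1.dim = n → P (cellMonomial k K c))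
    {x : reducedKoszul k K} (hx : x ∈ (koszulDGA k K).deg n) : P x := by
  rw [mem_koszulDGA_deg_iff] at hx
  rw [eq_sum_cellMonomial k K x]
  refine Finset.sum_induction _ P add zero fun c _ => ?_
  by_cases hc : c.1.dim = n
  · exact smul _ _ (monomial c hc)
  · rw [hx c hc, zero_smul]; exact zero

lemma mul_mem_koszulDeg {p q : ℕ} {x y : Koszul k K} (hx : x ∈ koszulDeg k K p)
    (hy : y ∈ koszulDeg k K q) : x * y ∈ koszulDeg k K (p + q) := by
  have := Submodule.mul_mem_mul hx hy
  rw [koszulDeg, koszulDeg, Submodule.span_mul_span] at this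
  refine Submodule.span_mono ?_ this
  rintro _ ⟨_, ⟨p₁, q₁, rfl, a₁, ha₁, b₁, hb₁, rfl⟩, _, ⟨p₂, q₂, rfl, a₂, ha₂, b₂, hb₂, rfl⟩, rfl⟩
  refine ⟨p₁ + p₂, q₁ + q₂, by ring, a₁ * a₂, MvPolynomial.IsHomogeneous.mul ha₁ ha₂, b₁ * b₂, ?_, ?_⟩
  · rw [ExteriorAlgebra.exteriorPower, pow_add]; exact Submodule.mul_mem_mul hb₁ hb₂
  · simp only [Algebra.TensorProduct.tmul_mul_tmul, map_mul]

lemma koszulD_monomialVU (I J : Finset (Fin m)) :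
    koszulD k K (monomialVU k K I J) =
      ∑ i ∈ J, (-1 : k) ^ (J.filter (· < i)).card •
        ((v k K i * vMon k K I) ⊗ₜ[k] uMon k (J.erase i)) := by
  rw [monomialVU, koszulD_tmul, ← Finset.sum_subset (Finset.subset_univ J)]
  · refine Finset.sum_congr rfl fun i hi => ?_
    rw [contract_uMon_of_mem k hi, TensorProduct.tmul_smul]
  · intro i _ hi
    rw [contract_uMon_of_notMem k hi, TensorProduct.tmul_zero]

lemma koszulD_mem_koszulDeg {n : ℕ} (c : ZCell K) (h : c.1.dim = n) :
    koszulD k K (cellMonomial k K c) ∈ koszulDeg k K (n + 1) := by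
  rw [cellMonomial, koszulD_monomialVU]
  refine Submodule.sum_mem _ fun i hi => Submodule.smul_mem _ _ ?_
  have hI : i ∉ c.1.I := fun h => Finset.disjoint_left.1 c.1.disj h hi
  have : v k K i * vMon k K c.1.I = vMon k K (insert i c.1.I) := by
    rw [vMon, vMon, Finset.prod_insert hI]
  rw [this]
  refine monomialVU_mem_koszulDeg k K _ _ ?_
  rw [Finset.card_insert_of_notMem hI, Finset.card_erase_of_mem hi, ← h, Cell.dim]
  have := Finset.card_pos.2 ⟨i, hi⟩
  omega

/-- `koszulD_u_mul` handles one generator; the Leibniz rule for `u_J` follows by splitting off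
generators from the left. -/
lemma koszulD_list_prod_mul (l : List (Fin m)) (x : Koszul k K) :
    koszulD k K ((1 ⊗ₜ (l.map (u k)).prod) * x) = koszulD k K (1 ⊗ₜ (l.map (u k)).prod) * x +
      (-1 : k) ^ l.length • ((1 ⊗ₜ (l.map (u k)).prod) * koszulD k K x) := by
  induction l with
  | nil =>
    rw [List.map_nil, List.prod_nil, koszulD_v, ← Algebra.TensorProduct.one_def]
    simp
  | cons j l ih =>
    have h : (1 : FaceRing k K) ⊗ₜ[k] ((j :: l).map (u k)).prod =
        (1 ⊗ₜ u k j) * (1 ⊗ₜ (l.map (u k)).prod) := by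
      rw [Algebra.TensorProduct.tmul_mul_tmul, mul_one, List.map_cons, List.prod_cons]
    rw [h, mul_assoc, koszulD_u_mul, koszulD_u_mul, ih, List.length_cons, pow_succ, mul_neg_one,
      neg_smul, mul_add, sub_mul, mul_smul_comm]
    simp only [mul_assoc]
    abel

lemma koszulD_monomialVU_mul (I J : Finset (Fin m)) (x : Koszul k K) :
    koszulD k K (monomialVU k K I J * x) = koszulD k K (monomialVU k K I J) * x +
      (-1 : k) ^ J.card • (monomialVU k K I J * koszulD k K x) := by
  have h : monomialVU k K I J = (vMon k K I ⊗ₜ 1) * (1 ⊗ₜ uMon k J) := by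
    rw [Algebra.TensorProduct.tmul_mul_tmul, mul_one, one_mul, monomialVU]
  rw [h, mul_assoc, koszulD_v_mul, koszulD_v_mul, uMon, koszulD_list_prod_mul, mul_add,
    mul_smul_comm, Finset.length_sort]
  simp only [mul_assoc]

/-- Pure tensors are refined to those with exterior factor `u_J`, past which a generator `u_i` moves
with a known sign. -/
lemma koszul_induction {P : Koszul k K → Prop} (zero : P 0) (add : ∀ x y, P x → P y → P (x + y))
    (tmul : ∀ a J, P (a ⊗ₜ uMon k J)) (x : Koszul k K) : P x := by
  induction x using TensorProduct.induction_on with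
  | zero => exact zero
  | add x y hx hy => exact add x y hx hy
  | tmul a b =>
    have hb : b ∈ Submodule.span k (Set.range (uMon k)) := by
      have : uMon k = ⇑(Pi.basisFun k (Fin m)).ExteriorAlgebra := funext (uMon_eq_basis k)
      rw [this, Module.Basis.span_eq]; trivial
    induction hb using Submodule.span_induction generalizing a with
    | zero => rw [TensorProduct.tmul_zero]; exact zero
    | add x y _ _ hx hy => rw [TensorProduct.tmul_add]; exact add _ _ (hx a) (hy a)
    | smul r x _ hx => rw [← TensorProduct.smul_tmul]; exact hx _
    | mem b hb => obtain ⟨J, rfl⟩ := hb; exact tmul a J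

lemma neg_one_pow_smul_self (n : ℕ) {V : Type*} [AddCommGroup V] [Module k V] (x : V) :
    (-1 : k) ^ n • (-1 : k) ^ n • x = x := by
  rw [smul_smul, ← mul_pow]; simp

lemma sq_mul_mem (i : Fin m) (x : Koszul k K) : (v k K i ^ 2) ⊗ₜ 1 * x ∈ squareIdeal k K := by
  have : (v k K i ^ 2) ⊗ₜ 1 * x = x * (v k K i ^ 2) ⊗ₜ 1 := by
    induction x using TensorProduct.induction_on with
    | zero => simp
    | add x y hx hy => rw [mul_add, add_mul, hx, hy]
    | tmul a b => simp only [Algebra.TensorProduct.tmul_mul_tmul, one_mul, mul_one, mul_comm]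
  rw [this]
  exact Ideal.mul_mem_left _ _ (Ideal.subset_span (Or.inl ⟨i, rfl⟩))

lemma vu_mul_tmul_uMon (i : Fin m) (a : FaceRing k K) (J : Finset (Fin m)) :
    v k K i ⊗ₜ[k] u k i * a ⊗ₜ[k] uMon k J =
      (-1 : k) ^ J.card • (a ⊗ₜ[k] uMon k J * v k K i ⊗ₜ[k] u k i) := by
  rw [Algebra.TensorProduct.tmul_mul_tmul, Algebra.TensorProduct.tmul_mul_tmul, u_mul_uMon, mul_comm a,
    TensorProduct.tmul_smul]

lemma vu_mul_mem (i : Fin m) (x : Koszul k K) : v k K i ⊗ₜ u k i * x ∈ squareIdeal k K := by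
  induction x using koszul_induction with
  | zero => simp
  | add x y hx hy => rw [mul_add]; exact Submodule.add_mem _ hx hy
  | tmul a J =>
    rw [vu_mul_tmul_uMon]
    exact Submodule.smul_mem _ _ (Ideal.mul_mem_left _ _ (Ideal.subset_span (Or.inr ⟨i, rfl⟩)))

/-- The ideal is defined as a left ideal, with the generators on the right. As they commute with `a
⊗ u_J` up to sign, they can be put on the left, where right multiplication and the rules
`koszulD_v_mul`, `koszulD_u_mul` apply. -/
lemma squareIdeal_induction {P : Koszul k K → Prop} (zero : P 0) (add : ∀ x y, P x → P y → P (x + y))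
    (smul : ∀ (r : k) x, P x → P (r • x))
    (sq : ∀ i x, P ((v k K i ^ 2) ⊗ₜ 1 * x)) (vu : ∀ i x, P (v k K i ⊗ₜ u k i * x))
    {x : Koszul k K} (hx : x ∈ squareIdeal k K) : P x := by
  have key : ∀ x ∈ Ideal.span ({x : Koszul k K | ∃ i, x = (v k K i ^ 2) ⊗ₜ[k] 1} ∪
      {x | ∃ i, x = v k K i ⊗ₜ[k] u k i}), ∀ y : Koszul k K, P (y * x) := by
    intro x hx
    induction hx using Submodule.span_induction with
    | zero => simpa using zero
    | add x y hx hy h1 h2 => intro z; rw [mul_add]; exact add _ _ (h1 z) (h2 z)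
    | smul a x _ hx => intro z; rw [smul_eq_mul, ← mul_assoc]; exact hx _
    | mem x hx =>
      intro y
      induction y using koszul_induction with
      | zero => simpa using zero
      | add y z h1 h2 => rw [add_mul]; exact add _ _ h1 h2
      | tmul a J =>
        rcases hx with ⟨i, rfl⟩ | ⟨i, rfl⟩
        · have := sq i (a ⊗ₜ uMon k J)
          rw [Algebra.TensorProduct.tmul_mul_tmul, one_mul, mul_comm] at this
          rwa [Algebra.TensorProduct.tmul_mul_tmul, mul_one]
        -- The extra scalar cancels the sign of moving `u_i` past `u_J`.
        · have := smul ((-1) ^ J.card) _ (vu i (a ⊗ₜ uMon k J))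
          rwa [vu_mul_tmul_uMon, neg_one_pow_smul_self] at this
  simpa using key x hx 1

lemma squareIdeal_mul_mem {x : Koszul k K} (hx : x ∈ squareIdeal k K) (y : Koszul k K) :
    x * y ∈ squareIdeal k K := by
  refine squareIdeal_induction k K (P := fun x => x * y ∈ squareIdeal k K) ?_ ?_ ?_ ?_ ?_ hx
  · simp
  · intro x y hx hy; rw [add_mul]; exact Submodule.add_mem _ hx hy
  · intro r x hx; rw [smul_mul_assoc]; exact Submodule.smul_mem _ _ hx
  · intro i x; rw [mul_assoc]; exact sq_mul_mem k K i _
  · intro i x; rw [mul_assoc]; exact vu_mul_mem k K i _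

lemma mul_squareIdeal_mem {x : Koszul k K} (hx : x ∈ squareIdeal k K) (y : Koszul k K) :
    y * x ∈ squareIdeal k K := Ideal.mul_mem_left _ _ hx

/-- `d(v_i² x) = v_i² dx` and `d(v_i u_i x) = v_i² x - v_i u_i dx`. -/
lemma koszulD_squareIdeal {x : Koszul k K} (hx : x ∈ squareIdeal k K) :
    koszulD k K x ∈ squareIdeal k K := by
  refine squareIdeal_induction k K (P := fun x => koszulD k K x ∈ squareIdeal k K) ?_ ?_ ?_ ?_ ?_ hx
  · simp
  · intro x y hx hy; rw [map_add]; exact Submodule.add_mem _ hx hy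
  · intro r x hx; rw [map_smul]; exact Submodule.smul_mem _ _ hx
  · intro i x; rw [koszulD_v_mul]; exact sq_mul_mem k K i _
  · intro i x
    have h : v k K i ⊗ₜ[k] u k i = (v k K i ⊗ₜ 1) * (1 ⊗ₜ u k i) := by
      rw [Algebra.TensorProduct.tmul_mul_tmul, mul_one, one_mul]
    rw [h, mul_assoc, koszulD_v_mul, koszulD_u_mul, mul_sub, ← mul_assoc, ← mul_assoc, ← h,
      Algebra.TensorProduct.tmul_mul_tmul, mul_one, ← pow_two]
    exact Submodule.sub_mem _ (sq_mul_mem k K i _) (vu_mul_mem k K i _)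

/-- Because the ideal is two-sided, `j` can be dropped inside a product. This reduces the unit and
associativity laws to those of the Koszul algebra. -/
lemma koszulProj_mul_left (x y : Koszul k K) :
    koszulProj k K (koszulProj k K x * y) = koszulProj k K (x * y) := by
  rw [eq_comm, ← sub_eq_zero, ← map_sub, ← sub_mul]
  exact koszulProj_eq_zero k K (squareIdeal_mul_mem k K (sub_koszulProj_mem k K x) y)

lemma koszulProj_mul_right (x y : Koszul k K) :
    koszulProj k K (x * koszulProj k K y) = koszulProj k K (x * y) := by
  rw [eq_comm, ← sub_eq_zero, ← map_sub, ← mul_sub]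
  exact koszulProj_eq_zero k K (mul_squareIdeal_mem k K (sub_koszulProj_mem k K y) x)

lemma koszulDGA_mul (a b : reducedKoszul k K) :
    (koszulDGA k K).mul a b = koszulProj k K (a * b : Koszul k K) := rfl

lemma koszulDGA_d_coe (a : reducedKoszul k K) :
    ((koszulDGA k K).d a : Koszul k K) = koszulD k K a := rfl

lemma koszulDGA_d_koszulProj (x : Koszul k K) :
    (koszulDGA k K).d (koszulProj k K x) = koszulProj k K (koszulD k K x) := by
  rw [← koszulProj_coe k K ((koszulDGA k K).d _), koszulDGA_d_coe, eq_comm, ← sub_eq_zero, ← map_sub,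
    ← map_sub]
  exact koszulProj_eq_zero k K (koszulD_squareIdeal k K (sub_koszulProj_mem k K x))

/-- Induction on the number of generators: `dd(u_j x) = v_j dx - (v_j dx - u_j ddx)`. -/
lemma koszulD_koszulD (x : Koszul k K) : koszulD k K (koszulD k K x) = 0 := by
  have key : ∀ l : List (Fin m), koszulD k K (koszulD k K (1 ⊗ₜ (l.map (u k)).prod)) = 0 := by
    intro l
    induction l with
    | nil => rw [List.map_nil, List.prod_nil, koszulD_v, map_zero]
    | cons j l ih =>
      have h : (1 : FaceRing k K) ⊗ₜ[k] ((j :: l).map (u k)).prod =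
          (1 ⊗ₜ u k j) * (1 ⊗ₜ (l.map (u k)).prod) := by
        rw [Algebra.TensorProduct.tmul_mul_tmul, mul_one, List.map_cons, List.prod_cons]
      rw [h, koszulD_u_mul, map_sub, koszulD_v_mul, koszulD_u_mul, ih]; simp
  induction x using koszul_induction with
  | zero => simp
  | add x y hx hy => rw [map_add, map_add, hx, hy, add_zero]
  | tmul a J =>
    have h : a ⊗ₜ[k] uMon k J = (a ⊗ₜ 1) * (1 ⊗ₜ uMon k J) := by
      rw [Algebra.TensorProduct.tmul_mul_tmul, mul_one, one_mul]
    rw [h, koszulD_v_mul, koszulD_v_mul, uMon, key, mul_zero]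

lemma cellularDGA_isInternal : DirectSum.IsInternal (cellularDGA k K).deg := by
  classical
  rw [DirectSum.isInternal_submodule_iff_iSupIndep_and_iSup_eq_top]
  constructor
  · intro n
    rw [Submodule.disjoint_def]
    intro a ha ha'
    -- The cochains that vanish on all `n`-cells; they contain every homogeneous part of degree
    -- other than `n`.
    let S : Submodule k (CellCochain k K) :=
      ⨅ c : {c : ZCell K // c.1.dim = n},
        LinearMap.ker (Module.Dual.eval k (CellChain k K) (Finsupp.single c.1 1))
    have hS : ⨆ j, ⨆ (_ : j ≠ n), (cellularDGA k K).deg j ≤ S := by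
      refine iSup₂_le fun j hj b hb => ?_
      rw [Submodule.mem_iInf]
      exact fun c => hb c.1 (by rw [c.2]; exact hj.symm)
    have h1 := hS ha'
    rw [Submodule.mem_iInf] at h1
    ext c
    simp only [LinearMap.coe_comp, Function.comp_apply, Finsupp.lsingle_apply, LinearMap.zero_apply]
    by_cases hc : c.1.dim = n
    · exact h1 ⟨c, hc⟩
    · exact ha c hc
  · rw [eq_top_iff]
    intro a _
    have : a = ∑ c, a (Finsupp.single c 1) • dualCell k K c := by
      ext c
      simp [dualCell_single]
    rw [this]
    refine Submodule.sum_mem _ fun c _ => Submodule.smul_mem _ _ ?_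
    refine Submodule.mem_iSup_of_mem c.1.dim fun c' hc' => ?_
    rw [dualCell_single, if_neg]
    rintro rfl
    exact hc' rfl

lemma isInternal_map {A B : Type*} [AddCommGroup A] [Module k A] [AddCommGroup B]
    [Module k B] (e : A ≃ₗ[k] B) {S : ℕ → Submodule k A} (h : DirectSum.IsInternal S) :
    DirectSum.IsInternal fun n => (S n).map e.toLinearMap := by
  rw [DirectSum.isInternal_submodule_iff_iSupIndep_and_iSup_eq_top] at h ⊢
  refine ⟨h.1.map_orderIso (Submodule.orderIsoMapComap e), ?_⟩
  rw [← Submodule.map_iSup, h.2, Submodule.map_top, LinearEquiv.range]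

lemma map_deg_toCochain (n : ℕ) :
    ((koszulDGA k K).deg n).map (toCochain k K).toLinearMap = (cellularDGA k K).deg n := by
  ext a
  constructor
  · rintro ⟨x, hx, rfl⟩ c hc
    exact (toCochain_apply k K x c).trans ((mem_koszulDGA_deg_iff k K x).1 hx c hc)
  · intro ha
    refine ⟨(toCochain k K).symm a, ?_, (toCochain k K).apply_symm_apply a⟩
    refine (mem_koszulDGA_deg_iff k K _).2 fun c hc => ?_
    rw [← toCochain_apply, LinearEquiv.apply_symm_apply]
    exact ha c hc

theorem koszulDGA_isDGA : (koszulDGA k K).IsDGA where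
  isInternal := by
    -- Pulled back from the cochains, where the grading is a partition of the dual basis. Only the
    -- linear structure enters, so there is no circularity.
    have := isInternal_map k (toCochain k K).symm (cellularDGA_isInternal k K)
    convert this using 2 with n
    rw [← map_deg_toCochain, ← Submodule.map_comp]
    simp
  one_mem := by
    have h : (1 : Koszul k K) = monomialVU k K ∅ ∅ := by
      simp [monomialVU, vMon, uMon, Algebra.TensorProduct.one_def]
    refine koszulProj_mem_deg k K ?_
    rw [h]
    exact monomialVU_mem_koszulDeg k K _ _ rfl
  mul_mem p q a ha b hb := koszulProj_mem_deg k K (mul_mem_koszulDeg k K ha hb)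
  one_mul a := by
    rw [koszulDGA_mul]
    change koszulProj k K (koszulProj k K 1 * a) = a
    rw [koszulProj_mul_left, one_mul, koszulProj_coe]
  mul_one a := by
    rw [koszulDGA_mul]
    change koszulProj k K (a * koszulProj k K 1) = a
    rw [koszulProj_mul_right, mul_one, koszulProj_coe]
  mul_assoc a b c := by
    simp only [koszulDGA_mul, koszulProj_mul_left, koszulProj_mul_right, mul_assoc]
  d_mem p a ha := by
    refine koszulDGA_deg_induction k K
      (P := fun a => (koszulDGA k K).d a ∈ (koszulDGA k K).deg (p + 1)) ?_ ?_ ?_ ?_ ha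
    · rw [map_zero]; exact Submodule.zero_mem _
    · intro x y hx hy; rw [map_add]; exact Submodule.add_mem _ hx hy
    · intro r x hx; rw [map_smul]; exact Submodule.smul_mem _ _ hx
    · exact koszulD_mem_koszulDeg k K
  d_d a := Subtype.ext (koszulD_koszulD k K a)
  leibniz p a ha b := by
    rw [koszulDGA_mul, koszulDGA_d_koszulProj, koszulDGA_mul, koszulDGA_mul, ← map_smul, ← map_add,
      koszulDGA_d_coe, koszulDGA_d_coe]
    congr 1
    refine koszulDGA_deg_induction k K (P := fun a => koszulD k K (a * b) =
      koszulD k K a * b + (-1 : k) ^ p • (a * koszulD k K b)) ?_ ?_ ?_ ?_ ha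
    · simp
    · intro x y hx hy
      simp only [Submodule.coe_add, add_mul, map_add, smul_add] at hx hy ⊢
      rw [hx, hy]
      abel
    · intro r x hx
      simp only [Submodule.coe_smul, smul_mul_assoc, map_smul] at hx ⊢
      rw [hx, smul_add, smul_comm]
    · intro c hc
      -- The `v_i` contribute the even number `2 #I` to the degree.
      have : (-1 : k) ^ p = (-1) ^ c.1.J.card := by
        rw [← hc, Cell.dim, pow_add, pow_mul]; simp
      rw [this]
      exact koszulD_monomialVU_mul k K _ _ _

/-- Spares the cellular side any geometric proof of `∂∂ = 0`, of associativity or of the Leibniz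
rule. -/
lemma PreDGA.IsDGA.of_isIso {k A B : Type*} [Field k] [AddCommGroup A] [Module k A]
    [AddCommGroup B] [Module k B] {X : PreDGA k A} {Y : PreDGA k B} (hX : X.IsDGA) {φ : A ≃ₗ[k] B}
    (h : X.IsIso Y φ) : Y.IsDGA := by
  have mem : ∀ n b, b ∈ Y.deg n → ∃ a ∈ X.deg n, φ a = b := by
    intro n b hb
    rw [← h.map_deg] at hb
    exact hb
  have mem' : ∀ n a, a ∈ X.deg n → φ a ∈ Y.deg n := by
    intro n a ha
    rw [← h.map_deg]
    exact ⟨a, ha, rfl⟩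
  refine ⟨?_, ?_, ?_, ?_, ?_, ?_, ?_, ?_, ?_⟩
  · have := isInternal_map k φ hX.isInternal
    rwa [funext h.map_deg] at this
  · rw [← h.map_one]; exact mem' _ _ hX.one_mem
  · intro p q a ha b hb
    obtain ⟨a, ha', rfl⟩ := mem p a ha
    obtain ⟨b, hb', rfl⟩ := mem q b hb
    rw [← h.map_mul]
    exact mem' _ _ (hX.mul_mem p q a ha' b hb')
  · intro a
    obtain ⟨a, rfl⟩ := φ.surjective a
    rw [← h.map_one, ← h.map_mul, hX.one_mul]
  · intro a
    obtain ⟨a, rfl⟩ := φ.surjective a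
    rw [← h.map_one, ← h.map_mul, hX.mul_one]
  · intro a b c
    obtain ⟨a, rfl⟩ := φ.surjective a
    obtain ⟨b, rfl⟩ := φ.surjective b
    obtain ⟨c, rfl⟩ := φ.surjective c
    simp only [← h.map_mul, hX.mul_assoc]
  · intro p a ha
    obtain ⟨a, ha', rfl⟩ := mem p a ha
    rw [← h.map_d]
    exact mem' _ _ (hX.d_mem p a ha')
  · intro a
    obtain ⟨a, rfl⟩ := φ.surjective a
    rw [← h.map_d, ← h.map_d, hX.d_d, map_zero]
  · intro p a ha b
    obtain ⟨a, ha', rfl⟩ := mem p a ha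
    obtain ⟨b, rfl⟩ := φ.surjective b
    rw [← h.map_mul, ← h.map_d, ← h.map_d, ← h.map_d, ← h.map_mul, ← h.map_mul, hX.leibniz p a ha' b,
      map_add, map_smul]

end Algebra

/-! ### The structure constants of `C^*(K)`. -/

section Coefficients

variable (k : Type*) [Field k] {m : ℕ} (K : AbstractSimplicialComplex (Fin m))

/-- `D_I T_J` is the disjoint union of `D_{I'} T_{J'}` and `D_{I''} T_{J''}`. -/
structure Cell.Splits (c c' c'' : Cell m) : Prop where
  I_eq : c.I = c'.I ∪ c''.I
  I_disj : Disjoint c'.I c''.I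
  J_eq : c.J = c'.J ∪ c''.J
  J_disj : Disjoint c'.J c''.J

/-- `D_{I'} T_{J'}` arises from `D_I T_J` by replacing the factor `D` in the `i`-th coordinate
with `T`. -/
structure Cell.IsFace (c c' : Cell m) (i : Fin m) : Prop where
  mem : i ∈ c.I
  I_eq : c'.I = c.I.erase i
  J_eq : c'.J = insert i c.J

lemma cellCoeff_mul_of_splits {c c' c'' : ZCell K} (h : c.1.Splits c'.1 c''.1) :
    cellCoeff k K c (cellMonomial k K c' * cellMonomial k K c'' : Koszul k K) =
      (unshuffleSign c'.1.J c''.1.J (List.finRange m) : k) := by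
  have hv : vMon k K c'.1.I * vMon k K c''.1.I = vMon k K c.1.I := by
    rw [vMon, vMon, vMon, h.I_eq, Finset.prod_union h.I_disj]
  simp only [cellCoeff, cellMonomial, monomialVU]
  rw [Algebra.TensorProduct.tmul_mul_tmul, hv, uMon_mul_uMon k h.J_disj, monoCoeff_tmul, faceCoeff_vMon,
    if_pos rfl, one_mul, map_zsmul, extCoeff_uMon, if_pos h.J_eq.symm]
  simp

/-- If `I'` and `I''` meet, the product contains a square `v_i²`; if `J'` and `J''` meet, the
exterior factor is zero. Otherwise it is `± v_{I' ∪ I''} u_{J' ∪ J''}` with an index different from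
that of `c`. -/
lemma cellCoeff_mul_of_not_splits {c c' c'' : ZCell K} (h : ¬ c.1.Splits c'.1 c''.1) :
    cellCoeff k K c (cellMonomial k K c' * cellMonomial k K c'' : Koszul k K) = 0 := by
  simp only [cellCoeff, cellMonomial, monomialVU]
  rw [Algebra.TensorProduct.tmul_mul_tmul, monoCoeff_tmul]
  by_cases hI : Disjoint c'.1.I c''.1.I
  · have hv : vMon k K c'.1.I * vMon k K c''.1.I = vMon k K (c'.1.I ∪ c''.1.I) := by
      rw [vMon, vMon, vMon, Finset.prod_union hI]
    rw [hv, faceCoeff_vMon]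
    by_cases hJ : Disjoint c'.1.J c''.1.J
    · rw [uMon_mul_uMon k hJ, map_zsmul, extCoeff_uMon]
      split_ifs with h1 h2
      · exact absurd ⟨h1.symm, hI, h2.symm, hJ⟩ h
      all_goals simp
    · rw [uMon_mul_of_not_disjoint k hJ, map_zero, mul_zero]
  · obtain ⟨i, h1, h2⟩ := Finset.not_disjoint_iff.1 hI
    have hv : vMon k K c'.1.I * vMon k K c''.1.I =
        vMon k K (c'.1.I.erase i) * vMon k K (c''.1.I.erase i) * v k K i ^ 2 := by
      simp only [vMon]
      rw [← Finset.mul_prod_erase _ _ h1, ← Finset.mul_prod_erase _ _ h2]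
      ring
    rw [hv, faceCoeff_mul_v_sq, zero_mul]

lemma cellCoeff_koszulD (c c' : ZCell K) :
    cellCoeff k K c (koszulD k K (cellMonomial k K c')) =
      ∑ i ∈ c'.1.J, (-1 : k) ^ (c'.1.J.filter (· < i)).card •
        if insert i c'.1.I = c.1.I ∧ c'.1.J.erase i = c.1.J then (1 : k) else 0 := by
  rw [cellMonomial, koszulD_monomialVU, map_sum]
  refine Finset.sum_congr rfl fun i hi => ?_
  have hI : i ∉ c'.1.I := fun h => Finset.disjoint_left.1 c'.1.disj h hi
  have : v k K i * vMon k K c'.1.I = vMon k K (insert i c'.1.I) := by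
    rw [vMon, vMon, Finset.prod_insert hI]
  rw [map_smul, this]
  congr 1
  exact monoCoeff_monomialVU k K c.isSimplex _ _

lemma Cell.isFace_iff {c c' : Cell m} {i : Fin m} :
    c.IsFace c' i ↔ i ∈ c'.J ∧ insert i c'.I = c.I ∧ c'.J.erase i = c.J := by
  constructor
  · rintro ⟨h, h1, h2⟩
    refine ⟨by simp [h2], by rw [h1, Finset.insert_erase h], ?_⟩
    rw [h2, Finset.erase_insert]
    exact Finset.disjoint_left.1 c.disj h
  · rintro ⟨h, h1, h2⟩
    refine ⟨by simp [← h1], ?_, by rw [← h2, Finset.insert_erase h]⟩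
    rw [← h1, Finset.erase_insert]
    exact fun h' => Finset.disjoint_left.1 c'.disj h' h

lemma Cell.IsFace.unique {c c' : Cell m} {i j : Fin m} (hi : c.IsFace c' i) (hj : c.IsFace c' j) :
    i = j := by
  by_contra hne
  have h1 : j ∈ c'.I := by rw [hi.I_eq]; exact Finset.mem_erase.2 ⟨Ne.symm hne, hj.mem⟩
  rw [hj.I_eq] at h1
  simp at h1

lemma Cell.IsFace.dim_eq {c c' : Cell m} {i : Fin m} (h : c.IsFace c' i) :
    c.dim = c'.dim + 1 := by
  have h1 : i ∉ c.J := Finset.disjoint_left.1 c.disj h.mem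
  rw [Cell.dim, Cell.dim, h.I_eq, h.J_eq, Finset.card_insert_of_notMem h1,
    Finset.card_erase_of_mem h.mem]
  have := Finset.card_pos.2 ⟨i, h.mem⟩
  omega

lemma cellCoeff_koszulD_of_isFace {c c' : ZCell K} {i : Fin m} (h : c.1.IsFace c'.1 i) :
    cellCoeff k K c (koszulD k K (cellMonomial k K c')) = (-1) ^ (c.1.J.filter (· < i)).card := by
  rw [cellCoeff_koszulD, Finset.sum_eq_single i]
  -- `J'` exceeds `J` only by `i`, which is not below itself, so both count the same predecessors.
  · rw [if_pos (Cell.isFace_iff.1 h).2, h.J_eq, Finset.filter_insert, if_neg (lt_irrefl _),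
      smul_eq_mul, mul_one]
  · intro j hj hne
    rw [if_neg, smul_zero]
    exact fun h' => hne (Cell.IsFace.unique (Cell.isFace_iff.2 ⟨hj, h'⟩) h)
  · exact fun h' => absurd (Cell.isFace_iff.1 h).1 h'

lemma cellCoeff_koszulD_of_not_isFace {c c' : ZCell K} (h : ∀ i, ¬ c.1.IsFace c'.1 i) :
    cellCoeff k K c (koszulD k K (cellMonomial k K c')) = 0 := by
  rw [cellCoeff_koszulD]
  refine Finset.sum_eq_zero fun i hi => ?_
  rw [if_neg, smul_zero]
  exact fun h' => h i (Cell.isFace_iff.2 ⟨hi, h'⟩)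

end Coefficients

/-! ### The distribution of the real coordinates of a cube among the factors of a cell. -/

section Slots

variable {m : ℕ}

/-- The number of real coordinates of the `i`-th factor of a cell. -/
def Cell.size (c : Cell m) (i : Fin m) : ℕ := if i ∈ c.I then 2 else if i ∈ c.J then 1 else 0

/-- The number of real coordinates of the first `l` factors of a cell. -/
def Cell.prefixDim (c : Cell m) (l : ℕ) : ℕ :=
  2 * (c.I.filter (·.val < l)).card + (c.J.filter (·.val < l)).card

/-- `prefixDim` continues the offsets to all natural numbers, in particular to `m`, where it is the
dimension; this makes induction on the number of factors possible. -/
lemma Cell.offset_eq (c : Cell m) (i : Fin m) : c.offset i = c.prefixDim i := rfl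

lemma card_filter_lt_succ (S : Finset (Fin m)) (i : Fin m) :
    (S.filter (·.val < (i : ℕ) + 1)).card = (S.filter (·.val < (i : ℕ))).card + if i ∈ S then 1 else 0 := by
  split_ifs with h
  · have : S.filter (·.val < (i : ℕ) + 1) = insert i (S.filter (·.val < (i : ℕ))) := by
      ext j
      simp only [Finset.mem_filter, Finset.mem_insert, Fin.ext_iff, Nat.lt_succ_iff_lt_or_eq]
      constructor
      · tauto
      · rintro (h1 | h1)
        · have : j = i := Fin.ext h1
          subst this; exact ⟨h, by simp⟩
        · exact ⟨h1.1, Or.inl h1.2⟩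
    rw [this, Finset.card_insert_of_notMem (by simp)]
  · rw [add_zero]
    congr 1
    refine Finset.filter_congr fun j hj => ?_
    have : j.val ≠ i.val := fun h' => h (Fin.ext h' ▸ hj)
    omega

lemma Cell.prefixDim_succ (c : Cell m) (i : Fin m) :
    c.prefixDim (i + 1) = c.prefixDim i + c.size i := by
  rw [prefixDim, prefixDim, card_filter_lt_succ, card_filter_lt_succ, size]
  have : i ∈ c.I → i ∉ c.J := fun h => Finset.disjoint_left.1 c.disj h
  split_ifs <;> first | omega | tauto

lemma Cell.prefixDim_mono (c : Cell m) : Monotone c.prefixDim := by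
  intro a b h
  have : ∀ S : Finset (Fin m), (S.filter (·.val < a)).card ≤ (S.filter (·.val < b)).card :=
    fun S => Finset.card_le_card (Finset.monotone_filter_right _ fun i _ hi => lt_of_lt_of_le hi h)
  have h1 := this c.I
  have h2 := this c.J
  simp only [prefixDim]
  omega

lemma Cell.prefixDim_top (c : Cell m) : c.prefixDim m = c.dim := by
  have : ∀ S : Finset (Fin m), S.filter (·.val < m) = S := fun S => by simp
  rw [prefixDim, this, this, dim]

lemma Cell.offset_add_size_le (c : Cell m) {i j : Fin m} (h : i < j) :
    c.offset i + c.size i ≤ c.offset j := by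
  rw [offset_eq, offset_eq, ← prefixDim_succ]
  exact c.prefixDim_mono h

lemma Cell.offset_add_size_le_dim (c : Cell m) (i : Fin m) : c.offset i + c.size i ≤ c.dim := by
  rw [offset_eq, ← prefixDim_succ, ← prefixDim_top]
  exact c.prefixDim_mono i.2

lemma Cell.size_of_mem_I {c : Cell m} {i : Fin m} (h : i ∈ c.I) : c.size i = 2 := if_pos h

lemma Cell.notMem_I {c : Cell m} {i : Fin m} (h : i ∈ c.J) : i ∉ c.I :=
  fun h' => Finset.disjoint_left.1 c.disj h' h

lemma Cell.size_of_mem_J {c : Cell m} {i : Fin m} (h : i ∈ c.J) : c.size i = 1 := by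
  rw [size, if_neg (notMem_I h), if_pos h]

/-- The slots of the `i`-th factor of a cell. -/
def Cell.slotsAt (c : Cell m) (p : Fin m → ℕ) (i : Fin m) : List ℕ :=
  if i ∈ c.I then [p i, p i + 1] else if i ∈ c.J then [p i] else []

/-- The slots of the factors, in the order of the coordinates, exhaust the cube without gaps. Both
`Cell.exists_slot` and the factorization `Cell.extTop_eq` rest on this. -/
lemma Cell.flatMap_slotsAt (c : Cell m) :
    (List.finRange m).flatMap (c.slotsAt c.offset) = List.range c.dim := by
  have key : ∀ l ≤ m, ((List.finRange m).take l).flatMap (c.slotsAt c.offset) =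
      List.range (c.prefixDim l) := by
    intro l
    induction l with
    | zero => intro _; simp [prefixDim]
    | succ l ih =>
      intro hl
      have h1 : (List.finRange m).take (l + 1) = (List.finRange m).take l ++ [⟨l, hl⟩] := by
        rw [List.take_succ_eq_append_getElem (by simpa using hl)]
        simp
      rw [h1, List.flatMap_append, ih (by omega), c.prefixDim_succ ⟨l, hl⟩, List.flatMap_singleton,
        slotsAt, size, offset_eq]
      split_ifs
      · simp [List.range_succ]
      · simp [List.range_succ]
      · simp
  have := key m le_rfl
  rwa [c.prefixDim_top, List.take_of_length_le (by simp)] at this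

lemma Cell.exists_slot (c : Cell m) {a : ℕ} (h : a < c.dim) :
    ∃ i, (i ∈ c.I ∧ (a = c.offset i ∨ a = c.offset i + 1)) ∨ (i ∈ c.J ∧ a = c.offset i) := by
  have : a ∈ (List.finRange m).flatMap (c.slotsAt c.offset) := by
    rw [c.flatMap_slotsAt]; simpa using h
  rw [List.mem_flatMap] at this
  obtain ⟨i, _, hi⟩ := this
  refine ⟨i, ?_⟩
  rw [slotsAt] at hi
  split_ifs at hi with h1 h2
  · left; exact ⟨h1, by simpa using hi⟩
  · right; exact ⟨h2, by simpa using hi⟩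
  · simp at hi

/-- `p` assigns to the factors of the cell `c` disjoint positions among the numbers below `n`. -/
structure Cell.IsLayout (c : Cell m) (p : Fin m → ℕ) (n : ℕ) : Prop where
  le : ∀ i, p i + c.size i ≤ n
  sep : ∀ i j, i ≠ j → p i + c.size i ≤ p j ∨ p j + c.size j ≤ p i

lemma Cell.isLayout_offset (c : Cell m) : c.IsLayout c.offset c.dim where
  le := c.offset_add_size_le_dim
  sep _ _ h := (lt_or_gt_of_ne h).imp c.offset_add_size_le c.offset_add_size_le

lemma Cell.IsLayout.mono {c : Cell m} {p : Fin m → ℕ} {n n' : ℕ} (h : c.IsLayout p n) (hn : n ≤ n') :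
    c.IsLayout p n' := ⟨fun i => (h.le i).trans hn, h.sep⟩

lemma Cell.IsLayout.lt_I {c : Cell m} {p : Fin m → ℕ} {n : ℕ} (h : c.IsLayout p n) {i : Fin m}
    (hi : i ∈ c.I) : p i + 1 < n := by
  have := h.le i
  rw [size_of_mem_I hi] at this
  omega

lemma Cell.IsLayout.lt_J {c : Cell m} {p : Fin m → ℕ} {n : ℕ} (h : c.IsLayout p n) {i : Fin m}
    (hi : i ∈ c.J) : p i < n := by
  have := h.le i
  rw [size_of_mem_J hi] at this
  omega

lemma slot_of_lt {n : ℕ} (x : Fin n → ℝ) {a : ℕ} (h : a < n) : slot x a = x ⟨a, h⟩ := dif_pos h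

@[simp] lemma slot_zero {n : ℕ} (a : ℕ) : slot (0 : Fin n → ℝ) a = 0 := by
  unfold slot; split_ifs <;> rfl

/-- The linear form `x ↦ slot x a`. -/
noncomputable def slotL (n a : ℕ) : (Fin n → ℝ) →L[ℝ] ℝ :=
  if h : a < n then ContinuousLinearMap.proj ⟨a, h⟩ else 0

@[simp] lemma slotL_apply {n : ℕ} (a : ℕ) (x : Fin n → ℝ) : slotL n a x = slot x a := by
  unfold slot slotL; split_ifs <;> rfl

lemma hasFDerivAt_slot {n : ℕ} (a : ℕ) (x : Fin n → ℝ) :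
    HasFDerivAt (fun x : Fin n → ℝ => slot x a) (slotL n a) x := by
  have h : (fun x : Fin n → ℝ => slot x a) = slotL n a := funext fun x => (slotL_apply a x).symm
  rw [h]
  exact (slotL n a).hasFDerivAt

lemma abs_slot_lt {n : ℕ} {x : Fin n → ℝ} (h : ∀ a, |x a| < 1) (a : ℕ) : |slot x a| < 1 := by
  unfold slot; split_ifs <;> simp [h]

/-- The product of characteristic maps of the factors of a cell, with the factor `i` at position
`p i`. -/
noncomputable def Cell.charMapAt (c : Cell m) (p : Fin m → ℕ) {n : ℕ} (x : Fin n → ℝ) : Fin m → ℂ :=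
  fun i =>
    if i ∈ c.I then squareToDisc (slot x (p i)) (slot x (p i + 1))
    else if i ∈ c.J then segToCircle (slot x (p i))
    else 1

lemma Cell.charMap_eq (c : Cell m) {n : ℕ} (x : Fin n → ℝ) : c.charMap x = c.charMapAt c.offset x :=
  rfl

/-- Puts the two factors on one cube, the second with positions shifted by `dim c`, so that the
lemmas on `charMapAt` apply to product cells. -/
lemma prodCharMap_eq (c c' : Cell m) (x : Fin (c.dim + c'.dim) → ℝ) :
    prodCharMap c c' x =
      (c.charMapAt c.offset x, c'.charMapAt (fun i => c.dim + c'.offset i) x) := by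
  -- The bound matters: past the end of the shorter vector `slot` has the default value `0`.
  have h1 : ∀ a < c.dim, slot (fun b => x (Fin.castAdd c'.dim b)) a = slot x a := by
    intro a ha
    rw [slot_of_lt _ ha, slot_of_lt x (by omega : a < c.dim + c'.dim)]; rfl
  have h2 : ∀ a < c'.dim, slot (fun b => x (Fin.natAdd c.dim b)) a = slot x (c.dim + a) := by
    intro a ha
    rw [slot_of_lt _ ha, slot_of_lt x (by omega : c.dim + a < c.dim + c'.dim)]; rfl
  refine Prod.ext (funext fun i => ?_) (funext fun i => ?_)
  · simp only [prodCharMap, Cell.charMap_eq, Cell.charMapAt]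
    split_ifs with hI hJ
    · have := c.isLayout_offset.lt_I hI
      rw [h1 _ (by omega), h1 _ this]
    · rw [h1 _ (c.isLayout_offset.lt_J hJ)]
    · rfl
  · simp only [prodCharMap, Cell.charMap_eq, Cell.charMapAt]
    split_ifs with hI hJ
    · have := c'.isLayout_offset.lt_I hI
      rw [h2 _ (by omega), h2 _ this, add_assoc]
    · rw [h2 _ (c'.isLayout_offset.lt_J hJ)]
    · rfl

end Slots

/-! ### Values and derivatives of the characteristic maps and of `wrap` in one coordinate. -/

section Plane

/-- The real-linear map `(s, t) ↦ s α + t β`. -/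
noncomputable def planeMap (α β : ℂ) : ℝ × ℝ →L[ℝ] ℂ :=
  (ContinuousLinearMap.fst ℝ ℝ ℝ).smulRight α + (ContinuousLinearMap.snd ℝ ℝ ℝ).smulRight β

@[simp] lemma planeMap_apply (α β : ℂ) (q : ℝ × ℝ) : planeMap α β q = q.1 * α + q.2 * β := by
  simp [planeMap]

lemma squareToDisc_eq (s t : ℝ) :
    squareToDisc s t = (s * √(1 - t ^ 2 / 2)) • (1 : ℂ) + (t * √(1 - s ^ 2 / 2)) • Complex.I := by
  apply Complex.ext <;> simp [squareToDisc]

lemma normSq_squareToDisc {s t : ℝ} (hs : |s| ≤ 1) (ht : |t| ≤ 1) :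
    ‖squareToDisc s t‖ ^ 2 = 1 - (1 - s ^ 2) * (1 - t ^ 2) := by
  have hs' : s ^ 2 ≤ 1 := (sq_le_one_iff_abs_le_one s).2 hs
  have ht' : t ^ 2 ≤ 1 := (sq_le_one_iff_abs_le_one t).2 ht
  rw [← Complex.normSq_eq_norm_sq, Complex.normSq_apply, squareToDisc]
  have h1 := Real.mul_self_sqrt (by linarith : (0 : ℝ) ≤ 1 - t ^ 2 / 2)
  have h2 := Real.mul_self_sqrt (by linarith : (0 : ℝ) ≤ 1 - s ^ 2 / 2)
  simp only
  linear_combination s ^ 2 * h1 + t ^ 2 * h2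

lemma norm_squareToDisc_lt {s t : ℝ} (hs : |s| < 1) (ht : |t| < 1) : ‖squareToDisc s t‖ < 1 := by
  have hs' : s ^ 2 < 1 := (sq_lt_one_iff_abs_lt_one s).2 hs
  have ht' : t ^ 2 < 1 := (sq_lt_one_iff_abs_lt_one t).2 ht
  have := normSq_squareToDisc hs.le ht.le
  have : 0 < (1 - s ^ 2) * (1 - t ^ 2) := mul_pos (by linarith) (by linarith)
  rw [← sq_lt_one_iff₀ (norm_nonneg _)]
  linarith

lemma sqrt_one_sub_half_sq_pos {t : ℝ} (ht : |t| ≤ 1) : 0 < √(1 - t ^ 2 / 2) := by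
  have ht' : t ^ 2 ≤ 1 := (sq_le_one_iff_abs_le_one t).2 ht
  exact Real.sqrt_pos.2 (by linarith)

lemma squareToDisc_zero_left (t : ℝ) : squareToDisc 0 t = t * Complex.I := by
  simp [squareToDisc_eq]

/-- The only preimage of a point of the imaginary axis. -/
lemma eq_of_squareToDisc_eq {s t τ : ℝ} (ht : |t| ≤ 1) (h : squareToDisc s t = τ * Complex.I) :
    s = 0 ∧ t = τ := by
  have h1 := congrArg Complex.re h
  have h2 := congrArg Complex.im h
  simp only [squareToDisc, Complex.re_ofReal_mul, Complex.im_ofReal_mul, Complex.I_re,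
    Complex.I_im, mul_zero, mul_one] at h1 h2
  have h3 : s = 0 := (mul_eq_zero.1 h1).resolve_right (sqrt_one_sub_half_sq_pos ht).ne'
  subst h3
  simpa using h2

lemma norm_squareToDisc_eq_one {s t : ℝ} (hs : |s| ≤ 1) (ht : |t| ≤ 1) (h : s ^ 2 = 1 ∨ t ^ 2 = 1) :
    ‖squareToDisc s t‖ = 1 := by
  have := normSq_squareToDisc hs ht
  have h0 : (1 - s ^ 2) * (1 - t ^ 2) = 0 := by
    rcases h with h | h <;> rw [h] <;> ring
  rw [h0, sub_zero] at this
  exact (pow_eq_one_iff_of_nonneg (norm_nonneg _) two_ne_zero).1 this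

/-- Needed at the centre, `τ = 0`, and at the preimages of the zeros of `wrap`, `τ = ±1/2`. The
derivatives of the two square roots drop out: one is multiplied by `s = 0`, the other vanishes
there. -/
lemma hasFDerivAt_squareToDisc (τ : ℝ) (hτ : |τ| < 1) :
    HasFDerivAt (fun q : ℝ × ℝ => squareToDisc q.1 q.2) (planeMap √(1 - τ ^ 2 / 2) Complex.I)
      (0, τ) := by
  have h1 : HasFDerivAt (fun q : ℝ × ℝ => q.1) (ContinuousLinearMap.fst ℝ ℝ ℝ) ((0 : ℝ), τ) :=
    hasFDerivAt_fst
  have h2 : HasFDerivAt (fun q : ℝ × ℝ => q.2) (ContinuousLinearMap.snd ℝ ℝ ℝ) ((0 : ℝ), τ) :=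
    hasFDerivAt_snd
  have hτ' : τ ^ 2 < 1 := (sq_lt_one_iff_abs_lt_one τ).2 hτ
  have h3 := ((((h2.pow 2).mul_const 2⁻¹).const_sub 1).sqrt (by simp only; linarith))
  have h4 := ((((h1.pow 2).mul_const 2⁻¹).const_sub 1).sqrt (by norm_num))
  have h5 := ((h1.mul h3).smul_const (1 : ℂ)).add ((h2.mul h4).smul_const Complex.I)
  simp only [squareToDisc_eq, div_eq_mul_inv]
  refine h5.congr_fderiv ?_
  ext <;> simp

/-- At the midpoint of the left edge, which goes to `-1`, the image moves upwards, that is,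
clockwise and against the orientation of `T`. -/
lemma hasDerivAt_squareToDisc_edge :
    HasDerivAt (fun t : ℝ => squareToDisc (-1) t) (√(1 / 2) * Complex.I) 0 := by
  have h1 := hasDerivAt_id (0 : ℝ)
  have h3 := ((((h1.pow 2).div_const 2).const_sub 1).sqrt (by norm_num))
  have h5 := ((h3.const_mul (-1)).smul_const (1 : ℂ)).add
    ((h1.mul_const √(1 - (-1) ^ 2 / 2)).smul_const Complex.I)
  simp only [squareToDisc_eq]
  refine h5.congr_deriv ?_
  norm_num

lemma wrap_mul_I {τ : ℝ} (hτ : |τ| = 1 / 2) : wrap (τ * Complex.I) = 0 := by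
  have h : ((τ : ℂ)) ^ 2 = 1 / 4 := by
    rw [← Complex.ofReal_pow, ← sq_abs, hτ]; norm_num
  rw [wrap, norm_mul, Complex.norm_I, Complex.norm_real, Real.norm_eq_abs, hτ, mul_pow, h,
    Complex.I_sq]
  norm_num

/-- At `±i/2` the derivatives of the norm in `-|z|` and in `z²/|z|` cancel. What is left is
multiplication by `±2i`, which preserves orientation. -/
lemma hasFDerivAt_wrap {τ : ℝ} (hτ : |τ| = 1 / 2) :
    HasFDerivAt wrap ((4 * τ * Complex.I) • (1 : ℂ →L[ℝ] ℂ)) (τ * Complex.I) := by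
  have hn : ‖(τ * Complex.I : ℂ)‖ = 1 / 2 := by
    rw [norm_mul, Complex.norm_I, Complex.norm_real, Real.norm_eq_abs, hτ, mul_one]
  have hτ2 : τ ^ 2 = 1 / 4 := by rw [← sq_abs, hτ]; norm_num
  have h0 : HasFDerivAt (fun z : ℂ => ‖z‖) ((2 * τ) • Complex.imCLM) (τ * Complex.I) := by
    have h1 := (hasStrictFDerivAt_norm_sq (τ * Complex.I : ℂ)).hasFDerivAt.sqrt (by rw [hn]; norm_num)
    simp only [Real.sqrt_sq (norm_nonneg _)] at h1
    refine h1.congr_fderiv ?_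
    ext v
    rw [hn]
    simp [Complex.inner]
    ring
  have h1 := Complex.ofRealCLM.hasFDerivAt.comp _ h0
  have h1' := Complex.ofRealCLM.hasFDerivAt.comp _
    ((hasDerivAt_inv (by rw [hn]; norm_num : ‖(τ * Complex.I : ℂ)‖ ≠ 0)).comp_hasFDerivAt _ h0)
  have h2 := (hasFDerivAt_id (𝕜 := ℝ) (τ * Complex.I : ℂ)).pow 2
  have h3 := (h1.const_sub 1).add (h2.mul h1')
  have he : wrap = fun z => 1 - (‖z‖ : ℂ) + z ^ 2 * (((‖z‖ : ℝ)⁻¹ : ℝ) : ℂ) := by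
    funext z; rw [wrap, div_eq_mul_inv, Complex.ofReal_inv]
  rw [he]
  refine h3.congr_fderiv ?_
  ext v
  have hI := Complex.I_sq
  have hτ3 : (τ : ℂ) ^ 2 = 1 / 4 := by rw [← Complex.ofReal_pow, hτ2]; norm_num
  simp only [add_apply, neg_apply, Function.comp_apply, hn,
    ContinuousLinearMap.comp_apply, smul_apply, Complex.ofRealCLM_apply,
    Complex.imCLM_apply, ContinuousLinearMap.id_apply, one_apply_eq_self, smul_eq_mul, id,
    nsmul_eq_mul, mul_pow, hτ3, hI]
  push_cast
  ring

/-- The equation reads `z² = |z| (|z| - 1)`. Norms give `|z| = 1/2`, and then `z² = -1/4`. -/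
lemma eq_of_wrap_eq_zero {z : ℂ} (h : wrap z = 0) : z = Complex.I / 2 ∨ z = -(Complex.I / 2) := by
  have h0 : z ≠ 0 := by rintro rfl; simp [wrap] at h
  have hn : (‖z‖ : ℂ) ≠ 0 := by simpa using h0
  have hn' : 0 < ‖z‖ := norm_pos_iff.2 h0
  have h1 : z ^ 2 = ((‖z‖ * (‖z‖ - 1) : ℝ) : ℂ) := by
    rw [wrap] at h
    field_simp at h
    push_cast
    linear_combination h
  have h2 := congrArg norm h1
  rw [norm_pow, Complex.norm_real, Real.norm_eq_abs, abs_mul, abs_of_pos hn', pow_two] at h2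
  have h3 := mul_left_cancel₀ hn'.ne' h2
  have h4 : ‖z‖ = 1 / 2 := by
    rcases abs_cases (‖z‖ - 1) with h5 | h5 <;> linarith
  rw [h4] at h1
  have h5 : (z - Complex.I / 2) * (z + Complex.I / 2) = 0 := by
    have : (((1 / 2 * (1 / 2 - 1) : ℝ)) : ℂ) = -1 / 4 := by norm_num
    rw [this] at h1
    linear_combination h1 - Complex.I_sq / 4
  rcases mul_eq_zero.1 h5 with h6 | h6
  · left; linear_combination h6
  · right; linear_combination h6

/-- Real points go to `1` and the others stay in the open disc. So a factor `D` never covers the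
centre of a factor `T`. -/
lemma wrap_ne_neg_one {z : ℂ} (h : ‖z‖ < 1) : wrap z ≠ -1 := by
  intro hw
  by_cases hz : z.im = 0
  · rw [wrap_real hz] at hw; norm_num at hw
  · have := norm_wrap_lt h hz
    rw [hw] at this
    norm_num at this

lemma segToCircle_eq (s : ℝ) :
    segToCircle s = ⟨-Real.cos (Real.pi * s), -Real.sin (Real.pi * s)⟩ := by
  rw [segToCircle, Complex.exp_mul_I, ← Complex.ofReal_cos, ← Complex.ofReal_sin, mul_add, mul_one,
    Real.cos_add_pi, Real.sin_add_pi]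
  apply Complex.ext <;> simp [-Complex.ofReal_cos, -Complex.ofReal_sin]

lemma norm_segToCircle (s : ℝ) : ‖segToCircle s‖ = 1 := Complex.norm_exp_ofReal_mul_I _

lemma segToCircle_zero : segToCircle 0 = -1 := by
  rw [segToCircle_eq]; apply Complex.ext <;> simp

lemma segToCircle_one : segToCircle 1 = 1 := by
  rw [segToCircle_eq]; apply Complex.ext <;> simp

lemma segToCircle_neg_one : segToCircle (-1) = 1 := by
  rw [segToCircle_eq]; apply Complex.ext <;> simp

lemma segToCircle_ne_one {s : ℝ} (hs : |s| < 1) : segToCircle s ≠ 1 := by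
  intro h
  have hp := Real.pi_pos
  have h1 := abs_lt.1 hs
  rw [segToCircle_eq] at h
  have h2 : Real.sin (Real.pi * s) = 0 := by simpa using congrArg Complex.im h
  have h3 := congrArg Complex.re h
  rw [Real.sin_eq_zero_iff_of_lt_of_lt (by nlinarith) (by nlinarith)] at h2
  simp [h2] at h3
  norm_num at h3

lemma eq_zero_of_segToCircle_eq {s : ℝ} (hs : |s| < 1) (h : segToCircle s = -1) : s = 0 := by
  have hp := Real.pi_pos
  have h1 := abs_lt.1 hs
  rw [segToCircle_eq] at h
  have h2 : Real.sin (Real.pi * s) = 0 := by simpa using congrArg Complex.im h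
  rw [Real.sin_eq_zero_iff_of_lt_of_lt (by nlinarith) (by nlinarith)] at h2
  exact (mul_eq_zero.1 h2).resolve_left hp.ne'

/-- The circle is run through counterclockwise from `1`, hence the upper half first. -/
lemma segToCircle_im_nonneg_iff {s : ℝ} (hs : |s| < 1) : 0 ≤ (segToCircle s).im ↔ s ≤ 0 := by
  have hp := Real.pi_pos
  have h1 := abs_lt.1 hs
  rw [segToCircle_eq]
  simp only [Left.nonneg_neg_iff]
  constructor
  · intro h
    by_contra hn
    have := Real.sin_pos_of_pos_of_lt_pi (x := Real.pi * s) (by nlinarith) (by nlinarith)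
    linarith
  · intro h
    exact Real.sin_nonpos_of_nonpos_of_neg_pi_le (by nlinarith) (by nlinarith)

lemma segToCircle_sq {σ : ℝ} (hσ : |σ| = 1 / 2) : segToCircle σ ^ 2 = -1 := by
  have : σ = 1 / 2 ∨ σ = -(1 / 2) := eq_or_eq_neg_of_abs_eq hσ
  have h : Real.pi * (1 / 2) = Real.pi / 2 := by ring
  rw [segToCircle_eq]
  rcases this with rfl | rfl <;> rw [pow_two] <;> apply Complex.ext <;> simp <;>
    simp [← one_div, h]

lemma abs_eq_of_segToCircle_sq {s : ℝ} (hs : |s| < 1) (h : segToCircle s ^ 2 = -1) :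
    |s| = 1 / 2 := by
  have hp := Real.pi_pos
  have h1 := abs_lt.1 hs
  have h2 : Real.cos (Real.pi * s) = 0 := by
    have h3 : (segToCircle s - Complex.I) * (segToCircle s + Complex.I) = 0 := by
      linear_combination h - Complex.I_sq
    rw [segToCircle_eq] at h3
    rcases mul_eq_zero.1 h3 with h4 | h4 <;> simpa using congrArg Complex.re h4
  rw [← Real.cos_abs, abs_mul, abs_of_pos hp] at h2
  have h0 := abs_nonneg s
  have := Real.injOn_cos (x₁ := Real.pi * |s|) (x₂ := Real.pi / 2) ⟨by positivity, by nlinarith⟩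
    ⟨by positivity, by linarith⟩ (by rw [h2, Real.cos_pi_div_two])
  nlinarith

lemma hasDerivAt_segToCircle (s : ℝ) :
    HasDerivAt segToCircle (segToCircle s * (Real.pi * Complex.I)) s := by
  have h := ((((hasDerivAt_id s).add_const 1).const_mul Real.pi).ofReal_comp.mul_const Complex.I).cexp
  refine h.congr_deriv ?_
  simp [segToCircle]

lemma hasDerivAt_segToCircle_zero : HasDerivAt segToCircle (-(Real.pi * Complex.I)) 0 := by
  have := hasDerivAt_segToCircle 0
  rwa [segToCircle_zero, neg_one_mul] at this

/-- On the circle `wrap` is squaring. The velocity is twice that of `segToCircle` at `0`, a positive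
multiple. -/
lemma hasDerivAt_wrap_segToCircle {σ : ℝ} (hσ : |σ| = 1 / 2) :
    HasDerivAt (fun s => wrap (segToCircle s)) (-(2 * Real.pi * Complex.I)) σ := by
  have : (fun s => wrap (segToCircle s)) = fun s => segToCircle s ^ 2 :=
    funext fun s => wrap_circle (norm_segToCircle s)
  rw [this]
  refine ((hasDerivAt_segToCircle σ).pow 2).congr_deriv ?_
  have := segToCircle_sq hσ
  push_cast
  linear_combination (2 * Real.pi * Complex.I) * this

end Plane

/-! ### Degrees over cells with no preimage or one preimage of the centre. -/

section Degree

variable {n : ℕ} {E : Type*} [NormedAddCommGroup E] [NormedSpace ℝ E]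

lemma localDegree_eq_zero {f g : (Fin n → ℝ) → E} (h : ∀ x, (∀ a, |x a| < 1) → f x ≠ g 0) :
    localDegree f g = 0 := by
  rw [localDegree]
  refine (finsum_congr fun x => ?_).trans finsum_zero
  have : ¬ ((∀ a, |x a| < 1) ∧ f x = g 0) := fun hx => h x hx.1 hx.2
  simp [this]

lemma localDegree_eq_localSign {f g : (Fin n → ℝ) → E} {x₀ : Fin n → ℝ} (h₀ : ∀ a, |x₀ a| < 1)
    (hf : f x₀ = g 0) (h : ∀ x, (∀ a, |x a| < 1) → f x = g 0 → x = x₀) :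
    localDegree f g = localSign f x₀ g 0 := by
  rw [localDegree, finsum_eq_single _ x₀]
  · classical
    exact finsum_eq_if.trans (if_pos ⟨h₀, hf⟩)
  · intro x hx
    have : ¬ ((∀ a, |x a| < 1) ∧ f x = g 0) := fun h' => hx (h x h'.1 h'.2)
    simp [this]

/-- Injectivity of `g'` makes the map in the definition of `localSign` unique, so the chosen one is
`A`. -/
lemma localSign_eq {f g : (Fin n → ℝ) → E} {x y : Fin n → ℝ} {f' g' : (Fin n → ℝ) →L[ℝ] E}
    (hf : HasFDerivAt f f' x) (hg : HasFDerivAt g g' y) (hinj : Function.Injective g')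
    (A : (Fin n → ℝ) →ₗ[ℝ] (Fin n → ℝ)) (hA : ∀ v, f' v = g' (A v)) :
    localSign f x g y = (SignType.sign (LinearMap.det A) : ℤ) := by
  have h : ∃ A : (Fin n → ℝ) →L[ℝ] (Fin n → ℝ), fderiv ℝ f x = (fderiv ℝ g y).comp A :=
    ⟨LinearMap.toContinuousLinearMap A, by
      rw [hf.fderiv, hg.fderiv]; ext1 v; exact hA v⟩
  have h2 : (h.choose : (Fin n → ℝ) →ₗ[ℝ] (Fin n → ℝ)) = A := by
    refine LinearMap.ext fun v => hinj ?_
    have h3 := DFunLike.congr_fun h.choose_spec v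
    rw [ContinuousLinearMap.comp_apply] at h3
    rw [← hA, ← hg.fderiv, ← hf.fderiv]
    exact h3.symm
  rw [localSign, dif_pos h, h2]

end Degree

/-! ### Derivatives of characteristic maps at the centre, and recovery of a cell from its centre. -/

section CharDeriv

variable {m n : ℕ}

lemma hasFDerivAt_comp_slots {F : ℝ × ℝ → ℂ} {F' : ℝ × ℝ →L[ℝ] ℂ} {x : Fin n → ℝ} {a b : ℕ}
    (h : HasFDerivAt F F' (slot x a, slot x b)) :
    HasFDerivAt (fun x : Fin n → ℝ => F (slot x a, slot x b))
      (F'.comp ((slotL n a).prod (slotL n b))) x :=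
  h.comp x ((hasFDerivAt_slot a x).prodMk (hasFDerivAt_slot b x))

lemma hasFDerivAt_comp_slot {F : ℝ → ℂ} {F' : ℂ} {x : Fin n → ℝ} {a : ℕ}
    (h : HasDerivAt F F' (slot x a)) :
    HasFDerivAt (fun x : Fin n → ℝ => F (slot x a)) ((slotL n a).smulRight F') x := by
  refine (h.hasFDerivAt.comp x (hasFDerivAt_slot a x)).congr_fderiv ?_
  ext v; simp

/-- The derivative of `charMapAt` at the centre. -/
noncomputable def Cell.charDeriv (c : Cell m) (p : Fin m → ℕ) (n : ℕ) :
    (Fin n → ℝ) →L[ℝ] (Fin m → ℂ) :=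
  ContinuousLinearMap.pi fun i =>
    if i ∈ c.I then (planeMap 1 Complex.I).comp ((slotL n (p i)).prod (slotL n (p i + 1)))
    else if i ∈ c.J then (slotL n (p i)).smulRight (-(Real.pi * Complex.I))
    else 0

lemma Cell.charDeriv_apply_I {c : Cell m} {i : Fin m} (h : i ∈ c.I) (p : Fin m → ℕ)
    (v : Fin n → ℝ) :
    c.charDeriv p n v i = slot v (p i) + slot v (p i + 1) * Complex.I := by
  simp [charDeriv, h]

lemma Cell.charDeriv_apply_J {c : Cell m} {i : Fin m} (h : i ∈ c.J) (p : Fin m → ℕ)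
    (v : Fin n → ℝ) :
    c.charDeriv p n v i = slot v (p i) * (-(Real.pi * Complex.I)) := by
  simp [charDeriv, h, notMem_I h]

lemma Cell.charDeriv_apply_of_notMem {c : Cell m} {i : Fin m} (hI : i ∉ c.I) (hJ : i ∉ c.J)
    (p : Fin m → ℕ) (v : Fin n → ℝ) : c.charDeriv p n v i = 0 := by
  simp [charDeriv, hI, hJ]

lemma Cell.hasFDerivAt_charMapAt (c : Cell m) (p : Fin m → ℕ) :
    HasFDerivAt (c.charMapAt p) (c.charDeriv p n) 0 := by
  rw [hasFDerivAt_pi']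
  intro i
  by_cases hI : i ∈ c.I
  · simp only [charMapAt, hI, if_true]
    have h := hasFDerivAt_squareToDisc 0 (by simp)
    have h1 := hasFDerivAt_comp_slots (n := n) (x := 0) (a := p i) (b := p i + 1) (by simpa using h)
    refine h1.congr_fderiv ?_
    ext v; simp [charDeriv, hI]
  · by_cases hJ : i ∈ c.J
    · simp only [charMapAt, hI, hJ, if_true, if_false]
      have h1 := hasFDerivAt_comp_slot (n := n) (x := 0) (a := p i)
        (by simpa using hasDerivAt_segToCircle_zero)
      refine h1.congr_fderiv ?_
      ext v; simp [charDeriv, hI, hJ]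
    · simp only [charMapAt, hI, hJ, if_false]
      refine (hasFDerivAt_const _ _).congr_fderiv ?_
      ext v; simp [charDeriv, hI, hJ]

lemma Cell.slots_eq_zero_of_charDeriv_I {c : Cell m} {p : Fin m → ℕ} {v : Fin n → ℝ} {i : Fin m}
    (hi : i ∈ c.I) (h : c.charDeriv p n v = 0) : slot v (p i) = 0 ∧ slot v (p i + 1) = 0 := by
  have h1 := congrFun h i
  rw [charDeriv_apply_I hi] at h1
  exact ⟨by simpa using congrArg Complex.re h1, by simpa using congrArg Complex.im h1⟩

lemma Cell.slot_eq_zero_of_charDeriv_J {c : Cell m} {p : Fin m → ℕ} {v : Fin n → ℝ} {i : Fin m}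
    (hi : i ∈ c.J) (h : c.charDeriv p n v = 0) : slot v (p i) = 0 := by
  have h1 := congrFun h i
  rw [charDeriv_apply_J hi] at h1
  simpa [Real.pi_ne_zero] using h1

/-- All slots of `c` vanish if the derivative of the characteristic map does. -/
lemma Cell.slot_eq_zero_of_charDeriv {c : Cell m} {a : ℕ} {v : Fin n → ℝ}
    (h : c.charDeriv (fun i => a + c.offset i) n v = 0) {b : ℕ} (hb : b < c.dim) :
    slot v (a + b) = 0 := by
  obtain ⟨i, ⟨hi, rfl | rfl⟩ | ⟨hi, rfl⟩⟩ := c.exists_slot hb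
  · exact (slots_eq_zero_of_charDeriv_I hi h).1
  · exact (slots_eq_zero_of_charDeriv_I hi h).2
  · exact slot_eq_zero_of_charDeriv_J hi h

lemma Cell.charMapAt_zero (c : Cell m) (p : Fin m → ℕ) :
    c.charMapAt p (0 : Fin n → ℝ) = c.centre := by
  funext i
  simp [charMapAt, centre, squareToDisc_zero_left, segToCircle_zero]

lemma Cell.charMapAt_apply_I {c : Cell m} {i : Fin m} (h : i ∈ c.I) (p : Fin m → ℕ)
    (x : Fin n → ℝ) : c.charMapAt p x i = squareToDisc (slot x (p i)) (slot x (p i + 1)) :=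
  if_pos h

lemma Cell.charMapAt_apply_J {c : Cell m} {i : Fin m} (h : i ∈ c.J) (p : Fin m → ℕ)
    (x : Fin n → ℝ) : c.charMapAt p x i = segToCircle (slot x (p i)) := by
  rw [charMapAt, if_neg (notMem_I h), if_pos h]

lemma Cell.charMapAt_apply_of_notMem {c : Cell m} {i : Fin m} (hI : i ∉ c.I) (hJ : i ∉ c.J)
    (p : Fin m → ℕ) (x : Fin n → ℝ) : c.charMapAt p x i = 1 := by
  rw [charMapAt, if_neg hI, if_neg hJ]

lemma Cell.centre_of_mem_I {c : Cell m} {i : Fin m} (h : i ∈ c.I) : c.centre i = 0 := if_pos h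

lemma Cell.centre_of_mem_J {c : Cell m} {i : Fin m} (h : i ∈ c.J) : c.centre i = -1 := by
  rw [centre, if_neg (notMem_I h), if_pos h]

lemma Cell.centre_of_notMem {c : Cell m} {i : Fin m} (hI : i ∉ c.I) (hJ : i ∉ c.J) :
    c.centre i = 1 := by
  rw [centre, if_neg hI, if_neg hJ]

/-- This and the next three lemmas read a cell off its centre, whose values `0`, `-1`, `1`
distinguish `D`, `T` and the point. -/
lemma Cell.mem_I_of_norm_centre_lt {c : Cell m} {i : Fin m} (h : ‖c.centre i‖ < 1) : i ∈ c.I := by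
  by_contra hI
  by_cases hJ : i ∈ c.J
  · simp [centre_of_mem_J hJ] at h
  · simp [centre_of_notMem hI hJ] at h

lemma Cell.notMem_I_of_norm_centre {c : Cell m} {i : Fin m} (h : ‖c.centre i‖ = 1) : i ∉ c.I := by
  intro hI
  simp [centre_of_mem_I hI] at h

lemma Cell.mem_J_of_centre {c : Cell m} {i : Fin m} (h : ‖c.centre i‖ = 1) (h1 : c.centre i ≠ 1) :
    i ∈ c.J := by
  by_contra hJ
  exact h1 (centre_of_notMem (notMem_I_of_norm_centre h) hJ)

lemma Cell.notMem_of_centre_eq_one {c : Cell m} {i : Fin m} (h : c.centre i = 1) :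
    i ∉ c.I ∧ i ∉ c.J := by
  refine ⟨notMem_I_of_norm_centre (by simp [h]), fun hJ => ?_⟩
  rw [centre_of_mem_J hJ] at h
  norm_num at h

end CharDeriv

/-! ### Incidence numbers of cells. -/

section Incidence

variable {m : ℕ}

lemma slot_insertNth {n : ℕ} (a : Fin (n + 1)) (ε : ℝ) (x : Fin n → ℝ) (b : ℕ) :
    slot (a.insertNth ε x : Fin (n + 1) → ℝ) b =
      if b = a then ε else if b < a then slot x b else slot x (b - 1) := by
  by_cases hb : b < n + 1
  · rw [slot_of_lt _ hb]
    rcases lt_trichotomy b a with h | h | h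
    · rw [if_neg h.ne, if_pos h, slot_of_lt x (by omega)]
      have : (⟨b, hb⟩ : Fin (n + 1)) = a.succAbove ⟨b, by omega⟩ := by
        rw [Fin.succAbove_of_castSucc_lt _ _ (by simpa [Fin.lt_def] using h)]; rfl
      rw [this, Fin.insertNth_apply_succAbove]
    · rw [if_pos h]
      have : (⟨b, hb⟩ : Fin (n + 1)) = a := Fin.ext h
      rw [this, Fin.insertNth_apply_same]
    · rw [if_neg h.ne', if_neg (by omega), slot_of_lt x (by omega : b - 1 < n)]
      have : (⟨b, hb⟩ : Fin (n + 1)) = a.succAbove ⟨b - 1, by omega⟩ := by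
        rw [Fin.succAbove_of_le_castSucc _ _ (by simp [Fin.le_def]; omega)]
        apply Fin.ext; simp; omega
      rw [this, Fin.insertNth_apply_succAbove]
  · have := a.2
    rw [if_neg (by omega), if_neg (by omega), slot, slot, dif_neg hb, dif_neg (by omega)]

/-- Where the boundary of the cube of a cell meets the preimage of the centre of a cell of
dimension one less. -/
lemma Cell.face_preimage {c c' : Cell m} (hdim : c.dim = c'.dim + 1) {i : Fin m} (hi : i ∈ c.I)
    {N a : ℕ} (ha : a = c.offset i ∨ a = c.offset i + 1) {y : Fin N → ℝ} {ε : ℝ}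
    (hε : ε ^ 2 = 1) (hya : slot y a = ε) (hy : ∀ b, b ≠ a → |slot y b| < 1)
    (h : c.charMap y = c'.centre) :
    a = c.offset i ∧ ε = -1 ∧ c.IsFace c' i ∧ ∀ b < c.dim, b ≠ a → slot y b = 0 := by
  -- The fixed coordinate `a` belongs to the factor `i`, so the parameters of all other factors are
  -- interior.
  have hne : ∀ j, j ≠ i → (∀ b, c.offset j ≤ b → b < c.offset j + c.size j → b ≠ a) := by
    intro j hj b h1 h2
    have := c.isLayout_offset.sep j i hj
    rw [size_of_mem_I hi] at this
    omega
  have hI : ∀ j, j ≠ i → j ∈ c.I →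
      j ∈ c'.I ∧ slot y (c.offset j) = 0 ∧ slot y (c.offset j + 1) = 0 := by
    intro j hj hjI
    have hs := size_of_mem_I hjI
    have h1 := hy _ (hne j hj (c.offset j) (by omega) (by omega))
    have h2 := hy _ (hne j hj (c.offset j + 1) (by omega) (by omega))
    have h3 := congrFun h j
    rw [charMap_eq, charMapAt_apply_I hjI] at h3
    have h4 : j ∈ c'.I := mem_I_of_norm_centre_lt (h3 ▸ norm_squareToDisc_lt h1 h2)
    rw [centre_of_mem_I h4] at h3
    exact ⟨h4, eq_of_squareToDisc_eq (τ := 0) h2.le (by simpa using h3)⟩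
  have hJ : ∀ j ∈ c.J, j ∈ c'.J ∧ slot y (c.offset j) = 0 := by
    intro j hjJ
    have hj : j ≠ i := by rintro rfl; exact notMem_I hjJ hi
    have hs := size_of_mem_J hjJ
    have h1 := hy _ (hne j hj (c.offset j) (by omega) (by omega))
    have h3 := congrFun h j
    rw [charMap_eq, charMapAt_apply_J hjJ] at h3
    have h4 : j ∈ c'.J := mem_J_of_centre (h3 ▸ norm_segToCircle _) (h3 ▸ segToCircle_ne_one h1)
    rw [centre_of_mem_J h4] at h3
    exact ⟨h4, eq_zero_of_segToCircle_eq h1 h3⟩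
  have h0 : ∀ j, j ∉ c.I → j ∉ c.J → j ∉ c'.I ∧ j ∉ c'.J := by
    intro j h1 h2
    have h3 := congrFun h j
    rw [charMap_eq, charMapAt_apply_of_notMem h1 h2] at h3
    exact notMem_of_centre_eq_one h3.symm
  have hεabs : |ε| ≤ 1 := (sq_le_one_iff_abs_le_one ε).1 hε.le
  have hval := congrFun h i
  rw [charMap_eq, charMapAt_apply_I hi] at hval
  have hnorm : ‖c'.centre i‖ = 1 := by
    rw [← hval]
    rcases ha with rfl | rfl
    · rw [hya]
      exact norm_squareToDisc_eq_one hεabs (hy _ (by omega)).le (Or.inl hε)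
    · rw [hya]
      exact norm_squareToDisc_eq_one (hy _ (by omega)).le hεabs (Or.inr hε)
  have hi' : i ∉ c'.I := notMem_I_of_norm_centre hnorm
  have eI : c'.I = c.I.erase i := by
    ext j
    rw [Finset.mem_erase]
    constructor
    · intro hj
      refine ⟨by rintro rfl; exact hi' hj, ?_⟩
      by_contra hjI
      by_cases hjJ : j ∈ c.J
      · exact notMem_I (hJ j hjJ).1 hj
      · exact (h0 j hjI hjJ).1 hj
    · exact fun hj => (hI j hj.1 hj.2).1
  have eJ : ∀ j, j ≠ i → (j ∈ c'.J ↔ j ∈ c.J) := by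
    intro j hj
    refine ⟨fun hj' => ?_, fun hj' => (hJ j hj').1⟩
    by_contra hjJ
    by_cases hjI : j ∈ c.I
    · exact notMem_I hj' (hI j hj hjI).1
    · exact (h0 j hjI hjJ).2 hj'
  have hiJ : i ∉ c.J := fun h => notMem_I h hi
  -- If the `i`-th factor of `c'` were the point, the dimension would drop by two.
  have hiJ' : i ∈ c'.J := by
    by_contra hn
    have e : c'.J = c.J := by
      ext j
      by_cases hj : j = i
      · subst hj; simp [hn, hiJ]
      · exact eJ j hj
    rw [dim, dim, e, eI, Finset.card_erase_of_mem hi] at hdim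
    have := Finset.card_pos.2 ⟨i, hi⟩
    omega
  have hface : c.IsFace c' i := by
    refine ⟨hi, eI, ?_⟩
    ext j
    by_cases hj : j = i
    · subst hj; simp [hiJ']
    · rw [eJ j hj, Finset.mem_insert, or_iff_right hj]
  rw [centre_of_mem_J hiJ'] at hval
  have hre := congrArg Complex.re hval
  have him := congrArg Complex.im hval
  simp only [squareToDisc, Complex.neg_re, Complex.neg_im, Complex.one_re, Complex.one_im,
    neg_zero] at hre him
  -- On an edge `s = ε` the vanishing imaginary part forces `t = 0`, and then the real part is `ε =
  -- -1`. On an edge `t = ε` the imaginary part cannot vanish.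
  rcases ha with rfl | rfl
  · rw [hya] at hre him
    have ht := (mul_eq_zero.1 him).resolve_right (sqrt_one_sub_half_sq_pos hεabs).ne'
    rw [ht] at hre
    refine ⟨rfl, by simpa using hre, hface, fun b hb hba => ?_⟩
    obtain ⟨j, ⟨hj, hbj⟩ | ⟨hj, rfl⟩⟩ := c.exists_slot hb
    · by_cases hji : j = i
      · subst hji
        rcases hbj with rfl | rfl
        · exact absurd rfl hba
        · exact ht
      · rcases hbj with rfl | rfl
        · exact (hI j hji hj).2.1
        · exact (hI j hji hj).2.2
    · exact (hJ j hj).2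
  · rw [hya] at him
    have := (mul_eq_zero.1 him).resolve_right
      (sqrt_one_sub_half_sq_pos (hy _ (by omega)).le).ne'
    rw [this] at hε
    norm_num at hε

lemma Cell.IsFace.offset_of_le {c c' : Cell m} {i : Fin m} (h : c.IsFace c' i) {j : Fin m}
    (hj : j ≤ i) : c'.offset j = c.offset j := by
  rw [offset, offset, h.I_eq, h.J_eq, Finset.filter_insert, if_neg (not_lt.2 hj)]
  congr 3
  ext l
  simp only [Finset.mem_filter, Finset.mem_erase]
  constructor
  · tauto
  · rintro ⟨h1, h2⟩
    exact ⟨⟨(lt_of_lt_of_le h2 hj).ne, h1⟩, h2⟩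

lemma Cell.IsFace.offset_of_lt {c c' : Cell m} {i : Fin m} (h : c.IsFace c' i) {j : Fin m}
    (hj : i < j) : c'.offset j + 1 = c.offset j := by
  have hiJ : i ∉ c.J := fun h' => notMem_I h' h.mem
  rw [offset, offset, h.I_eq, h.J_eq, Finset.filter_insert, if_pos hj,
    Finset.card_insert_of_notMem (by simp [hiJ])]
  have h1 : (c.I.erase i).filter (· < j) = (c.I.filter (· < j)).erase i := by
    ext l; simp only [Finset.mem_filter, Finset.mem_erase]; tauto
  have h2 : i ∈ c.I.filter (· < j) := by simp [h.mem, hj]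
  rw [h1, Finset.card_erase_of_mem h2]
  have := Finset.card_pos.2 ⟨i, h2⟩
  omega

lemma slot_diagonal {n : ℕ} (w : Fin n → ℝ) (v : Fin n → ℝ) {b : ℕ} (hb : b < n) :
    slot (Matrix.toLin' (Matrix.diagonal w) v) b = w ⟨b, hb⟩ * slot v b := by
  rw [slot_of_lt _ hb, slot_of_lt _ hb, Matrix.toLin'_apply, Matrix.mulVec_diagonal]

/-- The restriction of the characteristic map of a cell to the face over which a boundary cell is
covered. -/
lemma Cell.IsFace.charMap_insertNth {c c' : Cell m} {i : Fin m} (h : c.IsFace c' i)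
    {a : Fin (c'.dim + 1)} (ha : (a : ℕ) = c.offset i) (x : Fin c'.dim → ℝ) (j : Fin m) :
    c.charMap (a.insertNth (-1 : ℝ) x : Fin (c'.dim + 1) → ℝ) j =
      if j = i then squareToDisc (-1) (slot x (c'.offset i)) else c'.charMap x j := by
  have hs := size_of_mem_I h.mem
  rw [charMap_eq, charMap_eq]
  by_cases hj : j = i
  · subst hj
    rw [if_pos rfl, charMapAt_apply_I h.mem, slot_insertNth, slot_insertNth, if_pos ha.symm,
      if_neg (by omega), if_neg (by omega), Nat.add_sub_cancel, h.offset_of_le le_rfl]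
  · rw [if_neg hj]
    have key : ∀ b < c.size j, slot (a.insertNth (-1 : ℝ) x : Fin (c'.dim + 1) → ℝ) (c.offset j + b) =
        slot x (c'.offset j + b) := by
      intro b hb
      rw [slot_insertNth]
      rcases lt_or_gt_of_ne hj with hlt | hlt
      · have := c.offset_add_size_le hlt
        rw [if_neg (by omega), if_pos (by omega), h.offset_of_le hlt.le]
      · have := c.offset_add_size_le hlt
        have h2 := h.offset_of_lt hlt
        rw [if_neg (by omega), if_neg (by omega)]
        congr 1
        omega
    by_cases hI : j ∈ c.I
    · have hI' : j ∈ c'.I := by rw [h.I_eq]; exact Finset.mem_erase.2 ⟨hj, hI⟩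
      have := size_of_mem_I hI
      rw [charMapAt_apply_I hI, charMapAt_apply_I hI', key 1 (by omega)]
      have := key 0 (by omega)
      simp only [add_zero] at this
      rw [this]
    · have hI' : j ∉ c'.I := by rw [h.I_eq]; simp [hI]
      by_cases hJ : j ∈ c.J
      · have hJ' : j ∈ c'.J := by rw [h.J_eq]; simp [hJ]
        have hs' := size_of_mem_J hJ
        have := key 0 (by omega)
        simp only [add_zero] at this
        rw [charMapAt_apply_J hJ, charMapAt_apply_J hJ', this]
      · have hJ' : j ∉ c'.J := by rw [h.J_eq]; simp [hJ, hj]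
        rw [charMapAt_apply_of_notMem hI hJ, charMapAt_apply_of_notMem hI' hJ']

lemma Cell.injective_charDeriv (c : Cell m) : Function.Injective (c.charDeriv c.offset c.dim) := by
  rw [injective_iff_map_eq_zero]
  intro v hv
  funext b
  have := slot_eq_zero_of_charDeriv (c := c) (a := 0) (v := v) (by simpa using hv) b.2
  rwa [zero_add, slot_of_lt _ b.2] at this

/-- To first order at the centre, the face map is the characteristic map of `c'` with the parameter
of the `i`-th factor rescaled by a negative number. -/
lemma Cell.IsFace.localSign_eq {c c' : Cell m} {i : Fin m} (h : c.IsFace c' i)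
    {a : Fin (c'.dim + 1)} (ha : (a : ℕ) = c.offset i) :
    localSign (fun x => c.charMap (a.insertNth (-1 : ℝ) x : Fin (c'.dim + 1) → ℝ)) 0
      (fun x : Fin c'.dim → ℝ => c'.charMap x) 0 = -1 := by
  have hiJ : i ∈ c'.J := by rw [h.J_eq]; simp
  have hq := c'.isLayout_offset.lt_J hiJ
  have hsi := size_of_mem_J hiJ
  have hf : HasFDerivAt (fun x : Fin c'.dim → ℝ =>
        c.charMap (a.insertNth (-1 : ℝ) x : Fin (c'.dim + 1) → ℝ))
      (ContinuousLinearMap.pi fun j => if j = i then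
          (slotL c'.dim (c'.offset i)).smulRight (√(1 / 2) * Complex.I)
        else (ContinuousLinearMap.proj j).comp (c'.charDeriv c'.offset c'.dim)) 0 := by
    rw [hasFDerivAt_pi']
    intro j
    simp only [h.charMap_insertNth ha]
    by_cases hj : j = i
    · simp only [if_pos hj]
      refine (hasFDerivAt_comp_slot (by simpa using hasDerivAt_squareToDisc_edge)).congr_fderiv ?_
      ext v; simp [hj]
    · simp only [if_neg hj]
      refine (hasFDerivAt_pi'.1 (c'.hasFDerivAt_charMapAt c'.offset) j).congr_fderiv ?_
      ext v; simp [hj]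
  -- The quotient of the velocity `√(1/2) i` of the edge and the velocity `-π i` of `T` at `-1`.
  let w : Fin c'.dim → ℝ := fun b => if b = ⟨c'.offset i, hq⟩ then -(√(1 / 2) / Real.pi) else 1
  have hg : HasFDerivAt (fun x : Fin c'.dim → ℝ => c'.charMap x) (c'.charDeriv c'.offset c'.dim) 0 :=
    c'.hasFDerivAt_charMapAt c'.offset
  rw [MomentAngle.localSign_eq hf hg c'.injective_charDeriv
    (Matrix.toLin' (Matrix.diagonal w))]
  · rw [LinearMap.det_toLin', Matrix.det_diagonal, Finset.prod_ite_eq' Finset.univ, if_pos (Finset.mem_univ _)]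
    have : 0 < √(1 / 2) / Real.pi := div_pos (Real.sqrt_pos.2 (by norm_num)) Real.pi_pos
    rw [sign_neg (by linarith)]
    rfl
  · intro v
    funext j
    rw [ContinuousLinearMap.pi_apply]
    by_cases hj : j = i
    · subst hj
      rw [if_pos rfl, charDeriv_apply_J hiJ, slot_diagonal _ _ hq]
      have hp : (Real.pi : ℂ) ≠ 0 := by simp [Real.pi_ne_zero]
      simp only [w, ContinuousLinearMap.smulRight_apply, slotL_apply, Complex.real_smul, if_true]
      push_cast
      field_simp
    · rw [if_neg hj]
      have hsep := c'.isLayout_offset.sep j i hj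
      have key : ∀ b < c'.size j, slot (Matrix.toLin' (Matrix.diagonal w) v) (c'.offset j + b) =
          slot v (c'.offset j + b) := by
        intro b hb
        have hlt : c'.offset j + b < c'.dim := by have := c'.isLayout_offset.le j; omega
        rw [slot_diagonal _ _ hlt]
        simp only [w]
        rw [if_neg, one_mul]
        rw [Fin.mk.injEq]
        omega
      rw [ContinuousLinearMap.comp_apply, ContinuousLinearMap.proj_apply]
      by_cases hI : j ∈ c'.I
      · have := size_of_mem_I hI
        rw [charDeriv_apply_I hI, charDeriv_apply_I hI, key 1 (by omega)]
        have := key 0 (by omega)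
        simp only [add_zero] at this
        rw [this]
      · by_cases hJ : j ∈ c'.J
        · have hs' := size_of_mem_J hJ
          have := key 0 (by omega)
          simp only [add_zero] at this
          rw [charDeriv_apply_J hJ, charDeriv_apply_J hJ, this]
        · rw [charDeriv_apply_of_notMem hI hJ, charDeriv_apply_of_notMem hI hJ]

/-- The faces of the cube given by the end points of a factor `T` are identified by the
characteristic map. -/
lemma Cell.charMap_insertNth_of_mem_J {c : Cell m} {i : Fin m} (h : i ∈ c.J) {n : ℕ}
    {a : Fin (n + 1)} (ha : (a : ℕ) = c.offset i) (x : Fin n → ℝ) :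
    c.charMap (a.insertNth (1 : ℝ) x : Fin (n + 1) → ℝ) =
      c.charMap (a.insertNth (-1 : ℝ) x : Fin (n + 1) → ℝ) := by
  funext j
  have hs := size_of_mem_J h
  rw [charMap_eq, charMap_eq]
  by_cases hj : j = i
  · subst hj
    rw [charMapAt_apply_J h, charMapAt_apply_J h, slot_insertNth, slot_insertNth, if_pos ha.symm,
      if_pos ha.symm, segToCircle_one, segToCircle_neg_one]
  · have hsep := c.isLayout_offset.sep j i hj
    have key : ∀ b < c.size j, slot (a.insertNth (1 : ℝ) x : Fin (n + 1) → ℝ) (c.offset j + b) =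
        slot (a.insertNth (-1 : ℝ) x : Fin (n + 1) → ℝ) (c.offset j + b) := by
      intro b hb
      simp only [slot_insertNth, if_neg (show ¬ c.offset j + b = a by omega)]
    by_cases hI : j ∈ c.I
    · have := size_of_mem_I hI
      rw [charMapAt_apply_I hI, charMapAt_apply_I hI, key 1 (by omega)]
      have := key 0 (by omega)
      simp only [add_zero] at this
      rw [this]
    · by_cases hJ : j ∈ c.J
      · have hs' := size_of_mem_J hJ
        have := key 0 (by omega)
        simp only [add_zero] at this
        rw [charMapAt_apply_J hJ, charMapAt_apply_J hJ, this]
      · rw [charMapAt_apply_of_notMem hI hJ, charMapAt_apply_of_notMem hI hJ]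

lemma Cell.face_preimage_insertNth {c c' : Cell m} (hdim : c.dim = c'.dim + 1) {i : Fin m}
    (hi : i ∈ c.I) {a : Fin (c'.dim + 1)} (ha : (a : ℕ) = c.offset i ∨ (a : ℕ) = c.offset i + 1)
    {ε : ℝ} (hε : ε ^ 2 = 1) {x : Fin c'.dim → ℝ} (hx : ∀ b, |x b| < 1)
    (h : c.charMap (a.insertNth ε x : Fin (c'.dim + 1) → ℝ) = c'.charMap (0 : Fin c'.dim → ℝ)) :
    (a : ℕ) = c.offset i ∧ ε = -1 ∧ c.IsFace c' i ∧ x = 0 := by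
  rw [c'.charMap_eq, charMapAt_zero] at h
  have h1 : slot (a.insertNth ε x : Fin (c'.dim + 1) → ℝ) a = ε := by
    rw [slot_insertNth, if_pos rfl]
  have h2 : ∀ b, b ≠ (a : ℕ) → |slot (a.insertNth ε x : Fin (c'.dim + 1) → ℝ) b| < 1 := by
    intro b hb
    rw [slot_insertNth, if_neg hb]
    split_ifs <;> exact abs_slot_lt hx _
  obtain ⟨h3, h4, h5, h6⟩ := face_preimage hdim hi ha hε h1 h2 h
  refine ⟨h3, h4, h5, ?_⟩
  funext b
  have hb := b.2
  by_cases hba : (b : ℕ) < a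
  · have := h6 b (by omega) hba.ne
    rwa [slot_insertNth, if_neg hba.ne, if_pos hba, slot_of_lt _ b.2] at this
  · have := h6 (b + 1) (by omega) (by omega)
    rwa [slot_insertNth, if_neg (by omega), if_neg (by omega), Nat.add_sub_cancel,
      slot_of_lt _ b.2] at this

/-- Every pair of opposite faces belongs to a factor `D`, and then misses the centre of `c'`, or to
a factor `T`, and then cancels. -/
lemma incidence_of_not_isFace {c c' : Cell m} (h : ∀ i, ¬ c.IsFace c' i) : incidence c c' = 0 := by
  rw [incidence]
  split_ifs with hdim
  · rw [boundaryDegree]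
    refine Finset.sum_eq_zero fun a _ => ?_
    obtain ⟨i, ⟨hi, ha⟩ | ⟨hi, ha⟩⟩ := c.exists_slot (a := a) (by have := a.2; omega)
    · rw [localDegree_eq_zero, localDegree_eq_zero, sub_zero, mul_zero]
      · exact fun x hx hfx =>
          h i (Cell.face_preimage_insertNth hdim hi ha (by norm_num) hx hfx).2.2.1
      · exact fun x hx hfx =>
          h i (Cell.face_preimage_insertNth hdim hi ha (by norm_num) hx hfx).2.2.1
    · simp only [Cell.charMap_insertNth_of_mem_J hi ha, sub_self, mul_zero]
  · rfl

lemma incidence_of_isFace {c c' : Cell m} {i : Fin m} (h : c.IsFace c' i) :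
    incidence c c' = (-1) ^ (c.J.filter (· < i)).card := by
  have hdim := h.dim_eq
  have hlt : c.offset i < c'.dim + 1 := by
    have := c.isLayout_offset.lt_I h.mem
    omega
  rw [incidence, if_pos hdim, boundaryDegree, Finset.sum_eq_single ⟨c.offset i, hlt⟩]
  · rw [localDegree_eq_zero, localDegree_eq_localSign (x₀ := 0), h.localSign_eq rfl]
    -- The local sign `-1` meets the sign of the lower face. The discs before `i` contribute an even
    -- number to the exponent.
    · simp only [Cell.offset, pow_add, pow_mul]
      simp
    · simp
    · funext j
      rw [h.charMap_insertNth rfl]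
      split_ifs with hj
      · have hiJ : i ∈ c'.J := by rw [h.J_eq]; simp
        subst hj
        rw [c'.charMap_eq, Cell.charMapAt_zero, Cell.centre_of_mem_J hiJ, slot_zero, squareToDisc_eq]
        simp
      · rfl
    · exact fun x hx hfx =>
        (Cell.face_preimage_insertNth hdim h.mem (Or.inl rfl) (by norm_num) hx hfx).2.2.2
    · intro x hx hfx
      have := (Cell.face_preimage_insertNth hdim h.mem (Or.inl rfl) (by norm_num) hx hfx).2.1
      norm_num at this
  · intro a _ hne
    obtain ⟨j, ⟨hj, ha⟩ | ⟨hj, ha⟩⟩ := c.exists_slot (a := a) (by have := a.2; omega)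
    · have key : ∀ ε : ℝ, ε ^ 2 = 1 → ∀ x : Fin c'.dim → ℝ, (∀ b, |x b| < 1) →
          c.charMap (a.insertNth ε x : Fin (c'.dim + 1) → ℝ) ≠ c'.charMap (0 : Fin c'.dim → ℝ) := by
        intro ε hε x hx hfx
        obtain ⟨h1, _, h2, _⟩ := Cell.face_preimage_insertNth hdim hj ha hε hx hfx
        obtain rfl := h.unique h2
        exact hne (Fin.ext h1)
      rw [localDegree_eq_zero (key 1 (by norm_num)), localDegree_eq_zero (key (-1) (by norm_num)),
        sub_zero, mul_zero]
    · simp only [Cell.charMap_insertNth_of_mem_J hj ha, sub_self, mul_zero]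
  · simp

end Incidence

/-! ### Determinants through the top exterior power, factored by the coordinates of a cell. -/

section TopForm

variable {n : ℕ}

/-- The `a`-th standard basis vector, or `0` if there is none. -/
def stdVec (n a : ℕ) : Fin n → ℝ := fun b => if (b : ℕ) = a then 1 else 0

lemma slot_stdVec {a b : ℕ} (hb : b < n) : slot (stdVec n a) b = if b = a then 1 else 0 := by
  rw [slot_of_lt _ hb, stdVec]

/-- The `a`-th generator of the exterior algebra. -/
noncomputable def extGen (n a : ℕ) : ExteriorAlgebra ℝ (Fin n → ℝ) :=
  ExteriorAlgebra.ι ℝ (stdVec n a)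

lemma extGen_mul_swap (a b : ℕ) : extGen n a * extGen n b = -(extGen n b * extGen n a) :=
  eq_neg_of_add_eq_zero_left (ExteriorAlgebra.ι_add_mul_swap (R := ℝ) _ _)

/-- Two anticommutations cancel. This is why discs contribute no signs. -/
lemma commute_extGen_pair (a b d : ℕ) : Commute (extGen n a * extGen n b) (extGen n d) := by
  rw [Commute, SemiconjBy, mul_assoc, extGen_mul_swap b d, mul_neg, ← mul_assoc,
    extGen_mul_swap a d, neg_mul, neg_neg, mul_assoc]

/-- The product of all generators of the exterior algebra. -/
noncomputable def extTop (n : ℕ) : ExteriorAlgebra ℝ (Fin n → ℝ) :=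
  ((List.range n).map (extGen n)).prod

lemma extTop_eq_ιMulti : extTop n = ExteriorAlgebra.ιMulti ℝ n (Pi.basisFun ℝ (Fin n)) := by
  rw [ExteriorAlgebra.ιMulti_apply, extTop, List.ofFn_eq_map, ← List.map_coe_finRange_eq_range,
    List.map_map]
  congr 2
  funext a
  simp only [Function.comp_apply, extGen, Pi.basisFun_apply]
  congr 1
  funext b
  rw [stdVec, Pi.single_apply]
  simp only [Fin.ext_iff]

lemma extCoeff_extTop : extCoeff ℝ Finset.univ (extTop n) = 1 := by
  have : extTop n = uMon ℝ Finset.univ := by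
    rw [extTop_eq_ιMulti, ExteriorAlgebra.ιMulti_apply, uMon_eq_prod, List.ofFn_eq_map]
    simp [u, Pi.basisFun_apply]
  rw [this, extCoeff_uMon, if_pos rfl]

/-- A linear map acts on the top exterior power by its determinant. -/
lemma det_eq_of_map_extTop (A : (Fin n → ℝ) →ₗ[ℝ] (Fin n → ℝ)) {r : ℝ}
    (h : ExteriorAlgebra.map A (extTop n) = r • extTop n) : LinearMap.det A = r := by
  have h1 := congrArg (extCoeff ℝ Finset.univ) h
  rw [map_smul, extCoeff_extTop, smul_eq_mul, mul_one, extTop_eq_ιMulti,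
    ExteriorAlgebra.map_apply_ιMulti] at h1
  -- The top coefficient of a product of `n` vectors is alternating, hence a multiple of the
  -- determinant; on the standard basis it is `1`.
  have h2 := AlternatingMap.eq_smul_basis_det (Pi.basisFun ℝ (Fin n))
    ((extCoeff ℝ Finset.univ).compAlternatingMap (ExteriorAlgebra.ιMulti ℝ n))
  have h3 := congrArg (fun f => f (A ∘ Pi.basisFun ℝ (Fin n))) h2
  simp only [LinearMap.compAlternatingMap_apply,
    ← extTop_eq_ιMulti, extCoeff_extTop, one_smul, Module.Basis.det_comp, Module.Basis.det_self,
    mul_one] at h3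
  rw [← h3]
  exact h1

lemma list_prod_map_flatMap {ι κ M : Type*} [Monoid M] (f : ι → List κ) (g : κ → M) (l : List ι) :
    ((l.flatMap f).map g).prod = (l.map fun i => ((f i).map g).prod).prod := by
  induction l with
  | nil => simp
  | cons i l ih => simp [ih]

lemma list_prod_map_smul {ι R : Type*} [Ring R] [Algebra ℝ R] (w : ι → ℝ) (z : ι → R) (l : List ι) :
    (l.map fun i => w i • z i).prod = (l.map w).prod • (l.map z).prod := by
  induction l with
  | nil => simp
  | cons i l ih => simp [ih, smul_smul, mul_comm]

variable {m : ℕ}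

/-- The product of the generators that belong to the `i`-th factor of a cell. -/
noncomputable def Cell.block (c : Cell m) (p : Fin m → ℕ) (n : ℕ) (i : Fin m) :
    ExteriorAlgebra ℝ (Fin n → ℝ) :=
  if i ∈ c.I then extGen n (p i) * extGen n (p i + 1) else if i ∈ c.J then extGen n (p i) else 1

lemma Cell.prod_map_slotsAt (c : Cell m) (p : Fin m → ℕ) (i : Fin m) :
    ((c.slotsAt p i).map (extGen n)).prod = c.block p n i := by
  unfold slotsAt block; split_ifs <;> simp

lemma Cell.extTop_eq (c : Cell m) (h : c.dim = n) :
    extTop n = ((List.finRange m).map (c.block c.offset n)).prod := by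
  rw [extTop, ← h, ← c.flatMap_slotsAt, list_prod_map_flatMap]
  simp only [prod_map_slotsAt]

lemma Cell.extTop_eq_mul (c c' : Cell m) :
    extTop (c.dim + c'.dim) =
      ((List.finRange m).map (c.block c.offset (c.dim + c'.dim))).prod *
      ((List.finRange m).map (c'.block (fun i => c.dim + c'.offset i) (c.dim + c'.dim))).prod := by
  have h : (c'.slotsAt fun i => c.dim + c'.offset i) =
      fun i => (c'.slotsAt c'.offset i).map (c.dim + ·) := by
    funext i; unfold slotsAt; split_ifs <;> simp [add_assoc]
  have h' : (List.range c'.dim).map (c.dim + ·) =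
      (List.finRange m).flatMap (c'.slotsAt fun i => c.dim + c'.offset i) := by
    rw [← c'.flatMap_slotsAt, List.map_flatMap, h]
  rw [extTop, List.range_add, List.map_append, List.prod_append, h', ← c.flatMap_slotsAt,
    list_prod_map_flatMap, list_prod_map_flatMap]
  simp only [prod_map_slotsAt]

/-- Blocks consist of two, one or no generators, so only two blocks of factors `T` anticommute. This
is the relation that `list_prod_map_mul` asks for. -/
lemma Cell.block_mul_block (c c' : Cell m) (p p' : Fin m → ℕ) (j i : Fin m) :
    c'.block p' n j * c.block p n i = exchangeSign c.J c'.J j i • (c.block p n i * c'.block p' n j) := by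
  have hc : ∀ a b, Commute (extGen n a * extGen n b) (c.block p n i) := by
    intro a b
    unfold block
    split_ifs
    · exact (commute_extGen_pair _ _ _).mul_right (commute_extGen_pair _ _ _)
    · exact commute_extGen_pair _ _ _
    · exact Commute.one_right _
  have hc' : ∀ a b, Commute (extGen n a * extGen n b) (c'.block p' n j) := by
    intro a b
    unfold block
    split_ifs
    · exact (commute_extGen_pair _ _ _).mul_right (commute_extGen_pair _ _ _)
    · exact commute_extGen_pair _ _ _
    · exact Commute.one_right _
  by_cases hj : j ∈ c'.I
  · have : j ∉ c'.J := fun h => notMem_I h hj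
    rw [exchangeSign, if_neg (by tauto), one_smul, block, if_pos hj, (hc _ _).eq]
  · by_cases hi : i ∈ c.I
    · have : i ∉ c.J := fun h => notMem_I h hi
      rw [exchangeSign, if_neg (by tauto), one_smul]
      conv_lhs => rw [block.eq_def c, if_pos hi]
      conv_rhs => rw [block.eq_def c, if_pos hi]
      rw [(hc' _ _).eq]
    · unfold block exchangeSign
      rw [if_neg hi, if_neg hj]
      by_cases hj' : j ∈ c'.J <;> by_cases hi' : i ∈ c.J <;> simp [hi', hj', extGen_mul_swap (p' j)]

end TopForm

/-! ### The linear algebra of a cell that splits into two. -/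

section SplitLayout

variable {m n : ℕ}

/-- Each coordinate has just one owner, since the positions are disjoint, so values can be
prescribed factor by factor. With `M` the linear forms this gives a linear map, with `M = ℝ` a point
of the cube. -/
lemma Cell.IsLayout.exists_of_surjective {M : Type*} {c : Cell m} {p : Fin m → ℕ}
    (h : c.IsLayout p n)
    (hs : ∀ b < n, ∃ i, (i ∈ c.I ∧ (b = p i ∨ b = p i + 1)) ∨ (i ∈ c.J ∧ b = p i))
    (α β : Fin m → M) :
    ∃ F : Fin n → M,
      (∀ i, ∀ hi : i ∈ c.I, F ⟨p i, (Nat.lt_succ_self _).trans (h.lt_I hi)⟩ = α i ∧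
        F ⟨p i + 1, h.lt_I hi⟩ = β i) ∧
      (∀ i, ∀ hi : i ∈ c.J, F ⟨p i, h.lt_J hi⟩ = α i) ∧ ∀ b, ∃ i, F b = α i ∨ F b = β i := by
  choose o ho using fun b : Fin n => hs b b.2
  have key : ∀ (b : Fin n) i, p i ≤ b → (b : ℕ) < p i + c.size i → o b = i := by
    intro b i h1 h2
    by_contra hne
    have := h.sep _ _ hne
    rcases ho b with ⟨h3, h4⟩ | ⟨h3, h4⟩
    · have := size_of_mem_I h3; omega
    · have := size_of_mem_J h3; omega
  refine ⟨fun b => if (b : ℕ) = p (o b) then α (o b) else β (o b), ?_, ?_, ?_⟩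
  · intro i hi
    have := size_of_mem_I hi
    have h1 := key ⟨p i, (Nat.lt_succ_self _).trans (h.lt_I hi)⟩ i le_rfl (by simp; omega)
    have h2 := key ⟨p i + 1, h.lt_I hi⟩ i (by simp) (by simp; omega)
    constructor
    · simp only [h1, if_true]
    · simp only [h2]
      rw [if_neg (by omega)]
  · intro i hi
    have := size_of_mem_J hi
    have h1 := key ⟨p i, h.lt_J hi⟩ i le_rfl (by simp; omega)
    simp only [h1, if_true]
  · intro b
    refine ⟨o b, ?_⟩
    by_cases h : (b : ℕ) = p (o b)
    · left; simp only; rw [if_pos h]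
    · right; simp only; rw [if_neg h]

/-- The position of the factors of a cell in a product cell. -/
def splitPos (c' c'' : Cell m) (i : Fin m) : ℕ :=
  if i ∈ c'.I ∨ i ∈ c'.J then c'.offset i else c'.dim + c''.offset i

variable {c c' c'' : Cell m}

lemma Cell.Splits.notMem_right (h : c.Splits c' c'') {i : Fin m} (hi : i ∈ c'.I ∨ i ∈ c'.J) :
    i ∉ c''.I ∧ i ∉ c''.J := by
  have h1 : i ∈ c'.I → i ∉ c''.I := fun h' => Finset.disjoint_left.1 h.I_disj h'
  have h2 : i ∈ c'.J → i ∉ c''.J := fun h' => Finset.disjoint_left.1 h.J_disj h'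
  have h3 : i ∈ c.I → i ∉ c.J := fun h' => Finset.disjoint_left.1 c.disj h'
  rw [h.I_eq, h.J_eq, Finset.mem_union, Finset.mem_union] at h3
  tauto

lemma splitPos_left {i : Fin m} (hi : i ∈ c'.I ∨ i ∈ c'.J) : splitPos c' c'' i = c'.offset i :=
  if_pos hi

lemma Cell.Splits.splitPos_right (h : c.Splits c' c'') {i : Fin m} (hi : i ∈ c''.I ∨ i ∈ c''.J) :
    splitPos c' c'' i = c'.dim + c''.offset i :=
  if_neg fun h' => by have := h.notMem_right h'; tauto

lemma Cell.Splits.size_left (h : c.Splits c' c'') {i : Fin m} (hi : i ∈ c'.I ∨ i ∈ c'.J) :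
    c.size i = c'.size i := by
  have := h.notMem_right hi
  simp [size, h.I_eq, h.J_eq, this]

lemma Cell.Splits.size_right (h : c.Splits c' c'') {i : Fin m} (hi : ¬ (i ∈ c'.I ∨ i ∈ c'.J)) :
    c.size i = c''.size i := by
  rw [not_or] at hi
  simp [size, h.I_eq, h.J_eq, hi]

lemma Cell.Splits.isLayout (h : c.Splits c' c'') :
    c.IsLayout (splitPos c' c'') (c'.dim + c''.dim) where
  le i := by
    by_cases hi : i ∈ c'.I ∨ i ∈ c'.J
    · have := c'.isLayout_offset.le i
      rw [splitPos_left hi, h.size_left hi]; omega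
    · have := c''.isLayout_offset.le i
      rw [splitPos, if_neg hi, h.size_right hi]; omega
  sep i j hij := by
    have h1 := c'.isLayout_offset.sep i j hij
    have h2 := c''.isLayout_offset.sep i j hij
    have h3 := c'.isLayout_offset.le i
    have h4 := c'.isLayout_offset.le j
    by_cases hi : i ∈ c'.I ∨ i ∈ c'.J <;> by_cases hj : j ∈ c'.I ∨ j ∈ c'.J
    · rw [splitPos_left hi, h.size_left hi, splitPos_left hj, h.size_left hj]; omega
    · rw [splitPos_left hi, h.size_left hi, splitPos, if_neg hj, h.size_right hj]; omega
    · rw [splitPos_left hj, h.size_left hj, splitPos, if_neg hi, h.size_right hi]; omega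
    · rw [splitPos, splitPos, if_neg hi, if_neg hj, h.size_right hi, h.size_right hj]; omega

lemma Cell.Splits.exists_splitPos (h : c.Splits c' c'') {b : ℕ} (hb : b < c'.dim + c''.dim) :
    ∃ i, (i ∈ c.I ∧ (b = splitPos c' c'' i ∨ b = splitPos c' c'' i + 1)) ∨
      (i ∈ c.J ∧ b = splitPos c' c'' i) := by
  rw [h.I_eq, h.J_eq]
  by_cases hb' : b < c'.dim
  · obtain ⟨i, ⟨hi, hb⟩ | ⟨hi, hb⟩⟩ := c'.exists_slot hb'
    · exact ⟨i, Or.inl ⟨Finset.mem_union_left _ hi, by rwa [splitPos_left (Or.inl hi)]⟩⟩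
    · exact ⟨i, Or.inr ⟨Finset.mem_union_left _ hi, by rwa [splitPos_left (Or.inr hi)]⟩⟩
  · obtain ⟨i, ⟨hi, hb⟩ | ⟨hi, hb⟩⟩ := c''.exists_slot (a := b - c'.dim) (by omega)
    · refine ⟨i, Or.inl ⟨Finset.mem_union_right _ hi, ?_⟩⟩
      rw [h.splitPos_right (Or.inl hi)]; omega
    · refine ⟨i, Or.inr ⟨Finset.mem_union_right _ hi, ?_⟩⟩
      rw [h.splitPos_right (Or.inr hi)]; omega

lemma Cell.Splits.dim_eq (h : c.Splits c' c'') : c.dim = c'.dim + c''.dim := by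
  rw [dim, dim, dim, h.I_eq, h.J_eq, Finset.card_union_of_disjoint h.I_disj,
    Finset.card_union_of_disjoint h.J_disj]
  ring

lemma Cell.Splits.block_eq (h : c.Splits c' c'') (i : Fin m) :
    c'.block c'.offset n i * c''.block (fun i => c'.dim + c''.offset i) n i =
      c.block (splitPos c' c'') n i := by
  by_cases hi : i ∈ c'.I ∨ i ∈ c'.J
  · have := h.notMem_right hi
    simp [block, h.I_eq, h.J_eq, splitPos, this, hi]
  · have hi' := not_or.1 hi
    simp [block, h.I_eq, h.J_eq, splitPos, hi']

/-- The left side lists the axes of the product cube in the order of the coordinates of `c`, the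
right side in their own order. In every coordinate at most one of the two cells has a nontrivial
block, so `list_prod_map_mul` gives the sign of the reordering. -/
lemma Cell.Splits.prod_block (h : c.Splits c' c'') :
    ((List.finRange m).map (c.block (splitPos c' c'') (c'.dim + c''.dim))).prod =
      unshuffleSign c'.J c''.J (List.finRange m) • extTop (c'.dim + c''.dim) := by
  rw [extTop_eq_mul, ← list_prod_map_mul _ _ _ _ (fun j i => block_mul_block c' c'' _ _ j i)]
  simp only [h.block_eq]

/-- The imaginary part of the point of the disc over which the `i`-th factor `D` of a cell meets the
centre of a product cell under the diagonal approximation. -/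
noncomputable def splitHeight (c' : Cell m) (i : Fin m) : ℝ := if i ∈ c'.I then 1 / 2 else -(1 / 2)

/-- The parameter of the point of the circle over which the `i`-th factor `T` of a cell meets the
centre of a product cell under the diagonal approximation. -/
noncomputable def splitParam (c' : Cell m) (i : Fin m) : ℝ := if i ∈ c'.J then -(1 / 2) else 1 / 2

lemma abs_splitHeight (c' : Cell m) (i : Fin m) : |splitHeight c' i| = 1 / 2 := by
  unfold splitHeight; split_ifs <;> norm_num [abs_of_pos, abs_of_neg]

lemma abs_splitParam (c' : Cell m) (i : Fin m) : |splitParam c' i| = 1 / 2 := by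
  unfold splitParam; split_ifs <;> norm_num [abs_of_pos, abs_of_neg]

/-- The derivative of the diagonal approximation at the preimage of the centre of a product cell,
in the coordinates of the cells. -/
lemma Cell.Splits.exists_linearMap (h : c.Splits c' c'') (r : ℝ) (hr : 0 < r) :
    ∃ A : (Fin (c'.dim + c''.dim) → ℝ) →ₗ[ℝ] (Fin (c'.dim + c''.dim) → ℝ),
      (∀ i ∈ c.I, ∀ v,
        slot (A v) (splitPos c' c'' i) = -(4 * splitHeight c' i) * slot v (c.offset i + 1) ∧
        slot (A v) (splitPos c' c'' i + 1) = 4 * splitHeight c' i * r * slot v (c.offset i)) ∧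
      (∀ i ∈ c.J, ∀ v, slot (A v) (splitPos c' c'' i) = 2 * slot v (c.offset i)) ∧
      (SignType.sign (LinearMap.det A) : ℤ) = unshuffleSign c'.J c''.J (List.finRange m) := by
  set N := c'.dim + c''.dim with hN
  set p := splitPos c' c'' with hp
  have hL : c.IsLayout p N := h.isLayout
  have hO : c.IsLayout c.offset N := c.isLayout_offset.mono h.dim_eq.le
  -- The rows of `A`. On a disc they are the real and imaginary part of `4τ i (r s + i t)`, on a
  -- circle the factor `2`. The first family serves the first slot of a disc as well as the slot of
  -- a circle.
  obtain ⟨F, hFI, hFJ, -⟩ := hL.exists_of_surjective (fun b hb => h.exists_splitPos hb)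
    (M := (Fin N → ℝ) →ₗ[ℝ] ℝ)
    (fun i => if i ∈ c.I then -(4 * splitHeight c' i) • (slotL N (c.offset i + 1)).toLinearMap
      else (2 : ℝ) • (slotL N (c.offset i)).toLinearMap)
    (fun i => (4 * splitHeight c' i * r) • (slotL N (c.offset i)).toLinearMap)
  have hAI : ∀ i ∈ c.I, ∀ v, slot (LinearMap.pi F v) (p i) =
        -(4 * splitHeight c' i) * slot v (c.offset i + 1) ∧
      slot (LinearMap.pi F v) (p i + 1) = 4 * splitHeight c' i * r * slot v (c.offset i) := by
    intro i hi v
    have h1 := hL.lt_I hi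
    rw [slot_of_lt _ h1, slot_of_lt _ ((Nat.lt_succ_self _).trans h1), LinearMap.pi_apply,
      LinearMap.pi_apply, (hFI i hi).1, (hFI i hi).2]
    simp [hi]
  have hAJ : ∀ i ∈ c.J, ∀ v, slot (LinearMap.pi F v) (p i) = 2 * slot v (c.offset i) := by
    intro i hi v
    rw [slot_of_lt _ (hL.lt_J hi), LinearMap.pi_apply, hFJ i hi]
    simp [notMem_I hi]
  refine ⟨LinearMap.pi F, hAI, hAJ, ?_⟩
  set A := LinearMap.pi F
  have hext : ∀ v w : Fin N → ℝ, (∀ i ∈ c.I, slot v (p i) = slot w (p i) ∧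
      slot v (p i + 1) = slot w (p i + 1)) → (∀ i ∈ c.J, slot v (p i) = slot w (p i)) → v = w := by
    intro v w hI hJ
    funext b
    rw [← slot_of_lt v b.2, ← slot_of_lt w b.2]
    obtain ⟨i, ⟨hi, hb | hb⟩ | ⟨hi, hb⟩⟩ := h.exists_splitPos b.2
    · rw [hb]; exact (hI i hi).1
    · rw [hb]; exact (hI i hi).2
    · rw [hb]; exact hJ i hi
  -- The columns of `A`, read off from the rows: both layouts separate the factors, so a basis
  -- vector only reaches slots of its own factor.
  have hA0 : ∀ i ∈ c.I, A (stdVec N (c.offset i)) =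
      (4 * splitHeight c' i * r) • stdVec N (p i + 1) := by
    intro i hi
    have hs := size_of_mem_I hi
    refine hext _ _ (fun j hj => ?_) (fun j hj => ?_)
    · have hsj := size_of_mem_I hj
      have h1 := hO.lt_I hj
      have h2 := hL.lt_I hj
      rw [(hAI j hj _).1, (hAI j hj _).2, ← slotL_apply, ← slotL_apply, ← slotL_apply, ← slotL_apply,
        map_smul, map_smul]
      simp only [slotL_apply, smul_eq_mul]
      rw [slot_stdVec (by omega), slot_stdVec (by omega), slot_stdVec (by omega),
        slot_stdVec (by omega)]
      by_cases hij : j = i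
      · subst hij; simp
      · have := hO.sep _ _ hij
        have := hL.sep _ _ hij
        rw [if_neg (by omega), if_neg (by omega), if_neg (by omega), if_neg (by omega)]; simp
    · have hsj := size_of_mem_J hj
      have h1 := hO.lt_J hj
      have h2 := hL.lt_J hj
      have hij : j ≠ i := by rintro rfl; exact notMem_I hj hi
      have := hO.sep _ _ hij
      have := hL.sep _ _ hij
      rw [hAJ j hj, ← slotL_apply, ← slotL_apply, map_smul]
      simp only [slotL_apply, smul_eq_mul]
      rw [slot_stdVec h1, slot_stdVec h2, if_neg (by omega), if_neg (by omega)]; simp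
  have hA1 : ∀ i ∈ c.I, A (stdVec N (c.offset i + 1)) =
      (-(4 * splitHeight c' i)) • stdVec N (p i) := by
    intro i hi
    have hs := size_of_mem_I hi
    refine hext _ _ (fun j hj => ?_) (fun j hj => ?_)
    · have hsj := size_of_mem_I hj
      have h1 := hO.lt_I hj
      have h2 := hL.lt_I hj
      rw [(hAI j hj _).1, (hAI j hj _).2, ← slotL_apply, ← slotL_apply, ← slotL_apply, ← slotL_apply,
        map_smul, map_smul]
      simp only [slotL_apply, smul_eq_mul]
      rw [slot_stdVec (by omega), slot_stdVec (by omega), slot_stdVec (by omega),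
        slot_stdVec (by omega)]
      by_cases hij : j = i
      · subst hij; simp
      · have := hO.sep _ _ hij
        have := hL.sep _ _ hij
        rw [if_neg (by omega), if_neg (by omega), if_neg (by omega), if_neg (by omega)]; simp
    · have hsj := size_of_mem_J hj
      have h1 := hO.lt_J hj
      have h2 := hL.lt_J hj
      have hij : j ≠ i := by rintro rfl; exact notMem_I hj hi
      have := hO.sep _ _ hij
      have := hL.sep _ _ hij
      rw [hAJ j hj, ← slotL_apply, ← slotL_apply, map_smul]
      simp only [slotL_apply, smul_eq_mul]
      rw [slot_stdVec h1, slot_stdVec h2, if_neg (by omega), if_neg (by omega)]; simp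
  have hA2 : ∀ i ∈ c.J, A (stdVec N (c.offset i)) = (2 : ℝ) • stdVec N (p i) := by
    intro i hi
    have hs := size_of_mem_J hi
    refine hext _ _ (fun j hj => ?_) (fun j hj => ?_)
    · have hsj := size_of_mem_I hj
      have h1 := hO.lt_I hj
      have h2 := hL.lt_I hj
      have hij : j ≠ i := by rintro rfl; exact notMem_I hi hj
      have := hO.sep _ _ hij
      have := hL.sep _ _ hij
      rw [(hAI j hj _).1, (hAI j hj _).2, ← slotL_apply, ← slotL_apply, ← slotL_apply, ← slotL_apply,
        map_smul, map_smul]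
      simp only [slotL_apply, smul_eq_mul]
      rw [slot_stdVec (by omega), slot_stdVec (by omega), slot_stdVec (by omega),
        slot_stdVec (by omega)]
      rw [if_neg (by omega), if_neg (by omega), if_neg (by omega), if_neg (by omega)]; simp
    · have hsj := size_of_mem_J hj
      have h1 := hO.lt_J hj
      have h2 := hL.lt_J hj
      rw [hAJ j hj, ← slotL_apply, ← slotL_apply, map_smul]
      simp only [slotL_apply, smul_eq_mul]
      rw [slot_stdVec h1, slot_stdVec h2]
      by_cases hij : j = i
      · subst hij; simp
      · have := hO.sep _ _ hij
        have := hL.sep _ _ hij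
        rw [if_neg (by omega), if_neg (by omega)]
  -- The determinants of the single factors; for a disc it is `16 τ² r` with `τ² = 1/4`.
  let w : Fin m → ℝ := fun i => if i ∈ c.I then 4 * r else if i ∈ c.J then 2 else 1
  have hblock : ∀ i, ExteriorAlgebra.map A (c.block c.offset N i) = w i • c.block p N i := by
    intro i
    by_cases hi : i ∈ c.I
    · simp only [block, hi, if_true, map_mul, extGen, ExteriorAlgebra.map_apply_ι, hA0 i hi, hA1 i hi,
        map_smul, w]
      simp only [← extGen.eq_def]
      rw [smul_mul_smul_comm, extGen_mul_swap, smul_neg, ← neg_smul]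
      congr 1
      have : splitHeight c' i ^ 2 = 1 / 4 := by rw [← sq_abs, abs_splitHeight]; norm_num
      linear_combination 16 * r * this
    · by_cases hj : i ∈ c.J
      · simp only [block, hi, hj, if_true, if_false, extGen, ExteriorAlgebra.map_apply_ι, hA2 i hj,
          map_smul, w]
      · simp [block, hi, hj, w]
  -- `A` scales the blocks by the positive `w` and moves them to the positions `splitPos`;
  -- `prod_block` supplies the sign.
  have hdet : LinearMap.det A = ((List.finRange m).map w).prod *
      (unshuffleSign c'.J c''.J (List.finRange m) : ℝ) := by
    refine det_eq_of_map_extTop A ?_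
    rw [c.extTop_eq h.dim_eq, map_list_prod, List.map_map]
    have : (ExteriorAlgebra.map A ∘ c.block c.offset N) = fun i => w i • c.block p N i :=
      funext hblock
    rw [this, list_prod_map_smul, h.prod_block, ← c.extTop_eq h.dim_eq, mul_smul,
      Int.cast_smul_eq_zsmul]
  have hw : 0 < ((List.finRange m).map w).prod := by
    refine List.prod_pos ?_
    intro a ha
    obtain ⟨i, -, rfl⟩ := List.mem_map.1 ha
    simp only [w]
    split_ifs <;> positivity
  rw [hdet, sign_mul, sign_pos hw, one_mul]
  rcases unshuffleSign_eq c'.J c''.J (List.finRange m) with h | h <;> rw [h] <;> simp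

end SplitLayout

/-! ### Degrees of the diagonal approximation. -/

section Diagonal

variable {m : ℕ} {c c' c'' : Cell m}

lemma I_div_two_eq : Complex.I / 2 = ((1 / 2 : ℝ) : ℂ) * Complex.I := by push_cast; ring

lemma neg_I_div_two_eq : -(Complex.I / 2) = ((-(1 / 2) : ℝ) : ℂ) * Complex.I := by push_cast; ring

/-- The preimage of the centre of a product cell under the diagonal approximation. -/
lemma Cell.diag_preimage (hdim : c.dim = c'.dim + c''.dim) {n : ℕ} {x : Fin n → ℝ}
    (hx : ∀ a, |x a| < 1) (h : diagApprox (c.charMap x) = (c'.centre, c''.centre)) :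
    c.Splits c' c'' ∧
      (∀ i ∈ c.I, slot x (c.offset i) = 0 ∧ slot x (c.offset i + 1) = splitHeight c' i) ∧
      ∀ i ∈ c.J, slot x (c.offset i) = splitParam c' i := by
  have h1 : ∀ i, (if 0 ≤ (c.charMap x i).im then wrap (c.charMap x i) else 1) = c'.centre i :=
    fun i => congrFun (congrArg Prod.fst h) i
  have h2 : ∀ i, (if 0 ≤ (c.charMap x i).im then 1 else wrap (c.charMap x i)) = c''.centre i :=
    fun i => congrFun (congrArg Prod.snd h) i
  have aux : ∀ (d : Cell m) (i : Fin m) (w : ℂ), w = d.centre i → w ≠ -1 →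
      (i ∈ d.I ∧ w = 0) ∨ (i ∉ d.I ∧ i ∉ d.J) := by
    intro d i w hw hne
    by_cases hI : i ∈ d.I
    · exact Or.inl ⟨hI, hw.trans (centre_of_mem_I hI)⟩
    · by_cases hJ : i ∈ d.J
      · exact absurd (hw.trans (centre_of_mem_J hJ)) hne
      · exact Or.inr ⟨hI, hJ⟩
  -- In the last alternative the factor is lost, both components being `1` there; a count of
  -- dimensions excludes it below.
  have hI : ∀ i ∈ c.I, i ∉ c'.J ∧ i ∉ c''.J ∧
      ((i ∈ c'.I ∧ i ∉ c''.I ∧ slot x (c.offset i) = 0 ∧ slot x (c.offset i + 1) = 1 / 2) ∨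
        (i ∉ c'.I ∧ i ∈ c''.I ∧ slot x (c.offset i) = 0 ∧ slot x (c.offset i + 1) = -(1 / 2)) ∨
        (i ∉ c'.I ∧ i ∉ c''.I)) := by
    intro i hi
    have e1 := h1 i
    have e2 := h2 i
    have ht := abs_slot_lt hx (c.offset i + 1)
    have hlt := norm_squareToDisc_lt (abs_slot_lt hx (c.offset i)) ht
    rw [charMap_eq, charMapAt_apply_I hi] at e1 e2
    by_cases him : 0 ≤ (squareToDisc (slot x (c.offset i)) (slot x (c.offset i + 1))).im
    · rw [if_pos him] at e1 e2
      have e3 := notMem_of_centre_eq_one e2.symm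
      rcases aux c' i _ e1 (wrap_ne_neg_one hlt) with ⟨h4, h5⟩ | ⟨h4, h5⟩
      · refine ⟨fun h => notMem_I h h4, e3.2, Or.inl ⟨h4, e3.1, ?_⟩⟩
        rcases eq_of_wrap_eq_zero h5 with h6 | h6
        · exact eq_of_squareToDisc_eq ht.le (h6.trans I_div_two_eq)
        · rw [h6] at him; norm_num at him
      · exact ⟨h5, e3.2, Or.inr (Or.inr ⟨h4, e3.1⟩)⟩
    · rw [if_neg him] at e1 e2
      have e3 := notMem_of_centre_eq_one e1.symm
      rcases aux c'' i _ e2 (wrap_ne_neg_one hlt) with ⟨h4, h5⟩ | ⟨h4, h5⟩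
      · refine ⟨e3.2, fun h => notMem_I h h4, Or.inr (Or.inl ⟨e3.1, h4, ?_⟩)⟩
        rcases eq_of_wrap_eq_zero h5 with h6 | h6
        · rw [h6] at him; norm_num at him
        · exact eq_of_squareToDisc_eq ht.le (h6.trans neg_I_div_two_eq)
      · exact ⟨e3.2, h5, Or.inr (Or.inr ⟨e3.1, h4⟩)⟩
  have hJ : ∀ i ∈ c.J, i ∉ c'.I ∧ i ∉ c''.I ∧
      ((i ∈ c'.J ∧ i ∉ c''.J ∧ slot x (c.offset i) = -(1 / 2)) ∨
        (i ∉ c'.J ∧ i ∈ c''.J ∧ slot x (c.offset i) = 1 / 2) ∨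
        (i ∉ c'.J ∧ i ∉ c''.J)) := by
    intro i hi
    have e1 := h1 i
    have e2 := h2 i
    have hs := abs_slot_lt hx (c.offset i)
    rw [charMap_eq, charMapAt_apply_J hi, wrap_circle (norm_segToCircle _)] at e1 e2
    simp only [segToCircle_im_nonneg_iff hs] at e1 e2
    have hn : ‖segToCircle (slot x (c.offset i)) ^ 2‖ = 1 := by
      rw [norm_pow, norm_segToCircle, one_pow]
    by_cases him : slot x (c.offset i) ≤ 0
    · rw [if_pos him] at e1 e2
      have e3 := notMem_of_centre_eq_one e2.symm
      refine ⟨notMem_I_of_norm_centre (e1 ▸ hn), e3.1, ?_⟩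
      by_cases h4 : i ∈ c'.J
      · refine Or.inl ⟨h4, e3.2, ?_⟩
        rw [centre_of_mem_J h4] at e1
        have := abs_eq_of_segToCircle_sq hs e1
        rw [abs_of_nonpos him] at this
        linarith
      · exact Or.inr (Or.inr ⟨h4, e3.2⟩)
    · rw [if_neg him] at e1 e2
      have e3 := notMem_of_centre_eq_one e1.symm
      refine ⟨e3.1, notMem_I_of_norm_centre (e2 ▸ hn), ?_⟩
      by_cases h4 : i ∈ c''.J
      · refine Or.inr (Or.inl ⟨e3.2, h4, ?_⟩)
        rw [centre_of_mem_J h4] at e2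
        have := abs_eq_of_segToCircle_sq hs e2
        rwa [abs_of_pos (not_le.1 him)] at this
      · exact Or.inr (Or.inr ⟨e3.2, h4⟩)
  have h0 : ∀ i, i ∉ c.I → i ∉ c.J → (i ∉ c'.I ∧ i ∉ c'.J) ∧ i ∉ c''.I ∧ i ∉ c''.J := by
    intro i hiI hiJ
    have e1 := h1 i
    have e2 := h2 i
    rw [charMap_eq, charMapAt_apply_of_notMem hiI hiJ] at e1 e2
    simp only [Complex.one_im, le_refl, if_true, wrap_real] at e1 e2
    exact ⟨notMem_of_centre_eq_one e1.symm, notMem_of_centre_eq_one e2.symm⟩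
  have dI : Disjoint c'.I c''.I := by
    rw [Finset.disjoint_left]
    intro i hi hi'
    by_cases a : i ∈ c.I
    · have := hI i a; tauto
    · by_cases b : i ∈ c.J
      · have := hJ i b; tauto
      · have := h0 i a b; tauto
  have dJ : Disjoint c'.J c''.J := by
    rw [Finset.disjoint_left]
    intro i hi hi'
    by_cases a : i ∈ c.I
    · have := hI i a; tauto
    · by_cases b : i ∈ c.J
      · have := hJ i b; tauto
      · have := h0 i a b; tauto
  have sI : c'.I ∪ c''.I ⊆ c.I := by
    intro i hi
    rw [Finset.mem_union] at hi
    by_contra a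
    by_cases b : i ∈ c.J
    · have := hJ i b; tauto
    · have := h0 i a b; tauto
  have sJ : c'.J ∪ c''.J ⊆ c.J := by
    intro i hi
    rw [Finset.mem_union] at hi
    by_contra b
    by_cases a : i ∈ c.I
    · have := hI i a; tauto
    · have := h0 i a b; tauto
  -- The factors of `c'` and `c''` are disjoint and occur in `c`; equal dimensions leave no factor
  -- of `c` over.
  have k1 := Finset.card_le_card sI
  have k2 := Finset.card_le_card sJ
  rw [dim, dim, dim] at hdim
  rw [Finset.card_union_of_disjoint dI] at k1
  rw [Finset.card_union_of_disjoint dJ] at k2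
  have eI : c'.I ∪ c''.I = c.I :=
    Finset.eq_of_subset_of_card_le sI (by rw [Finset.card_union_of_disjoint dI]; omega)
  have eJ : c'.J ∪ c''.J = c.J :=
    Finset.eq_of_subset_of_card_le sJ (by rw [Finset.card_union_of_disjoint dJ]; omega)
  refine ⟨⟨eI.symm, dI, eJ.symm, dJ⟩, fun i hi => ?_, fun i hi => ?_⟩
  · have h3 := (hI i hi).2.2
    rw [← eI, Finset.mem_union] at hi
    rw [splitHeight]
    split_ifs with h4
    · tauto
    · tauto
  · have h3 := (hJ i hi).2.2
    rw [← eJ, Finset.mem_union] at hi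
    rw [splitParam]
    split_ifs with h4
    · tauto
    · tauto

/-- The constant is `√(1 - τ²/2)` for `τ² = 1/4`. -/
lemma hasFDerivAt_wrap_squareToDisc {τ : ℝ} (hτ : |τ| = 1 / 2) :
    HasFDerivAt (fun q : ℝ × ℝ => wrap (squareToDisc q.1 q.2))
      (((4 * τ * Complex.I) • (1 : ℂ →L[ℝ] ℂ)).comp (planeMap √(7 / 8) Complex.I)) (0, τ) := by
  have h := hasFDerivAt_squareToDisc τ (by rw [hτ]; norm_num)
  have h2 : 1 - τ ^ 2 / 2 = 7 / 8 := by rw [← sq_abs, hτ]; norm_num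
  rw [h2] at h
  have hw : HasFDerivAt wrap ((4 * τ * Complex.I) • (1 : ℂ →L[ℝ] ℂ))
      (squareToDisc ((0 : ℝ), τ).1 ((0 : ℝ), τ).2) := by
    rw [squareToDisc_zero_left]
    exact hasFDerivAt_wrap hτ
  exact hw.comp ((0 : ℝ), τ) h

lemma segToCircle_neg_half : segToCircle (-(1 / 2)) = Complex.I := by
  have h : Real.pi * (-(1 / 2)) = -(Real.pi / 2) := by ring
  rw [segToCircle_eq, h, Real.cos_neg, Real.sin_neg, Real.cos_pi_div_two, Real.sin_pi_div_two]
  apply Complex.ext <;> simp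

lemma segToCircle_half : segToCircle (1 / 2) = -Complex.I := by
  have h : Real.pi * (1 / 2) = Real.pi / 2 := by ring
  rw [segToCircle_eq, h, Real.cos_pi_div_two, Real.sin_pi_div_two]
  apply Complex.ext <;> simp

lemma Cell.continuous_charMap_apply (c : Cell m) {n : ℕ} (i : Fin m) :
    Continuous fun x : Fin n → ℝ => c.charMap x i := by
  have hs : ∀ a, Continuous fun x : Fin n → ℝ => slot x a := fun a =>
    continuous_iff_continuousAt.2 fun x => (hasFDerivAt_slot a x).continuousAt
  simp only [charMap_eq, charMapAt]
  split_ifs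
  · simp only [squareToDisc_eq]
    have h1 := hs (c.offset i)
    have h2 := hs (c.offset i + 1)
    fun_prop
  · have h1 := hs (c.offset i)
    simp only [segToCircle]
    fun_prop
  · exact continuous_const

/-- The derivative of the components with index `i ∈ d` of the diagonal approximation of a cell `c`
that splits off `d`; here `τ` is the height of the point of the disc. -/
noncomputable def Cell.diagDeriv (c d : Cell m) (τ : Fin m → ℝ) (n : ℕ) :
    (Fin n → ℝ) →L[ℝ] (Fin m → ℂ) :=
  ContinuousLinearMap.pi fun i =>
    if i ∈ d.I then (((4 * τ i * Complex.I) • (1 : ℂ →L[ℝ] ℂ)).comp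
      (planeMap √(7 / 8) Complex.I)).comp ((slotL n (c.offset i)).prod (slotL n (c.offset i + 1)))
    else if i ∈ d.J then (slotL n (c.offset i)).smulRight (-(2 * Real.pi * Complex.I))
    else 0

/-- `x` is mapped to the centre of `c' × c''` by the diagonal approximation of the cell `c`. -/
structure Cell.IsDiagPoint (c c' : Cell m) {n : ℕ} (x : Fin n → ℝ) : Prop where
  slot_I : ∀ i ∈ c.I, slot x (c.offset i) = 0 ∧ slot x (c.offset i + 1) = splitHeight c' i
  slot_J : ∀ i ∈ c.J, slot x (c.offset i) = splitParam c' i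

section Point

variable {n : ℕ} {x : Fin n → ℝ}

lemma Cell.Splits.mem_I_iff (h : c.Splits c' c'') {i : Fin m} : i ∈ c.I ↔ i ∈ c'.I ∨ i ∈ c''.I := by
  rw [h.I_eq, Finset.mem_union]

lemma Cell.Splits.mem_J_iff (h : c.Splits c' c'') {i : Fin m} : i ∈ c.J ↔ i ∈ c'.J ∨ i ∈ c''.J := by
  rw [h.J_eq, Finset.mem_union]

lemma Cell.IsDiagPoint.charMap_I (hx : c.IsDiagPoint c' x) {i : Fin m} (hi : i ∈ c.I) :
    c.charMap x i = splitHeight c' i * Complex.I := by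
  rw [charMap_eq, charMapAt_apply_I hi, (hx.slot_I i hi).1, (hx.slot_I i hi).2,
    squareToDisc_zero_left]

lemma Cell.IsDiagPoint.charMap_J (hx : c.IsDiagPoint c' x) {i : Fin m} (hi : i ∈ c.J) :
    c.charMap x i = segToCircle (splitParam c' i) := by
  rw [charMap_eq, charMapAt_apply_J hi, hx.slot_J i hi]

lemma Cell.Splits.im_pos (h : c.Splits c' c'') (hx : c.IsDiagPoint c' x) {i : Fin m}
    (hi : i ∈ c'.I ∨ i ∈ c'.J) : 0 < (c.charMap x i).im := by
  rcases hi with hi | hi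
  · rw [hx.charMap_I (h.mem_I_iff.2 (Or.inl hi)), splitHeight, if_pos hi]
    simp
  · rw [hx.charMap_J (h.mem_J_iff.2 (Or.inl hi)), splitParam, if_pos hi, segToCircle_neg_half]
    simp

lemma Cell.Splits.im_neg (h : c.Splits c' c'') (hx : c.IsDiagPoint c' x) {i : Fin m}
    (hi : i ∈ c''.I ∨ i ∈ c''.J) : (c.charMap x i).im < 0 := by
  have h' : ¬ (i ∈ c'.I ∨ i ∈ c'.J) := fun h' => by have := h.notMem_right h'; tauto
  rw [not_or] at h'
  rcases hi with hi | hi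
  · rw [hx.charMap_I (h.mem_I_iff.2 (Or.inr hi)), splitHeight, if_neg h'.1]
    simp
  · rw [hx.charMap_J (h.mem_J_iff.2 (Or.inr hi)), splitParam, if_neg h'.2, segToCircle_half]
    simp

lemma Cell.IsDiagPoint.wrap_I (hx : c.IsDiagPoint c' x) {i : Fin m} (hi : i ∈ c.I) :
    wrap (c.charMap x i) = 0 := by
  rw [hx.charMap_I hi, wrap_mul_I (abs_splitHeight _ _)]

lemma Cell.IsDiagPoint.wrap_J (hx : c.IsDiagPoint c' x) {i : Fin m} (hi : i ∈ c.J) :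
    wrap (c.charMap x i) = -1 := by
  rw [hx.charMap_J hi, wrap_circle (norm_segToCircle _), segToCircle_sq (abs_splitParam _ _)]

lemma Cell.Splits.charMap_of_notMem (h : c.Splits c' c'') {i : Fin m}
    (hi' : ¬ (i ∈ c'.I ∨ i ∈ c'.J)) (hi'' : ¬ (i ∈ c''.I ∨ i ∈ c''.J)) (x : Fin n → ℝ) :
    c.charMap x i = 1 :=
  charMapAt_apply_of_notMem (by rw [h.mem_I_iff]; tauto) (by rw [h.mem_J_iff]; tauto) _ _

lemma Cell.Splits.diagApprox_eq (h : c.Splits c' c'') (hx : c.IsDiagPoint c' x) :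
    diagApprox (c.charMap x) = (c'.centre, c''.centre) := by
  refine Prod.ext (funext fun i => ?_) (funext fun i => ?_) <;> simp only [diagApprox]
  -- One script for both components: a coordinate of `c'` is active in the first and `1` in the
  -- second, a coordinate of `c''` the other way round.
  all_goals
    by_cases hi' : i ∈ c'.I ∨ i ∈ c'.J
    · have hn := h.notMem_right hi'
      rw [if_pos (h.im_pos hx hi').le]
      first
      | rw [centre_of_notMem hn.1 hn.2]
      | rcases hi' with hi | hi
        · rw [centre_of_mem_I hi, hx.wrap_I (h.mem_I_iff.2 (Or.inl hi))]
        · rw [centre_of_mem_J hi, hx.wrap_J (h.mem_J_iff.2 (Or.inl hi))]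
    · by_cases hi'' : i ∈ c''.I ∨ i ∈ c''.J
      · have hn := not_or.1 hi'
        rw [if_neg (h.im_neg hx hi'').not_ge]
        first
        | rw [centre_of_notMem hn.1 hn.2]
        | rcases hi'' with hi | hi
          · rw [centre_of_mem_I hi, hx.wrap_I (h.mem_I_iff.2 (Or.inr hi))]
          · rw [centre_of_mem_J hi, hx.wrap_J (h.mem_J_iff.2 (Or.inr hi))]
      · rw [h.charMap_of_notMem hi' hi'', wrap_real (by simp), ite_self]
        rw [not_or] at hi' hi''
        first
        | rw [centre_of_notMem hi'.1 hi'.2]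
        | rw [centre_of_notMem hi''.1 hi''.2]

lemma Cell.IsDiagPoint.hasFDerivAt_wrap_I (hx : c.IsDiagPoint c' x) {i : Fin m} (hi : i ∈ c.I) :
    HasFDerivAt (fun x : Fin n → ℝ => wrap (c.charMap x i))
      ((((4 * splitHeight c' i * Complex.I) • (1 : ℂ →L[ℝ] ℂ)).comp
        (planeMap √(7 / 8) Complex.I)).comp
        ((slotL n (c.offset i)).prod (slotL n (c.offset i + 1)))) x := by
  simp only [charMap_eq, charMapAt_apply_I hi]
  refine hasFDerivAt_comp_slots (F := fun q : ℝ × ℝ => wrap (squareToDisc q.1 q.2)) ?_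
  rw [(hx.slot_I i hi).1, (hx.slot_I i hi).2]
  exact hasFDerivAt_wrap_squareToDisc (abs_splitHeight _ _)

lemma Cell.IsDiagPoint.hasFDerivAt_wrap_J (hx : c.IsDiagPoint c' x) {i : Fin m} (hi : i ∈ c.J) :
    HasFDerivAt (fun x : Fin n → ℝ => wrap (c.charMap x i))
      ((slotL n (c.offset i)).smulRight (-(2 * Real.pi * Complex.I))) x := by
  simp only [charMap_eq, charMapAt_apply_J hi]
  refine hasFDerivAt_comp_slot (F := fun s => wrap (segToCircle s)) ?_
  rw [hx.slot_J i hi]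
  exact hasDerivAt_wrap_segToCircle (abs_splitParam _ _)

/-- By continuity the case distinction in `diagApprox` is constant near such a point, so the map can
be differentiated there. -/
lemma Cell.eventually_im_pos {i : Fin m} (h : 0 < (c.charMap x i).im) :
    ∀ᶠ y in nhds x, 0 ≤ (c.charMap y i).im :=
  ((Complex.continuous_im.comp (c.continuous_charMap_apply i)).continuousAt.eventually_const_lt
    h).mono fun _ => le_of_lt

lemma Cell.eventually_im_neg {i : Fin m} (h : (c.charMap x i).im < 0) :
    ∀ᶠ y in nhds x, ¬ 0 ≤ (c.charMap y i).im :=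
  ((Complex.continuous_im.comp (c.continuous_charMap_apply i)).continuousAt.eventually_lt_const
    h).mono fun _ => not_le_of_gt

lemma Cell.Splits.hasFDerivAt_fst (h : c.Splits c' c'') (hx : c.IsDiagPoint c' x) :
    HasFDerivAt (fun x : Fin n → ℝ => (diagApprox (c.charMap x)).1)
      (c.diagDeriv c' (splitHeight c') n) x := by
  rw [hasFDerivAt_pi']
  intro i
  rw [diagDeriv, ContinuousLinearMap.proj_pi]
  simp only [diagApprox]
  by_cases hi' : i ∈ c'.I ∨ i ∈ c'.J
  · refine HasFDerivAt.congr_of_eventuallyEq (f := fun y => wrap (c.charMap y i)) ?_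
      ((eventually_im_pos (h.im_pos hx hi')).mono fun y hy => if_pos hy)
    rcases hi' with hi | hi
    · rw [if_pos hi]
      exact hx.hasFDerivAt_wrap_I (h.mem_I_iff.2 (Or.inl hi))
    · rw [if_neg (notMem_I hi), if_pos hi]
      exact hx.hasFDerivAt_wrap_J (h.mem_J_iff.2 (Or.inl hi))
  · have hn := not_or.1 hi'
    rw [if_neg hn.1, if_neg hn.2]
    by_cases hi'' : i ∈ c''.I ∨ i ∈ c''.J
    · exact HasFDerivAt.congr_of_eventuallyEq (hasFDerivAt_const (1 : ℂ) x)
        ((eventually_im_neg (h.im_neg hx hi'')).mono fun y hy => if_neg hy)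
    · simp only [h.charMap_of_notMem hi' hi'']
      exact hasFDerivAt_const _ _

lemma Cell.Splits.hasFDerivAt_snd (h : c.Splits c' c'') (hx : c.IsDiagPoint c' x) :
    HasFDerivAt (fun x : Fin n → ℝ => (diagApprox (c.charMap x)).2)
      (c.diagDeriv c'' (splitHeight c') n) x := by
  rw [hasFDerivAt_pi']
  intro i
  rw [diagDeriv, ContinuousLinearMap.proj_pi]
  simp only [diagApprox]
  by_cases hi' : i ∈ c'.I ∨ i ∈ c'.J
  · have hn := h.notMem_right hi'
    rw [if_neg hn.1, if_neg hn.2]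
    exact HasFDerivAt.congr_of_eventuallyEq (hasFDerivAt_const (1 : ℂ) x)
      ((eventually_im_pos (h.im_pos hx hi')).mono fun y hy => if_pos hy)
  · by_cases hi'' : i ∈ c''.I ∨ i ∈ c''.J
    · refine HasFDerivAt.congr_of_eventuallyEq (f := fun y => wrap (c.charMap y i)) ?_
        ((eventually_im_neg (h.im_neg hx hi'')).mono fun y hy => if_neg hy)
      rcases hi'' with hi | hi
      · rw [if_pos hi]
        exact hx.hasFDerivAt_wrap_I (h.mem_I_iff.2 (Or.inr hi))
      · rw [if_neg (notMem_I hi), if_pos hi]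
        exact hx.hasFDerivAt_wrap_J (h.mem_J_iff.2 (Or.inr hi))
    · have hn := not_or.1 hi''
      rw [if_neg hn.1, if_neg hn.2]
      simp only [h.charMap_of_notMem hi' hi'']
      exact hasFDerivAt_const _ _

end Point

lemma Cell.exists_isDiagPoint (c c' : Cell m) {n : ℕ} (hn : c.dim = n) :
    ∃ x : Fin n → ℝ, c.IsDiagPoint c' x ∧ ∀ a, |x a| < 1 := by
  subst hn
  obtain ⟨x, hI, hJ, h⟩ := c.isLayout_offset.exists_of_surjective (fun _ => c.exists_slot)
    (fun i => if i ∈ c.I then 0 else splitParam c' i) (splitHeight c')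
  refine ⟨x, ⟨fun i hi => ?_, fun i hi => ?_⟩, fun a => ?_⟩
  · have h1 := c.isLayout_offset.lt_I hi
    rw [slot_of_lt _ h1, slot_of_lt _ ((Nat.lt_succ_self _).trans h1), (hI i hi).1, (hI i hi).2,
      if_pos hi]
    exact ⟨rfl, rfl⟩
  · rw [slot_of_lt _ (c.isLayout_offset.lt_J hi), hJ i hi, if_neg (notMem_I hi)]
  · obtain ⟨i, h | h⟩ := h a
    · rw [h]
      split_ifs
      · simp
      · rw [abs_splitParam]; norm_num
    · rw [h, abs_splitHeight]; norm_num

lemma Cell.IsDiagPoint.eq {n : ℕ} (hn : n ≤ c.dim) {x y : Fin n → ℝ} (hx : c.IsDiagPoint c' x)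
    (hy : c.IsDiagPoint c' y) : x = y := by
  funext b
  rw [← slot_of_lt x b.2, ← slot_of_lt y b.2]
  obtain ⟨i, ⟨hi, hb | hb⟩ | ⟨hi, hb⟩⟩ := c.exists_slot (b.2.trans_le hn)
  · rw [hb, (hx.slot_I i hi).1, (hy.slot_I i hi).1]
  · rw [hb, (hx.slot_I i hi).2, (hy.slot_I i hi).2]
  · rw [hb, hx.slot_J i hi, hy.slot_J i hi]

lemma prodCharMap_zero (c' c'' : Cell m) : prodCharMap c' c'' 0 = (c'.centre, c''.centre) := by
  rw [prodCharMap_eq, Cell.charMapAt_zero, Cell.charMapAt_zero]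

lemma hasFDerivAt_prodCharMap (c' c'' : Cell m) :
    HasFDerivAt (prodCharMap c' c'')
      ((c'.charDeriv c'.offset (c'.dim + c''.dim)).prod
        (c''.charDeriv (fun i => c'.dim + c''.offset i) (c'.dim + c''.dim))) 0 := by
  rw [funext (prodCharMap_eq c' c'')]
  exact (c'.hasFDerivAt_charMapAt _).prodMk (c''.hasFDerivAt_charMapAt _)

lemma injective_prod_charDeriv (c' c'' : Cell m) :
    Function.Injective ((c'.charDeriv c'.offset (c'.dim + c''.dim)).prod
        (c''.charDeriv (fun i => c'.dim + c''.offset i) (c'.dim + c''.dim))) := by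
  rw [injective_iff_map_eq_zero]
  intro v hv
  rw [ContinuousLinearMap.prod_apply, Prod.mk_eq_zero] at hv
  funext b
  rw [← slot_of_lt v b.2, Pi.zero_apply]
  by_cases hb : (b : ℕ) < c'.dim
  · have := Cell.slot_eq_zero_of_charDeriv (c := c') (a := 0) (v := v) (by simpa using hv.1) hb
    rwa [zero_add] at this
  · have hb2 := b.2
    have := Cell.slot_eq_zero_of_charDeriv (c := c'') hv.2 (b := b - c'.dim) (by omega)
    rwa [Nat.add_sub_cancel' (not_lt.1 hb)] at this

lemma Cell.Splits.localSign_eq (h : c.Splits c' c'') {x : Fin (c'.dim + c''.dim) → ℝ}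
    (hx : c.IsDiagPoint c' x) :
    localSign (fun x : Fin (c'.dim + c''.dim) → ℝ => diagApprox (c.charMap x)) x
      (prodCharMap c' c'') 0 = unshuffleSign c'.J c''.J (List.finRange m) := by
  obtain ⟨A, hI, hJ, hsign⟩ := h.exists_linearMap √(7 / 8) (Real.sqrt_pos.2 (by norm_num))
  have hf : HasFDerivAt (fun x : Fin (c'.dim + c''.dim) → ℝ => diagApprox (c.charMap x))
      ((c.diagDeriv c' (splitHeight c') _).prod (c.diagDeriv c'' (splitHeight c') _)) x :=
    (h.hasFDerivAt_fst hx).prodMk (h.hasFDerivAt_snd hx)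
  -- Used for `c'` with its own offsets and for `c''` with the shifted ones; both components factor
  -- through the same `A`.
  have key : ∀ (d : Cell m) (q : Fin m → ℕ), d.I ⊆ c.I → d.J ⊆ c.J →
      (∀ i, i ∈ d.I ∨ i ∈ d.J → splitPos c' c'' i = q i) → ∀ v,
      c.diagDeriv d (splitHeight c') _ v = d.charDeriv q _ (A v) := by
    intro d q hdI hdJ hq v
    funext i
    by_cases hi : i ∈ d.I
    · rw [charDeriv_apply_I hi, ← hq i (Or.inl hi), (hI i (hdI hi) v).1, (hI i (hdI hi) v).2]
      simp only [diagDeriv, ContinuousLinearMap.pi_apply, if_pos hi, ContinuousLinearMap.comp_apply,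
        planeMap_apply, ContinuousLinearMap.prod_apply, slotL_apply, smul_apply,
        one_apply_eq_self, smul_eq_mul]
      push_cast
      linear_combination (4 * splitHeight c' i * slot v (c.offset i + 1)) * Complex.I_sq
    · by_cases hj : i ∈ d.J
      · rw [charDeriv_apply_J hj, ← hq i (Or.inr hj), hJ i (hdJ hj) v]
        simp only [diagDeriv, ContinuousLinearMap.pi_apply, if_neg hi, if_pos hj,
          ContinuousLinearMap.smulRight_apply, slotL_apply, Complex.real_smul]
        push_cast
        ring
      · rw [charDeriv_apply_of_notMem hi hj]
        simp [diagDeriv, hi, hj]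
  rw [MomentAngle.localSign_eq hf (hasFDerivAt_prodCharMap c' c'') (injective_prod_charDeriv c' c'')
    A, hsign]
  intro v
  refine Prod.ext ?_ ?_
  · exact key c' _ (h.I_eq ▸ Finset.subset_union_left) (h.J_eq ▸ Finset.subset_union_left)
      (fun i hi => splitPos_left hi) v
  · exact key c'' _ (h.I_eq ▸ Finset.subset_union_right) (h.J_eq ▸ Finset.subset_union_right)
      (fun i hi => h.splitPos_right hi) v

/-- The centre of `c' × c''` has exactly one preimage in the open cube: the zero `i/2` or `-i/2` of
`wrap` in every disc and the parameter `∓1/2` in every circle. -/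
lemma diagDegree_of_splits (h : c.Splits c' c'') :
    diagDegree c c' c'' = unshuffleSign c'.J c''.J (List.finRange m) := by
  obtain ⟨x₀, hx₀, h₀⟩ := c.exists_isDiagPoint c' h.dim_eq
  rw [diagDegree, if_pos h.dim_eq, localDegree_eq_localSign h₀, h.localSign_eq hx₀]
  · rw [prodCharMap_zero, h.diagApprox_eq hx₀]
  · intro x hx hfx
    rw [prodCharMap_zero] at hfx
    obtain ⟨-, h1, h2⟩ := Cell.diag_preimage h.dim_eq hx hfx
    exact Cell.IsDiagPoint.eq h.dim_eq.ge ⟨h1, h2⟩ hx₀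

lemma diagDegree_of_not_splits (h : ¬ c.Splits c' c'') : diagDegree c c' c'' = 0 := by
  rw [diagDegree]
  split_ifs with hdim
  · refine localDegree_eq_zero fun x hx hfx => ?_
    rw [prodCharMap_zero] at hfx
    exact h (Cell.diag_preimage hdim hx hfx).1
  · rfl

end Diagonal

/-! ### Comparison of the structure constants. -/

section Main

variable (k : Type*) [Field k] {m : ℕ} (K : AbstractSimplicialComplex (Fin m))

lemma cellularDGA_d_apply (a : CellCochain k K) (c : ZCell K) :
    (cellularDGA k K).d a (Finsupp.single c 1) =
      ∑ c' : ZCell K, (incidence c.1 c'.1 : k) * a (Finsupp.single c' 1) := by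
  change a (cellBoundary k K (Finsupp.single c 1)) = _
  simp only [cellBoundary, Finsupp.linearCombination_single, one_smul, map_sum, map_smul,
    smul_eq_mul]

lemma cellularDGA_mul_apply (a b : CellCochain k K) (c : ZCell K) :
    (cellularDGA k K).mul a b (Finsupp.single c 1) =
      ∑ p : ZCell K × ZCell K, (diagDegree c.1 p.1.1 p.2.1 : k) *
        (a (Finsupp.single p.1 1) * b (Finsupp.single p.2 1)) := by
  change crossProd k K a b (diagChain k K (Finsupp.single c 1)) = _
  simp [diagChain, crossProd]

lemma cellCoeff_koszulD_eq_incidence (c c' : ZCell K) :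
    cellCoeff k K c (koszulD k K (cellMonomial k K c')) = (incidence c.1 c'.1 : k) := by
  by_cases h : ∃ i, c.1.IsFace c'.1 i
  · obtain ⟨i, h⟩ := h
    rw [cellCoeff_koszulD_of_isFace k K h, incidence_of_isFace h]
    simp
  · rw [not_exists] at h
    rw [cellCoeff_koszulD_of_not_isFace k K h, incidence_of_not_isFace h, Int.cast_zero]

/-- Both sides have been reduced to the same `unshuffleSign`, whose value is never needed. -/
lemma cellCoeff_mul_eq_diagDegree (c c' c'' : ZCell K) :
    cellCoeff k K c (cellMonomial k K c' * cellMonomial k K c'' : Koszul k K) =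
      (diagDegree c.1 c'.1 c''.1 : k) := by
  by_cases h : c.1.Splits c'.1 c''.1
  · rw [cellCoeff_mul_of_splits k K h, diagDegree_of_splits h]
  · rw [cellCoeff_mul_of_not_splits k K h, diagDegree_of_not_splits h, Int.cast_zero]

lemma cellCochain_ext {a b : CellCochain k K}
    (h : ∀ c, a (Finsupp.single c 1) = b (Finsupp.single c 1)) : a = b := by
  ext c
  exact h c

lemma toCochain_isIso : (koszulDGA k K).IsIso (cellularDGA k K) (toCochain k K) where
  map_one := by
    refine cellCochain_ext k K fun c => ?_
    have h : (1 : Koszul k K) = monomialVU k K ∅ ∅ := by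
      simp [monomialVU, vMon, uMon, Algebra.TensorProduct.one_def]
    have h1 : (cellularDGA k K).one (Finsupp.single c 1) = if c.1.dim = 0 then (1 : k) else 0 := by
      change Finsupp.linearCombination k _ _ = _
      simp
    rw [toCochain_apply, h1]
    change cellCoeff k K c (koszulProj k K 1) = _
    rw [cellCoeff_koszulProj, h, cellCoeff, monoCoeff_monomialVU]
    congr 1
    -- Dimension `0` means `I = J = ∅`, so the unit cochain corresponds to the monomial `1`.
    simp [Cell.dim, eq_comm]
  map_mul a b := by
    refine cellCochain_ext k K fun c => ?_
    rw [toCochain_apply, cellularDGA_mul_apply, koszulDGA_mul, cellCoeff_koszulProj,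
      Fintype.sum_prod_type]
    simp only [toCochain_apply, ← cellCoeff_mul_eq_diagDegree]
    conv_lhs => rw [eq_sum_cellMonomial k K a, eq_sum_cellMonomial k K b]
    simp only [Submodule.coe_sum, Submodule.coe_smul, Finset.sum_mul_sum, map_sum,
      smul_mul_smul_comm, map_smul, smul_eq_mul]
    refine Finset.sum_congr rfl fun c' _ => Finset.sum_congr rfl fun c'' _ => ?_
    ring
  map_d a := by
    refine cellCochain_ext k K fun c => ?_
    rw [toCochain_apply, cellularDGA_d_apply, koszulDGA_d_coe]
    simp only [toCochain_apply, ← cellCoeff_koszulD_eq_incidence]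
    conv_lhs => rw [eq_sum_cellMonomial k K a]
    simp only [Submodule.coe_sum, Submodule.coe_smul, map_sum, map_smul, smul_eq_mul]
    exact Finset.sum_congr rfl fun c' _ => mul_comm _ _
  map_deg := map_deg_toCochain k K

end Main

end MomentAngle

theorem mainTheorem4 (k : Type*) [Field k] {m : ℕ} (K : AbstractSimplicialComplex (Fin m)) :
    (∀ c : MomentAngle.Cell m,
      c.openCell ⊆ MomentAngle.momentAngle K ↔ MomentAngle.IsSimplex K c.I) ∧
    (MomentAngle.koszulDGA k K).IsDGA ∧
    (MomentAngle.cellularDGA k K).IsDGA ∧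
    ∃! φ : MomentAngle.reducedKoszul k K ≃ₗ[k] MomentAngle.CellCochain k K,
      (MomentAngle.koszulDGA k K).IsIso (MomentAngle.cellularDGA k K) φ ∧
      ∀ (c : MomentAngle.Cell m) (hc : c.openCell ⊆ MomentAngle.momentAngle K),
        φ ⟨MomentAngle.monomialVU k K c.I c.J, MomentAngle.monomialVU_mem k K c.disj⟩ =
          MomentAngle.dualCell k K ⟨c, hc⟩ := by
  refine ⟨MomentAngle.openCell_subset_iff K, MomentAngle.koszulDGA_isDGA k K,
    (MomentAngle.koszulDGA_isDGA k K).of_isIso (MomentAngle.toCochain_isIso k K),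
    MomentAngle.toCochain k K, ⟨MomentAngle.toCochain_isIso k K,
      fun c hc => MomentAngle.toCochain_cellMonomial k K ⟨c, hc⟩⟩, ?_⟩
  -- Uniqueness: the values on the monomials are prescribed, and the monomials span.
  rintro φ ⟨-, hφ⟩
  refine LinearEquiv.toLinearMap_injective (LinearMap.ext fun x => ?_)
  rw [LinearEquiv.coe_coe, LinearEquiv.coe_coe, MomentAngle.eq_sum_cellMonomial k K x, map_sum,
    map_sum]
  refine Finset.sum_congr rfl fun c _ => ?_
  rw [map_smul, map_smul, MomentAngle.toCochain_cellMonomial]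
  exact congrArg _ (hφ c.1 c.2)
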